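/- **Theorem A.** Let $k$ be a perfect field of characteristic $p>0$, let $X=\operatorname{Spec}R$ be a normal affine variety over $k$ (so $R$ is a normal domain of finite type over $k$), and put $d=\dim X$. Let $\iota\colon U\hookrightarrow X$ be the smooth locus and $\operatorname{Sing}(X)=X\setminus U$. *Notation.* For a smooth variety $U$ let $B\Omega^i_U$ and $Z\Omega^i_U$ be the image and the kernel of $F_*d$ in $F_*\Omega^i_U$, and let $C\colon Z\Omega^i_U\to\Omega^i_U$ be the Cartier operator, the $\mathcal O_U$-linear surjection with kernel $B\Omega^i_U$ such that $C(a^p x_1^{p-1}dx_1\wedge\dots\wedge x_i^{p-1}dx_i)=a\,dx_1\wedge\dots\wedge dx_i$. Put $Z_0\Omega^i_U=\Omega^i_U$, $C_0=\mathrm{id}$, $B_0\Omega^i_U=0$ and, inductively, let $Z_{n+1}\Omega^i_U\subseteq F^{n+1}_*\Omega^i_U$ be the kernel of $d\circ C_n$ on $Z_n\Omega^i_U$, let $C_{n+1}=C_n\circ C\colon Z_{n+1}\Omega^i_U\to\Omega^i_U$, and let $B_{n+1}\Omega^i_U$ be the preimage of $B_n\Omega^i_U$ under $C$ (so $Z_1=Z$,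 $C_1=C$, $B_1=B$). Put $\Omega^{[i]}_X=\iota_*\Omega^i_U$, $Z_n\Omega^{[i]}_X=\iota_*Z_n\Omega^i_U$, $B_n\Omega^{[i]}_X=\iota_*B_n\Omega^i_U$; there are induced exact sequences $0\to B_n\Omega^{[i]}_X\to Z_n\Omega^{[i]}_X\xrightarrow{C_n}\Omega^{[i]}_X$. If $C\colon Z\Omega^{[i]}_X\to\Omega^{[i]}_X$ is surjective, then so is every $C_n$, and one sets $$C_n^{-1}\colon \Omega^{[i]}_X\xleftarrow[\ \cong\ ]{C_n} \frac{Z_n\Omega^{[i]}_X}{B_n\Omega^{[i]}_X}\hookrightarrow\frac{F^n_*\Omega^{[i]}_X}{B_n\Omega^{[i]}_X}.$$ For a Cartier divisor $D\ge 0$ let $\Omega^{[i]}_X(D)=\Omega^{[i]}_X\otimes\mathcal O_X(D)$. For a closed point $\mathfrak m$, $H^j_{\mathfrak m}$ is local cohomology, and $\delta\colon H^j_{\mathfrak m}(F^n_*\Omega^{[i]}_X/B_n\Omega^{[i]}_X)\to H^{j+1}_{\mathfrak m}(B_n\Omega^{[i]}_X)$ is the connecting map of $0\to B_n\Omega^{[i]}_X\to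 F^n_*\Omega^{[i]}_X\to F^n_*\Omega^{[i]}_X/B_n\Omega^{[i]}_X\to0$. All indices $i,j,n$ are non-negative integers. $X$ is *$F$-rational* if for every closed point $\mathfrak m\in X$ and every Cartier divisor $D\ge0$ there is $n_0>0$ such that $H^j_{\mathfrak m}(\mathcal O_X)\xrightarrow{F^n}H^j_{\mathfrak m}(F^n_*\mathcal O_X)\to H^j_{\mathfrak m}(F^n_*\mathcal O_X(D))$ is injective for all $j\le d$ and $n\ge n_0$. $X$ is *pre-$m$-$F$-rational* if $C\colon Z\Omega^{[i]}_X\to\Omega^{[i]}_X$ is surjective for all $i\le m$, and for every closed point $\mathfrak m\in X$ and every Cartier divisor $D\ge0$ there is $n_0>0$ such that $$H^j_{\mathfrak m}(\Omega^{[i]}_X)\xrightarrow{C_n^{-1}}H^j_{\mathfrak m}\left(\frac{F^n_*\Omega^{[i]}_X}{B_n\Omega^{[i]}_X}\right)\xrightarrow{\mathrm{nat}}H^j_{\mathfrak m}\left(\frac{F^n_*\Omega^{[i]}_X(D)}{B_n\Omega^{[i]}_X}\right)\qquad(\ast)_D$$ is injective whenever $i\le m$, $i+j\le d$ and $n\ge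 n_0$. *Statement.* Let $m>0$ and assume that $C\colon Z\Omega^{[i]}_X\to\Omega^{[i]}_X$ is surjective for all $i\le m$. Then the following are equivalent: 1. $X$ is pre-$m$-$F$-rational; 2. there is a Cartier divisor $D\ge0$ on $X$ containing $\operatorname{Sing}(X)$ such that for every closed point $\mathfrak m\in X$ and every integer $r>0$ there is $n_0>0$ such that the composition $(\ast)_{rD}$ is injective whenever $0\le i\le m$, $i+j\le d$ and $n\ge n_0$; 3. $X$ is $F$-rational, and for every closed point $\mathfrak m\in X$ there is $n_0>0$ such that $\delta\circ C_n^{-1}\colon H^j_{\mathfrak m}(\Omega^{[i]}_X)\to H^{j+1}_{\mathfrak m}(B_n\Omega^{[i]}_X)$ is injective whenever $0<i\le m$, $i+j\le d$ and $n\ge n_0$; 4. $X$ is $F$-rational, and for every closed point $\mathfrak m\in X$ there is $n_0>0$ such that $C_n\colon H^j_{\mathfrak m}(Z_n\Omega^{[i]}_X)\to H^j_{\mathfrak m}(\Omega^{[i]}_X)$ is zero whenever $0<i\le m$, $i+j\le d$ and $n\ge n_0$. -/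

import Mathlib

universe u v

noncomputable section

open CategoryTheory
open scoped nonZeroDivisors

section ExteriorDerivative

variable (k : Type v) (A : Type u) [CommRing k] [CommRing A] [Algebra k A]

/-- The algebra of Kähler differential forms of `A` over `k`; its degree `i` part is
`⋀[A]^i Ω[A⁄k]`. -/
abbrev DiffForms : Type u := ExteriorAlgebra A (Ω[A⁄k])

variable {A}

/-- The exact one-form `da`, as an element of the algebra of forms. -/
def dOne (a : A) : DiffForms k A := ExteriorAlgebra.ι A (KaehlerDifferential.D k A a)

variable (A)

/-- Pairs of forms `(ω, θ)` with the `A`-module structure `a (ω, θ) = (a ω, a θ + da ∧ ω)`.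
For this structure `ω ↦ (ω, dω)` is `A`-linear, which is how `d` is constructed below. -/
def FormPair : Type u := DiffForms k A × DiffForms k A

instance : AddCommGroup (FormPair k A) :=
  inferInstanceAs (AddCommGroup (DiffForms k A × DiffForms k A))

namespace FormPair

variable {k A}

/-- The pair `(ω, θ)`. -/
def mk (ω θ : DiffForms k A) : FormPair k A := (ω, θ)

/-- The first component. -/
def fst (x : FormPair k A) : DiffForms k A := Prod.fst x

/-- The second component. -/
def snd (x : FormPair k A) : DiffForms k A := Prod.snd x

theorem ext {x y : FormPair k A} (h₁ : x.fst = y.fst) (h₂ : x.snd = y.snd) : x = y :=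
  Prod.ext h₁ h₂

@[simp] theorem fst_mk (ω θ : DiffForms k A) : (mk ω θ).fst = ω := rfl
@[simp] theorem snd_mk (ω θ : DiffForms k A) : (mk ω θ).snd = θ := rfl
@[simp] theorem fst_add (x y : FormPair k A) : (x + y).fst = x.fst + y.fst := rfl
@[simp] theorem snd_add (x y : FormPair k A) : (x + y).snd = x.snd + y.snd := rfl
@[simp] theorem fst_zero : (0 : FormPair k A).fst = 0 := rfl
@[simp] theorem snd_zero : (0 : FormPair k A).snd = 0 := rfl

instance : SMul A (FormPair k A) where
  smul a x := mk (a • x.fst) (a • x.snd + dOne k a * x.fst)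

@[simp] theorem fst_smul (a : A) (x : FormPair k A) : (a • x).fst = a • x.fst := rfl
@[simp] theorem snd_smul (a : A) (x : FormPair k A) :
    (a • x).snd = a • x.snd + dOne k a * x.fst := rfl

instance : Module A (FormPair k A) where
  one_smul x := ext (by simp) (by simp [dOne])
  mul_smul a b x := ext (by simp [mul_smul]) (by
    simp only [snd_smul, fst_smul, dOne, Derivation.leibniz, map_add, map_smul, add_mul,
      smul_mul_assoc, mul_smul_comm, smul_add, mul_smul]
    abel)
  smul_zero a := ext (by simp) (by simp)
  smul_add a x y := ext (by simp) (by
    simp only [snd_smul, snd_add, fst_add, smul_add, mul_add]; abel)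
  add_smul a b x := ext (by simp [add_smul]) (by
    simp only [snd_smul, snd_add, dOne, map_add, add_smul, add_mul]; abel)
  zero_smul x := ext (by simp) (by simp [dOne])

instance : Module k (FormPair k A) := Module.compHom _ (algebraMap k A)

instance : IsScalarTower k A (FormPair k A) := IsScalarTower.of_algebraMap_smul fun _ _ => rfl

end FormPair

theorem ι_mul_ι_anticomm {A : Type u} [CommRing A] {M : Type u} [AddCommGroup M] [Module A M]
    (μ ν : M) : ExteriorAlgebra.ι A μ * ExteriorAlgebra.ι A ν =
      -(ExteriorAlgebra.ι A ν * ExteriorAlgebra.ι A μ) :=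
  eq_neg_of_add_eq_zero_left (ExteriorAlgebra.ι_add_mul_swap μ ν)

/-- The derivation `a ↦ (da, 0)`. -/
def pairDerivation : Derivation k A (FormPair k A) :=
  Derivation.mk'
    { toFun := fun a => FormPair.mk (dOne k a) 0
      map_add' := fun a b => FormPair.ext (by simp [dOne]) (by simp)
      map_smul' := fun c a => by
        rw [RingHom.id_apply, ← algebraMap_smul A c (FormPair.mk (dOne k a) 0)]
        exact FormPair.ext (by rw [FormPair.fst_smul]; simp [dOne])
          (by rw [FormPair.snd_smul]; simp [dOne]) }
    fun a b => FormPair.ext (by simp [dOne]) (by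
      simp only [LinearMap.coe_mk, AddHom.coe_mk, FormPair.snd_mk, FormPair.snd_add,
        FormPair.snd_smul, FormPair.fst_mk, smul_zero, zero_add, dOne]
      rw [ι_mul_ι_anticomm, neg_add_cancel])

/-- `μ ↦ (μ, dμ)` on one-forms. -/
def pairOne : Ω[A⁄k] →ₗ[A] FormPair k A := (pairDerivation k A).liftKaehlerDifferential

variable {A}

theorem pairOne_D (a : A) : pairOne k A (KaehlerDifferential.D k A a) = FormPair.mk (dOne k a) 0 :=
  Derivation.liftKaehlerDifferential_comp_D _ _

theorem pairOne_fst (μ : Ω[A⁄k]) : (pairOne k A μ).fst = ExteriorAlgebra.ι A μ := by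
  have h : μ ∈ Submodule.span A (Set.range (KaehlerDifferential.D k A)) := by
    rw [KaehlerDifferential.span_range_derivation]; trivial
  induction h using Submodule.span_induction with
  | mem x hx => obtain ⟨a, rfl⟩ := hx; rw [pairOne_D]; rfl
  | zero => simp
  | add x y _ _ hx hy => simp [hx, hy]
  | smul a x _ hx => simp [hx]

theorem pairOne_snd_comm (μ ν : Ω[A⁄k]) :
    (pairOne k A μ).snd * ExteriorAlgebra.ι A ν = ExteriorAlgebra.ι A ν * (pairOne k A μ).snd := by
  have h : μ ∈ Submodule.span A (Set.range (KaehlerDifferential.D k A)) := by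
    rw [KaehlerDifferential.span_range_derivation]; trivial
  induction h using Submodule.span_induction with
  | mem x hx => obtain ⟨a, rfl⟩ := hx; rw [pairOne_D]; simp
  | zero => simp
  | add x y _ _ hx hy => simp [add_mul, mul_add, hx, hy]
  | smul a x _ hx =>
    simp only [map_smul, FormPair.snd_smul, add_mul, mul_add, smul_mul_assoc, mul_smul_comm, hx,
      pairOne_fst, dOne]
    congr 1
    rw [mul_assoc, ι_mul_ι_anticomm x ν, mul_neg, ← mul_assoc, ι_mul_ι_anticomm _ ν, neg_mul,
      neg_neg, mul_assoc]

/-- `(ω, θ) ↦ (μ ∧ ω, dμ ∧ ω - μ ∧ θ)`, the effect of `μ ∧ -` on pairs `(ω, dω)`. -/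
def pairWedge : Ω[A⁄k] →ₗ[A] FormPair k A →ₗ[A] FormPair k A :=
  LinearMap.mk₂ A
    (fun μ x => FormPair.mk (ExteriorAlgebra.ι A μ * x.fst)
      ((pairOne k A μ).snd * x.fst - ExteriorAlgebra.ι A μ * x.snd))
    (fun μ ν x => FormPair.ext (by simp [add_mul]) (by simp [add_mul]; abel))
    (fun a μ x => FormPair.ext (by simp) (by
      simp only [map_smul, FormPair.snd_smul, FormPair.snd_mk, FormPair.fst_mk, add_mul,
        smul_mul_assoc, pairOne_fst, smul_sub, mul_assoc]; abel))
    (fun μ x y => FormPair.ext (by simp [mul_add]) (by simp [mul_add]; abel))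
    (fun a μ x => FormPair.ext (by simp) (by
      simp only [FormPair.snd_smul, FormPair.fst_smul, FormPair.snd_mk, FormPair.fst_mk, mul_add,
        mul_smul_comm, smul_sub, ← mul_assoc, dOne]
      rw [ι_mul_ι_anticomm μ]
      simp only [neg_mul]
      abel))

theorem pairWedge_sq (μ : Ω[A⁄k]) (x : FormPair k A) :
    pairWedge k μ (pairWedge k μ x) = (0 : QuadraticForm A (Ω[A⁄k])) μ • x := by
  rw [show (0 : QuadraticForm A (Ω[A⁄k])) μ = 0 from rfl, zero_smul]
  refine FormPair.ext ?_ ?_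
  · simp [pairWedge, ← mul_assoc]
  · simp [pairWedge, mul_sub, ← mul_assoc, pairOne_snd_comm]

/-- `ω ↦ (ω, dω)`. -/
def formPair : DiffForms k A →ₗ[A] FormPair k A :=
  CliffordAlgebra.foldr 0 (pairWedge k) (pairWedge_sq k) (FormPair.mk 1 0)

/-- The exterior derivative `d` on Kähler differential forms: the additive map with
`d a = da` on functions, `d (da) = 0`, and `d (μ ∧ ω) = dμ ∧ ω - μ ∧ dω` for one-forms `μ`. -/
def extD : DiffForms k A →+ DiffForms k A where
  toFun ω := (formPair k ω).snd
  map_zero' := by simp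
  map_add' := by simp

theorem formPair_ι_mul (μ : Ω[A⁄k]) (ω : DiffForms k A) :
    formPair k (ExteriorAlgebra.ι A μ * ω) = pairWedge k μ (formPair k ω) := by
  simp [formPair]

theorem formPair_fst (ω : DiffForms k A) : (formPair k ω).fst = ω := by
  induction ω using CliffordAlgebra.left_induction with
  | algebraMap r => simp [formPair, Algebra.algebraMap_eq_smul_one]
  | add x y hx hy => simp [hx, hy]
  | ι_mul x m hx =>
    rw [formPair_ι_mul]; simp [pairWedge, hx]

theorem extD_smul (a : A) (ω : DiffForms k A) :
    extD k (a • ω) = a • extD k ω + dOne k a * ω := by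
  simp [extD, formPair_fst]

theorem extD_dOne_mul (a : A) (ω : DiffForms k A) :
    extD k (dOne k a * ω) = -(dOne k a * extD k ω) := by
  simp [extD, dOne, formPair_ι_mul, pairWedge, pairOne_D]

theorem extD_one : extD k (1 : DiffForms k A) = 0 := by
  simp [extD, formPair]

theorem extD_pow_smul (p : ℕ) [CharP A p] (a : A) (ω : DiffForms k A) :
    extD k (a ^ p • ω) = a ^ p • extD k ω := by
  rw [extD_smul]
  simp [dOne, Derivation.leibniz_pow, ← Nat.cast_smul_eq_nsmul A]

end ExteriorDerivative

section LocalForms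

variable (k : Type v) {K : Type u} [CommRing k] [Field K] [Algebra k K]

/-- The form `dx₁ ∧ ⋯ ∧ dxᵢ`. -/
def wedgeD {i : ℕ} (x : Fin i → K) : DiffForms k K :=
  ExteriorAlgebra.ιMulti K i fun j => KaehlerDifferential.D k K (x j)

variable {k}
variable (p : ℕ) (S : Subalgebra k K) (i : ℕ)

/-- The image of `Ω^i_{S/k}` in `Ω^i_{K/k}`: sums of forms `a dx₁ ∧ ⋯ ∧ dxᵢ` with `a, xⱼ ∈ S`. -/
def localForms : AddSubgroup (DiffForms k K) :=
  AddSubgroup.closure {ω | ∃ a ∈ S, ∃ x : Fin i → K, (∀ j, x j ∈ S) ∧ ω = a • wedgeD k x}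

/-- `BΩ^i_S`, the image of `d : Ω^{i-1}_S → Ω^i_S`, with `Ω^{-1}_S = 0`. -/
def localExact : ℕ → AddSubgroup (DiffForms k K)
  | 0 => ⊥
  | i + 1 => (localForms S i).map (extD k)

/-- The graph of the Cartier operator `C : ZΩ^i_S → Ω^i_S`: the group of pairs `(ω, η)` generated by
`(aᵖ x₁ᵖ⁻¹dx₁ ∧ ⋯ ∧ xᵢᵖ⁻¹dxᵢ, a dx₁ ∧ ⋯ ∧ dxᵢ)` and by `(dθ, 0)`. -/
def cartierGraph : AddSubgroup (DiffForms k K × DiffForms k K) :=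
  AddSubgroup.closure
    ({z | ∃ a ∈ S, ∃ x : Fin i → K, (∀ j, x j ∈ S) ∧
        z = ((a ^ p * ∏ j, x j ^ (p - 1)) • wedgeD k x, a • wedgeD k x)} ∪
      {z | z.1 ∈ localExact S i ∧ z.2 = 0})

/-- The composite of two additive relations, given by their graphs. -/
def relComp {E : Type u} [AddCommGroup E] (G H : AddSubgroup (E × E)) : AddSubgroup (E × E) where
  carrier := {z | ∃ θ, (z.1, θ) ∈ G ∧ (θ, z.2) ∈ H}
  zero_mem' := ⟨0, zero_mem G, zero_mem H⟩
  add_mem' := fun {_ _} ⟨θ, h₁, h₂⟩ ⟨θ', h₁', h₂'⟩ => ⟨θ + θ', add_mem h₁ h₁', add_mem h₂ h₂'⟩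
  neg_mem' := fun {_} ⟨θ, h₁, h₂⟩ => ⟨-θ, neg_mem h₁, neg_mem h₂⟩

/-- The preimage of a subgroup under an additive relation, given by its graph. -/
def relPreimage {E : Type u} [AddCommGroup E] (G : AddSubgroup (E × E)) (T : AddSubgroup E) :
    AddSubgroup E where
  carrier := {ω | ∃ θ ∈ T, (ω, θ) ∈ G}
  zero_mem' := ⟨0, zero_mem T, zero_mem G⟩
  add_mem' := fun {_ _} ⟨θ, h₁, h₂⟩ ⟨θ', h₁', h₂'⟩ => ⟨θ + θ', add_mem h₁ h₁', add_mem h₂ h₂'⟩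
  neg_mem' := fun {_} ⟨θ, h₁, h₂⟩ => ⟨-θ, neg_mem h₁, neg_mem h₂⟩

/-- The graph of the iterated Cartier operator `C_n : Z_nΩ^i_S → Ω^i_S`. -/
def cartierGraphIter : ℕ → AddSubgroup (DiffForms k K × DiffForms k K)
  | 0 => (localForms S i).map ((AddMonoidHom.id _).prod (AddMonoidHom.id _))
  | n + 1 => relComp (cartierGraph p S i) (cartierGraphIter n)

/-- `Z_nΩ^i_S`: `Z_0Ω^i_S = Ω^i_S`, and `Z_{n+1}Ω^i_S` is the kernel of `d ∘ C_n` on `Z_nΩ^i_S`.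
In particular `Z_1Ω^i_S` is the group of closed forms in `Ω^i_S`. -/
def localCycles : ℕ → AddSubgroup (DiffForms k K)
  | 0 => localForms S i
  | n + 1 => localCycles n ⊓ relPreimage (cartierGraphIter p S i n) (extD k).ker

/-- `B_nΩ^i_S`: `B_0Ω^i_S = 0`, `B_1Ω^i_S = BΩ^i_S`, and `B_{n+2}Ω^i_S` is the preimage of
`B_{n+1}Ω^i_S` under the Cartier operator. -/
def localBoundaries : ℕ → AddSubgroup (DiffForms k K)
  | 0 => ⊥
  | 1 => localExact S i
  | n + 2 => relPreimage (cartierGraph p S i) (localBoundaries (n + 1))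

variable {p S i}

theorem smul_mem_localForms {a : K} (ha : a ∈ S) {ω : DiffForms k K} (hω : ω ∈ localForms S i) :
    a • ω ∈ localForms S i := by
  induction hω using AddSubgroup.closure_induction with
  | mem ω h =>
    obtain ⟨b, hb, x, hx, rfl⟩ := h
    exact AddSubgroup.subset_closure ⟨a * b, mul_mem ha hb, x, hx, by rw [mul_smul]⟩
  | zero => simp
  | add _ _ _ _ h h' => rw [smul_add]; exact add_mem h h'
  | neg _ _ h => rw [smul_neg]; exact neg_mem h

theorem pow_smul_mem_localExact [CharP K p] {a : K} (ha : a ∈ S) {ω : DiffForms k K}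
    (hω : ω ∈ localExact S i) : a ^ p • ω ∈ localExact S i := by
  cases i with
  | zero =>
    rw [localExact, AddSubgroup.mem_bot] at hω
    rw [hω, smul_zero]
    exact zero_mem _
  | succ i =>
    obtain ⟨η, hη, rfl⟩ := hω
    exact ⟨a ^ p • η, smul_mem_localForms (pow_mem ha p) hη, extD_pow_smul k p a η⟩

theorem smul_mem_cartierGraph [CharP K p] {a : K} (ha : a ∈ S)
    {z : DiffForms k K × DiffForms k K} (hz : z ∈ cartierGraph p S i) :
    (a ^ p • z.1, a • z.2) ∈ cartierGraph p S i := by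
  induction hz using AddSubgroup.closure_induction with
  | mem z h =>
    refine AddSubgroup.subset_closure ?_
    rcases h with ⟨b, hb, x, hx, rfl⟩ | ⟨h₁, h₂⟩
    · exact Or.inl ⟨a * b, mul_mem ha hb, x, hx, by simp only [mul_pow, mul_smul]⟩
    · exact Or.inr ⟨pow_smul_mem_localExact ha h₁, by simp [h₂]⟩
  | zero =>
    rw [Prod.fst_zero, Prod.snd_zero, smul_zero, smul_zero]
    exact zero_mem _
  | add _ _ _ _ h h' => simpa using add_mem h h'
  | neg _ _ h => simpa using neg_mem h

theorem smul_mem_cartierGraphIter [CharP K p] {a : K} (ha : a ∈ S) {n : ℕ}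
    {z : DiffForms k K × DiffForms k K} (hz : z ∈ cartierGraphIter p S i n) :
    (a ^ p ^ n • z.1, a • z.2) ∈ cartierGraphIter p S i n := by
  induction n generalizing z with
  | zero =>
    obtain ⟨ω, hω, rfl⟩ := hz
    exact ⟨a • ω, smul_mem_localForms ha hω, by simp⟩
  | succ n ih =>
    obtain ⟨θ, h₁, h₂⟩ := hz
    refine ⟨a ^ p ^ n • θ, ?_, ih h₂⟩
    have := smul_mem_cartierGraph (pow_mem ha (p ^ n)) h₁
    rwa [← pow_mul, ← pow_succ] at this

theorem smul_mem_localCycles [CharP K p] {a : K} (ha : a ∈ S) {n : ℕ} {ω : DiffForms k K}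
    (hω : ω ∈ localCycles p S i n) : a ^ p ^ n • ω ∈ localCycles p S i n := by
  induction n generalizing a with
  | zero => exact smul_mem_localForms (by simpa using ha) hω
  | succ n ih =>
    obtain ⟨h, η, h₂, h₁⟩ := hω
    have e : a ^ p ^ (n + 1) = (a ^ p) ^ p ^ n := by rw [← pow_mul, ← pow_succ']
    rw [e]
    exact ⟨ih (pow_mem ha p) h, a ^ p • η,
      by rw [AddMonoidHom.mem_ker, extD_pow_smul, h₂, smul_zero],
      smul_mem_cartierGraphIter (pow_mem ha p) h₁⟩

theorem smul_mem_localBoundaries [CharP K p] {a : K} (ha : a ∈ S) {n : ℕ} {ω : DiffForms k K}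
    (hω : ω ∈ localBoundaries p S i n) : a ^ p ^ n • ω ∈ localBoundaries p S i n := by
  induction n using Nat.twoStepInduction generalizing ω with
  | zero =>
    rw [localBoundaries, AddSubgroup.mem_bot] at hω
    rw [hω, smul_zero]
    exact zero_mem _
  | one =>
    rw [pow_one]
    exact pow_smul_mem_localExact ha hω
  | more n _ ih =>
    obtain ⟨θ, h, h₁⟩ := hω
    refine ⟨a ^ p ^ (n + 1) • θ, ih h, ?_⟩
    have := smul_mem_cartierGraph (pow_mem ha (p ^ (n + 1))) h₁
    rwa [← pow_mul, ← pow_succ] at this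

end LocalForms

section FrobeniusPushforward

variable (R : Type u) [CommRing R] (p n : ℕ) (M : Type u) [AddCommGroup M]

/-- The Frobenius pushforward `Fⁿ_* M`: the group `M`, on which `r ∈ R` acts as `r ^ pⁿ`. -/
def FrobPush (_R : Type u) (_p _n : ℕ) (M : Type u) : Type u := M

instance : AddCommGroup (FrobPush R p n M) := inferInstanceAs (AddCommGroup M)

variable [Module R M] [ExpChar R p]

instance : Module R (FrobPush R p n M) := Module.compHom M (iterateFrobenius R p n)

variable {R M} {N : Type u} [AddCommGroup N] [Module R N]

/-- `Fⁿ_* f` for an `R`-linear map `f`. -/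
def FrobPush.map (f : M →ₗ[R] N) : FrobPush R p n M →ₗ[R] FrobPush R p n N where
  toFun := f
  map_add' := f.map_add
  map_smul' r x := f.map_smul (iterateFrobenius R p n r) x

end FrobeniusPushforward

section LinearMapOfGraph

variable {R : Type u} [CommRing R] {M N : Type u} [AddCommGroup M] [Module R M]
  [AddCommGroup N] [Module R N]

open Classical in
/-- The linear map with graph `G`; by convention zero if `G` is not the graph of a linear map. -/
def linearMapOfGraph (G : Submodule R (M × N)) : M →ₗ[R] N :=
  if h : ∃ f : M →ₗ[R] N, f.graph = G then h.choose else 0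

theorem graph_linearMapOfGraph {G : Submodule R (M × N)} (h : ∃ f : M →ₗ[R] N, f.graph = G) :
    (linearMapOfGraph G).graph = G := by
  rw [linearMapOfGraph, dif_pos h]
  exact h.choose_spec

end LinearMapOfGraph

section LocalCohomology

open Abelian

variable {R : Type u} [CommRing R] (I : Ideal R)

/-- The projection `R/Iᵗ → R/Iˢ` for `s ≤ t`. -/
def quotPowMap {s t : ℕ} (h : s ≤ t) :
    ModuleCat.of R (R ⧸ I ^ t) ⟶ ModuleCat.of R (R ⧸ I ^ s) :=
  ModuleCat.ofHom (Submodule.mapQ _ _ LinearMap.id (Ideal.pow_le_pow_right h))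

/-- The transition maps of the system `Ext^j(R/Iᵗ, M)`. -/
def extTransition (j : ℕ) (M : ModuleCat.{u} R) (s t : ℕ) (h : s ≤ t) :
    Ext (ModuleCat.of R (R ⧸ I ^ s)) M j →+ Ext (ModuleCat.of R (R ⧸ I ^ t)) M j :=
  (Ext.mk₀ (quotPowMap I h)).precomp M (zero_add j)

/-- Local cohomology `H^j_I(M)`, the direct limit over `t` of `Ext^j(R/Iᵗ, M)`. -/
def LocCoh (j : ℕ) (M : Type u) [AddCommGroup M] [Module R M] : Type u :=
  AddCommGroup.DirectLimit (fun t : ℕ => Ext (ModuleCat.of R (R ⧸ I ^ t)) (ModuleCat.of R M) j)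
    (extTransition I j (ModuleCat.of R M))

variable {M N : Type u} [AddCommGroup M] [Module R M] [AddCommGroup N] [Module R N]

instance (j : ℕ) : AddCommGroup (LocCoh I j M) :=
  inferInstanceAs (AddCommGroup (AddCommGroup.DirectLimit _ _))

/-- The map `H^j_I(M) → H^j_I(N)` induced by an `R`-linear map `M → N`. -/
def LocCoh.map (j : ℕ) (f : M →ₗ[R] N) : LocCoh I j M →+ LocCoh I j N :=
  AddCommGroup.DirectLimit.map
    (fun t => (Ext.mk₀ (ModuleCat.ofHom f)).postcomp (ModuleCat.of R (R ⧸ I ^ t)) (add_zero j))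
    (fun _ _ _ => AddMonoidHom.ext fun _ => Ext.comp_assoc_of_third_deg_zero _ _ _ (zero_add j))

/-- The sequence `B → M → M/B`. -/
def quotSeq (B : Submodule R M) : ShortComplex (ModuleCat.{u} R) :=
  ShortComplex.moduleCatMk B.subtype B.mkQ (by ext x; simp)

theorem quotSeq_shortExact (B : Submodule R M) : (quotSeq B).ShortExact where
  exact := by
    rw [ShortComplex.moduleCat_exact_iff_range_eq_ker]
    exact B.range_subtype.trans B.ker_mkQ.symm
  mono_f := (ModuleCat.mono_iff_injective _).2 B.subtype_injective
  epi_g := (ModuleCat.epi_iff_surjective _).2 B.mkQ_surjective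

/-- The connecting map `δ : H^j_I(M/B) → H^{j+1}_I(B)` of the long exact sequence of
`0 → B → M → M/B → 0`. -/
def LocCoh.δ (j : ℕ) (B : Submodule R M) : LocCoh I j (M ⧸ B) →+ LocCoh I (j + 1) B :=
  AddCommGroup.DirectLimit.map
    (fun t => (quotSeq_shortExact B).extClass.postcomp (ModuleCat.of R (R ⧸ I ^ t)) rfl)
    (fun _ _ _ => AddMonoidHom.ext fun _ => Ext.comp_assoc _ _ _ (zero_add j) rfl (by omega))

end LocalCohomology

section Reflexive

variable (k : Type v) {R : Type u} [Field k] [CommRing R] [IsDomain R] [Algebra k R]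

/-- The local ring `O_{X,P}`, as a subring of the function field. -/
def localRingAt (P : PrimeSpectrum R) : Subalgebra k (FractionRing R) :=
  (Localization.subalgebra.ofField (FractionRing R) P.asIdeal.primeCompl
    P.asIdeal.primeCompl_le_nonZeroDivisors).restrictScalars k

theorem algebraMap_mem_localRingAt (P : PrimeSpectrum R) (r : R) :
    algebraMap R (FractionRing R) r ∈ localRingAt k P :=
  Subalgebra.algebraMap_mem (Localization.subalgebra.ofField (FractionRing R) P.asIdeal.primeCompl
    P.asIdeal.primeCompl_le_nonZeroDivisors) r

variable (R)

/-- `Ω^{[i]}_X = j_*Ω^i_U` where `U` is the smooth locus: the rational `i`-forms that are regular at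
every point of `U`. -/
def reflForms (i : ℕ) : Submodule R (DiffForms k (FractionRing R)) where
  carrier := {ω | ∀ P ∈ Algebra.smoothLocus k R, ω ∈ localForms (localRingAt k P) i}
  zero_mem' _ _ := zero_mem _
  add_mem' h h' P hP := add_mem (h P hP) (h' P hP)
  smul_mem' r ω h P hP := by
    rw [← algebraMap_smul (FractionRing R) r ω]
    exact smul_mem_localForms (algebraMap_mem_localRingAt k P r) (h P hP)

/-- An effective Cartier divisor `D` on `Spec R`, given by its invertible ideal `O_X(-D)`. -/
structure EffCartierDiv (R : Type u) [CommRing R] [IsDomain R] where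
  /-- The ideal `O_X(-D)`. -/
  ideal : Ideal R
  isUnit : IsUnit (ideal : FractionalIdeal R⁰ (FractionRing R))

variable {R}

/-- The multiple `rD`. -/
def EffCartierDiv.mult (r : ℕ) (D : EffCartierDiv R) : EffCartierDiv R where
  ideal := D.ideal ^ r
  isUnit := by
    rw [FractionalIdeal.coeIdeal_pow]
    exact D.isUnit.pow r

/-- `D` contains the singular locus `Sing(X)`, the complement of the smooth locus. -/
def EffCartierDiv.ContainsSing (D : EffCartierDiv R) : Prop :=
  (Algebra.smoothLocus k R)ᶜ ⊆ PrimeSpectrum.zeroLocus (D.ideal : Set R)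

/-- `O_X(D)`: the rational functions `x` with `O_X(-D) x ⊆ O_X`. -/
def EffCartierDiv.functions (D : EffCartierDiv R) : Submodule R (FractionRing R) where
  carrier := {x | ∀ a ∈ D.ideal, a • x ∈ (1 : Submodule R (FractionRing R))}
  zero_mem' a _ := by rw [smul_zero]; exact zero_mem _
  add_mem' h h' a ha := by rw [smul_add]; exact add_mem (h a ha) (h' a ha)
  smul_mem' r x h a ha := by rw [smul_comm]; exact Submodule.smul_mem _ r (h a ha)

/-- The inclusion `O_X → O_X(D)`. -/
def EffCartierDiv.inclFunctions (D : EffCartierDiv R) : R →ₗ[R] D.functions :=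
  (Algebra.linearMap R (FractionRing R)).codRestrict D.functions fun r a _ =>
    Submodule.smul_mem _ a (Submodule.algebraMap_mem r)

/-- `Ω^{[i]}_X(D)`: the rational forms `ω` with `O_X(-D) ω ⊆ Ω^{[i]}_X`. -/
def reflFormsTwist (i : ℕ) (D : EffCartierDiv R) : Submodule R (DiffForms k (FractionRing R)) where
  carrier := {ω | ∀ a ∈ D.ideal, a • ω ∈ reflForms k R i}
  zero_mem' a _ := by rw [smul_zero]; exact zero_mem _
  add_mem' h h' a ha := by rw [smul_add]; exact add_mem (h a ha) (h' a ha)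
  smul_mem' r x h a ha := by rw [smul_comm]; exact Submodule.smul_mem _ r (h a ha)

/-- The inclusion `Ω^{[i]}_X → Ω^{[i]}_X(D)`. -/
def inclTwist (i : ℕ) (D : EffCartierDiv R) : reflForms k R i →ₗ[R] reflFormsTwist k i D :=
  Submodule.inclusion fun _ h a _ => Submodule.smul_mem _ a h

variable (R) (p : ℕ) [Fact p.Prime] [CharP R p]

/-- `Fⁿ_*Ω^{[i]}_X`. -/
abbrev PushForms (n i : ℕ) : Type u := FrobPush R p n (reflForms k R i)

/-- `Fⁿ_*(Ω^{[i]}_X(D))`. -/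
abbrev PushFormsTwist (n i : ℕ) (D : EffCartierDiv R) : Type u :=
  FrobPush R p n (reflFormsTwist k i D)

variable {k R p} in
/-- The rational form underlying an element of `Fⁿ_*Ω^{[i]}_X`. -/
def PushForms.form {n i : ℕ} (ω : PushForms k R p n i) : DiffForms k (FractionRing R) :=
  Subtype.val (p := fun x => x ∈ reflForms k R i) ω

theorem PushForms.form_smul {n i : ℕ} (r : R) (ω : PushForms k R p n i) :
    (r • ω).form = algebraMap R (FractionRing R) r ^ p ^ n • ω.form := by
  rw [← map_pow, algebraMap_smul]
  rfl

/-- `Z_nΩ^{[i]}_X = j_*Z_nΩ^i_U`, as a submodule of `Fⁿ_*Ω^{[i]}_X`. -/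
def reflCycles (n i : ℕ) : Submodule R (PushForms k R p n i) where
  carrier := {ω | ∀ P ∈ Algebra.smoothLocus k R, ω.form ∈ localCycles p (localRingAt k P) i n}
  zero_mem' _ _ := zero_mem _
  add_mem' h h' P hP := add_mem (h P hP) (h' P hP)
  smul_mem' r ω h P hP := by
    have : CharP (FractionRing R) p := IsFractionRing.charP_of_isFractionRing R p
    rw [PushForms.form_smul]
    exact smul_mem_localCycles (algebraMap_mem_localRingAt k P r) (h P hP)

/-- `B_nΩ^{[i]}_X = j_*B_nΩ^i_U`, as a submodule of `Fⁿ_*Ω^{[i]}_X`. -/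
def reflBoundaries (n i : ℕ) : Submodule R (PushForms k R p n i) where
  carrier := {ω | ∀ P ∈ Algebra.smoothLocus k R, ω.form ∈ localBoundaries p (localRingAt k P) i n}
  zero_mem' _ _ := zero_mem _
  add_mem' h h' P hP := add_mem (h P hP) (h' P hP)
  smul_mem' r ω h P hP := by
    have : CharP (FractionRing R) p := IsFractionRing.charP_of_isFractionRing R p
    rw [PushForms.form_smul]
    exact smul_mem_localBoundaries (algebraMap_mem_localRingAt k P r) (h P hP)

/-- The graph of the reflexive Cartier operator `C_n`: pairs `(ω, η)` with `C_n ω = η` at every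
point of the smooth locus. -/
def reflCartierGraph (n i : ℕ) : Submodule R (reflCycles k R p n i × reflForms k R i) where
  carrier := {z | ∀ P ∈ Algebra.smoothLocus k R,
    (z.1.1.form, z.2.1) ∈ cartierGraphIter p (localRingAt k P) i n}
  zero_mem' P _ := zero_mem (cartierGraphIter p (localRingAt k P) i n)
  add_mem' h h' P hP := add_mem (h P hP) (h' P hP)
  smul_mem' r z h P hP := by
    have : CharP (FractionRing R) p := IsFractionRing.charP_of_isFractionRing R p
    have e : ((r • z).1.1.form, (r • z).2.1) =
        (algebraMap R (FractionRing R) r ^ p ^ n • z.1.1.form,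
          algebraMap R (FractionRing R) r • z.2.1) :=
      Prod.ext (PushForms.form_smul k R p r z.1.1) (algebraMap_smul (FractionRing R) r z.2.1).symm
    rw [e]
    exact smul_mem_cartierGraphIter (algebraMap_mem_localRingAt k P r) (h P hP)

/-- The reflexive Cartier operator `C_n : Z_nΩ^{[i]}_X → Ω^{[i]}_X`. By Cartier's theorem on the
smooth locus `reflCartierGraph` is the graph of a linear map if `R` is of finite type over a
perfect field. -/
def cartier (n i : ℕ) : reflCycles k R p n i →ₗ[R] reflForms k R i :=
  linearMapOfGraph (reflCartierGraph k R p n i)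

/-- `Fⁿ_*Ω^{[i]}_X / B_nΩ^{[i]}_X`. -/
abbrev FormsModB (n i : ℕ) : Type u := PushForms k R p n i ⧸ reflBoundaries k R p n i

/-- The iterated inverse Cartier operator
`C_n⁻¹ : Ω^{[i]}_X ≅ Z_nΩ^{[i]}_X / B_nΩ^{[i]}_X ↪ Fⁿ_*Ω^{[i]}_X / B_nΩ^{[i]}_X`, that is, the map
which sends `C_n ω` to the class of `ω`. It exists if `C : ZΩ^{[i]}_X → Ω^{[i]}_X` is surjective. -/
def invCartier (n i : ℕ) : reflForms k R i →ₗ[R] FormsModB k R p n i :=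
  linearMapOfGraph (LinearMap.range ((cartier k R p n i).prod
    ((reflBoundaries k R p n i).mkQ ∘ₗ (reflCycles k R p n i).subtype)))

/-- `Fⁿ_*Ω^{[i]}_X(D) / B_nΩ^{[i]}_X`. -/
abbrev FormsTwistModB (n i : ℕ) (D : EffCartierDiv R) : Type u :=
  PushFormsTwist k R p n i D ⧸
    (reflBoundaries k R p n i).map (FrobPush.map p n (inclTwist k i D))

/-- The natural map `Fⁿ_*Ω^{[i]}_X / B_nΩ^{[i]}_X → Fⁿ_*Ω^{[i]}_X(D) / B_nΩ^{[i]}_X`. -/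
def natTwist (n i : ℕ) (D : EffCartierDiv R) :
    FormsModB k R p n i →ₗ[R] FormsTwistModB k R p n i D :=
  Submodule.mapQ _ _ (FrobPush.map p n (inclTwist k i D)) (Submodule.le_comap_map _ _)

/-- The Frobenius `Fⁿ : O_X → Fⁿ_*O_X`. -/
def frobMap (n : ℕ) : R →ₗ[R] FrobPush R p n R where
  toFun := iterateFrobenius R p n
  map_add' := map_add (iterateFrobenius R p n)
  map_smul' := map_mul (iterateFrobenius R p n)

/-- `Spec R`, of dimension `d`, is `F`-rational: for every closed point `𝔪` and every `D ≥ 0` the map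
`H^j_𝔪(O_X) → H^j_𝔪(Fⁿ_*O_X) → H^j_𝔪(Fⁿ_*O_X(D))` is injective for `j ≤ d` and `n ≫ 0`. -/
def IsFRational (d : ℕ) : Prop :=
  ∀ 𝔪 : Ideal R, 𝔪.IsMaximal → ∀ D : EffCartierDiv R, ∃ n₀ > 0, ∀ j ≤ d, ∀ n ≥ n₀,
    Function.Injective
      ((LocCoh.map 𝔪 j (FrobPush.map p n D.inclFunctions)).comp (LocCoh.map 𝔪 j (frobMap R p n)))

/-- `Spec R`, of dimension `d`, is pre-`m`-`F`-rational. -/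
def IsPreFRational (m d : ℕ) : Prop :=
  (∀ i ≤ m, Function.Surjective (cartier k R p 1 i)) ∧
  ∀ 𝔪 : Ideal R, 𝔪.IsMaximal → ∀ D : EffCartierDiv R, ∃ n₀ > 0, ∀ i j n : ℕ,
    i ≤ m → i + j ≤ d → n₀ ≤ n →
    Function.Injective
      ((LocCoh.map 𝔪 j (natTwist k R p n i D)).comp (LocCoh.map 𝔪 j (invCartier k R p n i)))

end Reflexive

end

-- Write Ω for Ω^{[i]}_X. Precomposing (∗)_D with H^j(C_n) : H^j(Z_n) → H^j(Ω) gives the composite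
-- H^j(Z_n) → H^j(Fⁿ_*Ω) → H^j(Fⁿ_*Ω(D)) → H^j(Fⁿ_*Ω(D)/B_n), because C_n⁻¹ ∘ C_n is the projection
-- modulo B_n. So if the twist H^j(Fⁿ_*Ω) → H^j(Fⁿ_*Ω(D)) is zero, injectivity of (∗)_D forces
-- H^j(C_n) = 0 (`map_cartier_eq_zero_of_injective`). On the other hand δ ∘ C_n⁻¹ is the connecting
-- map of 0 → B_n → Z_n → Ω → 0, so it is injective exactly when H^j(C_n) = 0 (`injective_δ_iff`).
-- By naturality δ also factors through the quotient by B_n of the twist by any D, so its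
-- injectivity on the image of C_n⁻¹ implies that of (∗)_D for every D
-- (`injective_natTwist_of_injective_δ`). In degree i = 0 one has B_n = 0, C_n⁻¹ = Fⁿ and Ω^{[0]}_X
-- = O_X, so (∗)_D is the map of F-rationality (`injective_degree_zero_iff`).
--
-- Two geometric facts remain. The first: if D contains Sing(X), high multiples of D kill
-- H^j_𝔪(Fⁿ_*Ω) for all j < d, uniformly in n (`exists_forall_map_inclTwist_mult_eq_zero`). For a
-- smooth point P there is a finite map from X to an affine space of dimension r ≥ d that is flat at
-- P and sends 𝔪 to the origin (`exists_finite_flat_coordinates`). By flatness, multiplication by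
-- some s ∉ P on Ω factors through a free module over the polynomial ring, on which all powers of
-- the variables form regular sequences. Hence sʳ annihilates local cohomology below degree r
-- (`LocCoh.map_pow_eq_zero_of_factorsThrough`). Frobenius only replaces the variables by powers, so
-- sʳ does not depend on n. The ideal of all such annihilators is contained in no smooth prime, so
-- it contains a power of O_X(-D).
--
-- The second: F-rationality need only be tested on multiples of one D containing Sing(X)
-- (`isFRational_of_containsSing`). For c ≠ 0 in O_X(-D') and large e, the values φ(c) of the
-- p⁻ᵉ-linear maps φ : R → R form an ideal contained in no smooth prime, so it contains O_X(-ND) for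
-- some N. This gives a p⁻ᵉ-linear map O_X(D') → O_X(ND) with 1 ↦ 1, which carries injectivity for
-- ND at level n to injectivity for D' at level n + e.
--
-- The underlying tool is Cartier's theorem, proved at smooth points in logarithmic coordinates:
-- monomial forms are eigenvectors of the Lie derivatives x ∂/∂x, and on closed forms Cartan's
-- formula makes everything with a nonzero eigenvalue exact. Since X is smooth in codimension one,
-- functions regular on the smooth locus are regular, and reflexive forms are finitely generated.

universe w

noncomputable section

open CategoryTheory
open scoped nonZeroDivisors

/-! ### Functoriality and exact sequences of local cohomology -/

section LocalCohomologyBasics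

open Abelian

variable {R : Type u} [CommRing R] (I : Ideal R)
variable {M N Q : Type u} [AddCommGroup M] [Module R M] [AddCommGroup N] [Module R N]
  [AddCommGroup Q] [Module R Q]

namespace LocCoh

/-- The canonical map `Ext^j(R/Iᵗ, M) → H^j_I(M)`. -/
def of (j : ℕ) (M : Type u) [AddCommGroup M] [Module R M] (t : ℕ) :
    Ext (ModuleCat.of R (R ⧸ I ^ t)) (ModuleCat.of R M) j →+ LocCoh I j M :=
  AddCommGroup.DirectLimit.of
    (fun t : ℕ => Ext (ModuleCat.of R (R ⧸ I ^ t)) (ModuleCat.of R M) j)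
    (extTransition I j (ModuleCat.of R M)) t

variable {I}

@[elab_as_elim]
theorem induction_on {j : ℕ} {C : LocCoh I j M → Prop} (z : LocCoh I j M)
    (h : ∀ t x, C (of I j M t x)) : C z :=
  AddCommGroup.DirectLimit.induction_on z h

theorem quotPowMap_comp {s t r : ℕ} (h : s ≤ t) (h' : t ≤ r) :
    quotPowMap I h' ≫ quotPowMap I h = quotPowMap I (h.trans h') := by
  ext
  rfl

theorem quotPowMap_refl {s : ℕ} : quotPowMap I (le_refl s) = 𝟙 _ := by
  ext
  rfl

instance directedSystem_extTransition (j : ℕ) (M : ModuleCat.{u} R) :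
    DirectedSystem (fun t : ℕ => Ext (ModuleCat.of R (R ⧸ I ^ t)) M j)
      (fun s t h => extTransition I j M s t h) where
  map_self s x := by
    simp [extTransition, quotPowMap_refl]
  map_map s t r h h' x := by
    simp [extTransition, ← quotPowMap_comp h h']

theorem of_eq_zero {j t : ℕ} {x : Ext (ModuleCat.of R (R ⧸ I ^ t)) (ModuleCat.of R M) j}
    (h : of I j M t x = 0) :
    ∃ s, ∃ hs : t ≤ s, extTransition I j (ModuleCat.of R M) t s hs x = 0 :=
  AddCommGroup.DirectLimit.of.zero_exact
    (f := extTransition I j (ModuleCat.of R M)) t x h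

theorem of_transition {j s t : ℕ} (h : s ≤ t)
    (x : Ext (ModuleCat.of R (R ⧸ I ^ s)) (ModuleCat.of R M) j) :
    of I j M t (extTransition I j (ModuleCat.of R M) s t h x) = of I j M s x := by
  unfold of
  exact AddCommGroup.DirectLimit.of_f
    (G := fun t : ℕ => Ext (ModuleCat.of R (R ⧸ I ^ t)) (ModuleCat.of R M) j) h x

theorem map_of (j : ℕ) (f : M →ₗ[R] N) (t : ℕ)
    (x : Ext (ModuleCat.of R (R ⧸ I ^ t)) (ModuleCat.of R M) j) :
    map I j f (of I j M t x) = of I j N t (x.comp (Ext.mk₀ (ModuleCat.ofHom f)) (add_zero j)) := by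
  unfold of map
  apply AddCommGroup.DirectLimit.lift_of

theorem map_comp_apply (j : ℕ) (g : N →ₗ[R] Q) (f : M →ₗ[R] N) (z : LocCoh I j M) :
    map I j g (map I j f z) = map I j (g ∘ₗ f) z := by
  induction z using induction_on with
  | h t x => simp [map_of, ModuleCat.ofHom_comp]

theorem map_add_apply (j : ℕ) (f g : M →ₗ[R] N) (z : LocCoh I j M) :
    map I j (f + g) z = map I j f z + map I j g z := by
  induction z using induction_on with
  | h t x =>
    rw [map_of, map_of, map_of, ← map_add, ← Ext.comp_add, ← Ext.mk₀_add]
    rfl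

theorem map_zero_apply (j : ℕ) (z : LocCoh I j M) : map I j (0 : M →ₗ[R] N) z = 0 := by
  have h := map_add_apply j (0 : M →ₗ[R] N) 0 z
  simpa using h

theorem map_id_apply (j : ℕ) (z : LocCoh I j M) : map I j (LinearMap.id : M →ₗ[R] M) z = z := by
  induction z using induction_on with
  | h t x =>
    rw [map_of, show ModuleCat.ofHom (LinearMap.id : M →ₗ[R] M) = 𝟙 _ from rfl, Ext.comp_mk₀_id]

theorem map_sum_apply {ι : Type*} (s : Finset ι) (j : ℕ) (f : ι → M →ₗ[R] N) (z : LocCoh I j M) :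
    map I j (∑ i ∈ s, f i) z = ∑ i ∈ s, map I j (f i) z := by
  classical
  induction s using Finset.induction_on with
  | empty => simpa using map_zero_apply j z
  | insert a s ha ih => rw [Finset.sum_insert ha, Finset.sum_insert ha, map_add_apply, ih]

/-- Every class in `H^j_I(M)` is killed by a power of `y ∈ I`. -/
theorem exists_map_pow_smul_eq_zero {j : ℕ} (z : LocCoh I j M) {y : R} (hy : y ∈ I) :
    ∃ t : ℕ, ∀ s ≥ t, map I j (y ^ s • (LinearMap.id : M →ₗ[R] M)) z = 0 := by
  induction z using induction_on with
  | h t x =>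
    refine ⟨t, fun s hs => ?_⟩
    have e : (Ext.mk₀ (ModuleCat.ofHom (y ^ s • (LinearMap.id : M →ₗ[R] M)))) =
        y ^ s • Ext.mk₀ (𝟙 (ModuleCat.of R M)) := by
      rw [← Ext.mk₀_smul]
      rfl
    -- The action of y ^ s on Ext can be moved to the first argument R/Iᵗ, which it kills as s ≥ t.
    have e' : y ^ s • Ext.mk₀ (𝟙 (ModuleCat.of R (R ⧸ I ^ t))) = 0 := by
      rw [← Ext.mk₀_smul]
      have : y ^ s • 𝟙 (ModuleCat.of R (R ⧸ I ^ t)) = 0 := by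
        ext
        have : (Ideal.Quotient.mk (I ^ t)) (y ^ s * 1) = 0 :=
          Ideal.Quotient.eq_zero_iff_mem.2
            (Ideal.mul_mem_right _ _ (Ideal.pow_le_pow_right hs (Ideal.pow_mem_pow hy s)))
        exact this
      rw [this, Ext.mk₀_zero]
    rw [map_of, e, Ext.comp_smul, Ext.comp_mk₀_id, ← Ext.mk₀_id_comp x, ← Ext.smul_comp, e',
      Ext.zero_comp, map_zero]

/-- A class that dies in the limit dies at a finite stage, and there Hom is left exact. -/
theorem map_injective_of_injective_zero {f : M →ₗ[R] N} (hf : Function.Injective f) :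
    Function.Injective (map I 0 f) := by
  rw [injective_iff_map_eq_zero]
  intro z
  induction z using induction_on with
  | h t x =>
    intro hz
    rw [map_of] at hz
    obtain ⟨s, hs, h⟩ := of_eq_zero hz
    have : Mono (ModuleCat.ofHom f) := (ModuleCat.mono_iff_injective _).2 hf
    rw [← of_transition hs]
    have h0 : extTransition I 0 (ModuleCat.of R M) t s hs x = 0 := by
      apply Ext.postcomp_mk₀_injective_of_mono _ (ModuleCat.ofHom f)
      rw [map_zero]
      refine Eq.trans ?_ h
      exact Ext.comp_assoc_of_third_deg_zero _ _ _ (zero_add 0)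
    rw [h0, map_zero]

variable {S : ShortComplex (ModuleCat.{u} R)} (hS : S.ShortExact)

/-- The connecting map of a short exact sequence of modules. -/
def conn (j : ℕ) : LocCoh I j S.X₃ →+ LocCoh I (j + 1) S.X₁ :=
  AddCommGroup.DirectLimit.map
    (fun t => hS.extClass.postcomp (ModuleCat.of R (R ⧸ I ^ t)) rfl)
    (fun _ _ _ => AddMonoidHom.ext fun _ => Ext.comp_assoc _ _ _ (zero_add j) rfl (by omega))

theorem conn_of (j t : ℕ) (x : Ext (ModuleCat.of R (R ⧸ I ^ t)) S.X₃ j) :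
    conn (I := I) hS j (of I j S.X₃ t x) = of I (j + 1) S.X₁ t (x.comp hS.extClass rfl) := by
  unfold of conn
  apply AddCommGroup.DirectLimit.lift_of

/-- The covariant Ext sequence is exact at each stage; a class whose image vanishes in the limit is
first moved to a stage where the image vanishes. -/
theorem exists_conn_eq {j : ℕ} (z : LocCoh I (j + 1) S.X₁) (hz : map I (j + 1) S.f.hom z = 0) :
    ∃ w : LocCoh I j S.X₃, conn hS j w = z := by
  induction z using induction_on with
  | h t x =>
    rw [map_of] at hz
    obtain ⟨s, hs, h⟩ := of_eq_zero hz
    have h0 : (extTransition I (j + 1) S.X₁ t s hs x).comp (Ext.mk₀ S.f) (add_zero _) = 0 := by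
      refine Eq.trans ?_ h
      exact Ext.comp_assoc_of_third_deg_zero _ _ _ (zero_add (j + 1))
    obtain ⟨w, hw⟩ := Ext.covariant_sequence_exact₁ _ hS _ h0 rfl
    exact ⟨of I j S.X₃ s w, by rw [conn_of, hw]; exact of_transition hs x⟩

theorem exists_map_eq {j : ℕ} (w : LocCoh I j S.X₃) (hw : conn hS j w = 0) :
    ∃ y : LocCoh I j S.X₂, map I j S.g.hom y = w := by
  induction w using induction_on with
  | h t x =>
    rw [conn_of] at hw
    obtain ⟨s, hs, h⟩ := of_eq_zero hw
    have h0 : (extTransition I j S.X₃ t s hs x).comp hS.extClass rfl = 0 := by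
      refine Eq.trans ?_ h
      exact Ext.comp_assoc _ _ _ (zero_add j) rfl (by omega)
    obtain ⟨w, hw⟩ := Ext.covariant_sequence_exact₃ _ hS _ rfl h0
    exact ⟨of I j S.X₂ s w, by
      rw [map_of]
      exact (congrArg (of I j S.X₃ s) hw).trans (of_transition hs x)⟩

theorem conn_map {j : ℕ} (y : LocCoh I j S.X₂) : conn hS j (map I j S.g.hom y) = 0 := by
  induction y using induction_on with
  | h t x =>
    rw [map_of]
    refine (conn_of hS j t _).trans ?_
    refine (congrArg (of I (j + 1) S.X₁ t) ?_).trans (map_zero _)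
    refine (Ext.comp_assoc_of_second_deg_zero _ _ _ _).trans ?_
    exact (congrArg (fun y => x.comp y rfl) hS.comp_extClass).trans (Ext.comp_zero _ _ _ _ _)

theorem conn_naturality {S₁ S₂ : ShortComplex (ModuleCat.{u} R)} (h₁ : S₁.ShortExact)
    (h₂ : S₂.ShortExact) (φ : S₁ ⟶ S₂) {j : ℕ} (w : LocCoh I j S₁.X₃) :
    conn h₂ j (map I j φ.τ₃.hom w) = map I (j + 1) φ.τ₁.hom (conn h₁ j w) := by
  induction w using induction_on with
  | h t x =>
    rw [map_of]
    refine (conn_of h₂ j t _).trans ?_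
    rw [conn_of]
    refine Eq.trans ?_ (map_of (j + 1) φ.τ₁.hom t _).symm
    congr 1
    refine (Ext.comp_assoc_of_second_deg_zero _ _ _ _).trans ?_
    refine Eq.trans ?_ (Ext.comp_assoc_of_third_deg_zero _ _ _ _).symm
    exact congrArg (fun y => x.comp y rfl) (ShortComplex.ShortExact.extClass_naturality h₁ h₂ φ).symm

end LocCoh

end LocalCohomologyBasics

/-! ### Annihilation by factoring through a module with regular sequences -/

section Annihilation

open RingTheory.Sequence
open scoped Pointwise

variable {R : Type u} [CommRing R] {A : Type w} [CommRing A]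

/-- All sequences of powers of the elements of `rs` are weakly regular on `G`. -/
def IsPowRegular (G : Type v) [AddCommGroup G] [Module A G] (rs : List A) : Prop :=
  ∀ rs' : List A, List.Forall₂ (fun a b => ∃ e : ℕ, b = a ^ e) rs rs' → IsWeaklyRegular G rs'

theorem IsPowRegular.isSMulRegular {G : Type v} [AddCommGroup G] [Module A G] {x : A} {rs : List A}
    (h : IsPowRegular G (x :: rs)) (e : ℕ) : IsSMulRegular G (x ^ e) := by
  have := h (x ^ e :: rs) (List.Forall₂.cons ⟨e, rfl⟩
    (List.forall₂_same.2 fun a _ => ⟨1, (pow_one a).symm⟩))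
  exact ((isWeaklyRegular_cons_iff _ _ _).1 this).1

theorem IsPowRegular.quotSMulTop {G : Type v} [AddCommGroup G] [Module A G] {x : A} {rs : List A}
    (h : IsPowRegular G (x :: rs)) (e : ℕ) : IsPowRegular (QuotSMulTop (x ^ e) G) rs :=
  fun _ hrs => ((isWeaklyRegular_cons_iff _ _ _).1 (h _ (List.Forall₂.cons ⟨e, rfl⟩ hrs))).2

variable {M : Type u} [AddCommGroup M] [Module R M]

/-- The endomorphism `f` of `M` factors, linearly over `A`, through the `A`-module `G`. -/
def FactorsThrough (φ : A →+* R) (G : Type v) [AddCommGroup G] [Module A G] (f : M →ₗ[R] M) :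
    Prop :=
  ∃ (α : M →+ G) (β : G →+ M), (∀ a m, α (φ a • m) = a • α m) ∧ (∀ a g, β (a • g) = φ a • β g) ∧
    ∀ m, f m = β (α m)

/-- Induction on `rs`, each element costing one factor of f. Put y = φ x. Since x is regular on G, α
kills the y-power torsion T, so f factors through M/T, on which y is injective. A class in H^j(M/T)
is killed by some y ^ s; hence it is zero if j = 0, and otherwise it comes from H^{j-1} of the
cokernel of y ^ s, where the induced endomorphism factors through G / x ^ s G. No bound on s is
known, which is why all sequences of powers are required to be regular. -/
theorem LocCoh.map_pow_eq_zero_of_factorsThrough {I : Ideal R} (φ : A →+* R) (rs : List A)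
    (hI : ∀ a ∈ rs, φ a ∈ I) {G : Type v} [AddCommGroup G] [Module A G] (hG : IsPowRegular G rs)
    {M : Type u} [AddCommGroup M] [Module R M] (f : M →ₗ[R] M) (hf : FactorsThrough φ G f)
    {j : ℕ} (hj : j < rs.length) (z : LocCoh I j M) :
    LocCoh.map I j (f ^ rs.length) z = 0 := by
  induction rs generalizing G M j with
  | nil => simp at hj
  | cons x rs ih =>
    obtain ⟨α, β, hα, hβ, hfαβ⟩ := hf
    set y := φ x with hy
    have hyI : y ∈ I := hI x (by simp)
    let T : Submodule R M := Submodule.torsion' R M (Submonoid.powers y)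
    have hαT : ∀ m ∈ T, α m = 0 := by
      rintro m ⟨⟨_, e, rfl⟩, hm⟩
      apply hG.isSMulRegular e
      change φ x ^ e • m = 0 at hm
      change x ^ e • α m = x ^ e • 0
      rw [← hα, map_pow, hm, map_zero, smul_zero]
    let g : M ⧸ T →ₗ[R] M := T.liftQ f fun m hm => by
      rw [LinearMap.mem_ker, hfαβ, hαT m hm, map_zero]
    let f' : M ⧸ T →ₗ[R] M ⧸ T := T.mkQ ∘ₗ g
    have hgq : g ∘ₗ T.mkQ = f := T.liftQ_mkQ f _
    -- One factor of f pays for the passage to M ⧸ T and back; the others become powers of f'.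
    have hpow : ∀ n : ℕ, f ^ (n + 1) = g ∘ₗ (f' ^ n) ∘ₗ T.mkQ := by
      intro n
      induction n with
      | zero => rw [pow_zero, zero_add, pow_one, ← hgq]; rfl
      | succ n ihn =>
        rw [pow_succ', ihn, pow_succ', ← hgq]
        rfl
    have hinj : ∀ s : ℕ, Function.Injective (y ^ s • (LinearMap.id : M ⧸ T →ₗ[R] M ⧸ T)) := by
      intro s
      rw [injective_iff_map_eq_zero]
      intro m hm
      obtain ⟨m, rfl⟩ := T.mkQ_surjective m
      have hm' : y ^ s • m ∈ T := (Submodule.Quotient.mk_eq_zero T).1 hm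
      obtain ⟨⟨_, e, rfl⟩, hm'⟩ := hm'
      refine (Submodule.Quotient.mk_eq_zero T).2 ⟨⟨y ^ (e + s), e + s, rfl⟩, ?_⟩
      change y ^ (e + s) • m = 0
      rw [pow_add, mul_smul]
      exact hm'
    rw [List.length_cons, hpow, ← LocCoh.map_comp_apply, ← LocCoh.map_comp_apply]
    suffices h : ∀ z : LocCoh I j (M ⧸ T), LocCoh.map I j (f' ^ rs.length) z = 0 by
      rw [h, map_zero]
    intro z
    obtain ⟨s, hs⟩ := LocCoh.exists_map_pow_smul_eq_zero z hyI
    specialize hs s le_rfl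
    cases j with
    | zero =>
      rw [LocCoh.map_injective_of_injective_zero (hinj s) (hs.trans (map_zero _).symm), map_zero]
    | succ j =>
      let μ : M ⧸ T →ₗ[R] M ⧸ T := y ^ s • LinearMap.id
      let S : ShortComplex (ModuleCat.{u} R) :=
        ShortComplex.moduleCatMk μ (LinearMap.range μ).mkQ (by ext m; simp)
      have hS : S.ShortExact :=
        { exact := by
            rw [ShortComplex.moduleCat_exact_iff_range_eq_ker]
            exact (LinearMap.range μ).ker_mkQ.symm
          mono_f := (ModuleCat.mono_iff_injective _).2 (hinj s)
          epi_g := (ModuleCat.epi_iff_surjective _).2 (LinearMap.range μ).mkQ_surjective }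
      obtain ⟨w, rfl⟩ := LocCoh.exists_conn_eq hS z hs
      have hle : LinearMap.range μ ≤ (LinearMap.range μ).comap f' := by
        rintro _ ⟨m, rfl⟩
        exact ⟨f' m, by simp [μ]⟩
      let f'' := (LinearMap.range μ).mapQ (LinearMap.range μ) f' hle
      have hpow' : ∀ n : ℕ, (LinearMap.range μ).mkQ ∘ₗ (f' ^ n) =
          (f'' ^ n) ∘ₗ (LinearMap.range μ).mkQ := by
        intro n
        induction n with
        | zero => rfl
        | succ n ihn =>
          rw [pow_succ, Module.End.mul_eq_comp, ← LinearMap.comp_assoc, ihn, pow_succ,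
            Module.End.mul_eq_comp, LinearMap.comp_assoc, LinearMap.comp_assoc]
          rfl
      let ψ : S ⟶ S :=
        { τ₁ := ModuleCat.ofHom (f' ^ rs.length)
          τ₂ := ModuleCat.ofHom (f' ^ rs.length)
          τ₃ := ModuleCat.ofHom (f'' ^ rs.length)
          comm₁₂ := by
            refine ModuleCat.hom_ext (LinearMap.ext fun (m : M ⧸ T) => ?_)
            exact ((f' ^ rs.length).map_smul (y ^ s) m).symm
          comm₂₃ := by
            refine ModuleCat.hom_ext (LinearMap.ext fun m => ?_)
            exact LinearMap.congr_fun (hpow' rs.length) m }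
      have hnat := LocCoh.conn_naturality hS hS ψ w
      refine hnat.symm.trans ?_
      have h0 : LocCoh.map I j (f'' ^ rs.length) w = 0 := by
        refine ih (fun a ha => hI a (by simp [ha])) (hG.quotSMulTop s) f'' ?_
          (by simpa using hj) w
        let α₁ : M ⧸ T →+ G := QuotientAddGroup.lift T.toAddSubgroup α fun m hm => hαT m hm
        have hα₁ : ∀ m, α₁ (T.mkQ m) = α m := fun m => rfl
        let α₂ : (M ⧸ T) ⧸ LinearMap.range μ →+ QuotSMulTop (x ^ s) G :=
          QuotientAddGroup.lift (LinearMap.range μ).toAddSubgroup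
            ((Submodule.mkQ (x ^ s • (⊤ : Submodule A G))).toAddMonoidHom.comp α₁) (by
              rintro _ ⟨m, rfl⟩
              obtain ⟨m, rfl⟩ := T.mkQ_surjective m
              refine (Submodule.Quotient.mk_eq_zero _).2 ?_
              have : α₁ (y ^ s • T.mkQ m) = x ^ s • α m := by
                rw [← map_smul, hα₁, hy, ← map_pow, hα]
              change α₁ (y ^ s • T.mkQ m) ∈ _
              rw [this]
              exact Submodule.smul_mem_pointwise_smul _ _ _ trivial)
        have hα₂ : ∀ m, α₂ ((LinearMap.range μ).mkQ (T.mkQ m)) = Submodule.Quotient.mk (α m) :=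
          fun m => rfl
        let β₂ : QuotSMulTop (x ^ s) G →+ (M ⧸ T) ⧸ LinearMap.range μ :=
          QuotientAddGroup.lift (x ^ s • (⊤ : Submodule A G)).toAddSubgroup
            (((LinearMap.range μ).mkQ.toAddMonoidHom.comp T.mkQ.toAddMonoidHom).comp β) (by
              intro a ha
              obtain ⟨a, -, rfl⟩ := (Submodule.mem_smul_pointwise_iff_exists _ _ _).1 ha
              refine (Submodule.Quotient.mk_eq_zero _).2 ⟨T.mkQ (β a), ?_⟩
              change y ^ s • T.mkQ (β a) = T.mkQ (β (x ^ s • a))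
              rw [hβ, map_pow, map_smul])
        have hβ₂ : ∀ a : G, β₂ (Submodule.Quotient.mk a) =
            (LinearMap.range μ).mkQ (T.mkQ (β a)) := fun a => rfl
        refine ⟨α₂, β₂, fun a m => ?_, fun a b => ?_, fun m => ?_⟩
        · obtain ⟨m, rfl⟩ := (LinearMap.range μ).mkQ_surjective m
          obtain ⟨m, rfl⟩ := T.mkQ_surjective m
          rw [← map_smul, ← map_smul, hα₂, hα₂, hα, Submodule.Quotient.mk_smul]
        · obtain ⟨b, rfl⟩ := Submodule.Quotient.mk_surjective _ b
          rw [← Submodule.Quotient.mk_smul, hβ₂, hβ₂, hβ, map_smul, map_smul]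
        · obtain ⟨m, rfl⟩ := (LinearMap.range μ).mkQ_surjective m
          obtain ⟨m, rfl⟩ := T.mkQ_surjective m
          rw [hα₂, hβ₂, ← hfαβ]
          rfl
      exact (congrArg (LocCoh.conn hS j) h0).trans (map_zero _)

end Annihilation

/-! ### Powers of the variables as regular sequences -/

section PolynomialRegular

open RingTheory.Sequence
open scoped Pointwise

/-- The ideal of the earlier powers is monomial, so membership is a condition on exponents of the
earlier variables, which multiplication by a power of a new variable does not change. Exponents zero
are harmless: the quotient becomes zero, and weak regularity permits that. -/
theorem MvPolynomial.isWeaklyRegular_X_pow (k : Type v) [Field k] (n : ℕ) (e : Fin n → ℕ) :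
    IsWeaklyRegular (MvPolynomial (Fin n) k)
      (List.ofFn fun l => (MvPolynomial.X l : MvPolynomial (Fin n) k) ^ e l) := by
  refine ⟨fun i hi => ?_⟩
  set A := MvPolynomial (Fin n) k
  have hi' : i < n := by simpa using hi
  set J : Ideal A := Ideal.ofList
    ((List.ofFn fun l => (MvPolynomial.X l : A) ^ e l).take i) with hJ
  have hJ' : J = Ideal.span ((fun s => MvPolynomial.monomial s (1 : k)) ''
      {s | ∃ l : Fin n, l.1 < i ∧ s = Finsupp.single l (e l)}) := by
    rw [hJ, Ideal.ofList]
    congr 1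
    ext f
    simp only [Set.mem_ofPred_eq, Set.mem_image, List.mem_take_iff_getElem]
    constructor
    · rintro ⟨l, hl, rfl⟩
      refine ⟨_, ⟨⟨l, by simp at hl; omega⟩, by simp at hl; exact hl.1, rfl⟩, ?_⟩
      simp [MvPolynomial.X_pow_eq_monomial]
    · rintro ⟨s, ⟨l, hl, rfl⟩, rfl⟩
      exact ⟨l.1, by simp; omega, by simp [MvPolynomial.X_pow_eq_monomial]⟩
  have hmem : ∀ f : A, f ∈ J ↔ ∀ s ∈ f.support, ∃ l : Fin n, l.1 < i ∧ e l ≤ s l := by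
    intro f
    rw [hJ', MvPolynomial.mem_ideal_span_monomial_image]
    refine forall₂_congr fun s _ => ⟨?_, ?_⟩
    · rintro ⟨_, ⟨l, hl, rfl⟩, h⟩
      exact ⟨l, hl, by simpa using h l⟩
    · rintro ⟨l, hl, h⟩
      exact ⟨_, ⟨l, hl, rfl⟩, by simpa using h⟩
  have key : ∀ f : A, (MvPolynomial.X (⟨i, hi'⟩ : Fin n) : A) ^ e ⟨i, hi'⟩ * f ∈ J → f ∈ J := by
    intro f hf
    rw [hmem] at hf ⊢
    intro s hs
    obtain ⟨l, hl, h⟩ := hf (Finsupp.single ⟨i, hi'⟩ (e ⟨i, hi'⟩) + s) (by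
      rw [MvPolynomial.mem_support_iff, MvPolynomial.X_pow_eq_monomial,
        MvPolynomial.coeff_monomial_mul, one_mul]
      exact MvPolynomial.mem_support_iff.1 hs)
    refine ⟨l, hl, ?_⟩
    have hne : (⟨i, hi'⟩ : Fin n) ≠ l := fun h => by rw [← h] at hl; simp at hl
    simpa [Finsupp.single_apply, hne] using h
  rw [isSMulRegular_iff_right_eq_zero_of_smul]
  intro m hm
  obtain ⟨f, rfl⟩ := Submodule.Quotient.mk_surjective _ m
  rw [← Submodule.Quotient.mk_smul, Submodule.Quotient.mk_eq_zero] at hm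
  rw [Submodule.Quotient.mk_eq_zero]
  have hJtop : (J • (⊤ : Submodule A A)) = J := by simp
  rw [hJtop] at hm ⊢
  refine key f ?_
  simpa using hm

theorem MvPolynomial.isPowRegular_X (k : Type v) [Field k] (n : ℕ) (G : Type w) [AddCommGroup G]
    [Module (MvPolynomial (Fin n) k) G] [Module.Flat (MvPolynomial (Fin n) k) G] :
    IsPowRegular G (List.ofFn fun l => (MvPolynomial.X l : MvPolynomial (Fin n) k)) := by
  intro rs' h
  obtain ⟨e, rfl⟩ : ∃ e : Fin n → ℕ,
      rs' = List.ofFn fun l => (MvPolynomial.X l : MvPolynomial (Fin n) k) ^ e l := by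
    rw [List.forall₂_iff_get] at h
    obtain ⟨hlen, h⟩ := h
    simp only [List.length_ofFn] at hlen h
    choose e he using fun l : Fin n => h l.1 l.2 (hlen ▸ l.2)
    refine ⟨e, List.ext_get (by simpa using hlen.symm) fun i h₁ h₂ => ?_⟩
    have := he ⟨i, by simpa using h₂⟩
    simpa using this
  have h1 := (MvPolynomial.isWeaklyRegular_X_pow k n e).isWeaklyRegular_rTensor (M₂ := G)
  exact ((TensorProduct.lid _ G).isWeaklyRegular_congr _).1 h1

end PolynomialRegular

/-! ### The exterior derivative on forms over a subring -/

section ExteriorDerivativeLemmas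

variable (k : Type v) {A : Type u} [CommRing k] [CommRing A] [Algebra k A]

theorem dOne_mul_self (a : A) : dOne k a * dOne k a = 0 := ExteriorAlgebra.ι_sq_zero _

theorem extD_extD (ω : DiffForms k A) : extD k (extD k ω) = 0 := by
  induction ω using CliffordAlgebra.left_induction with
  | algebraMap r =>
    rw [show algebraMap A (CliffordAlgebra (0 : QuadraticForm A Ω[A⁄k])) r =
      r • (1 : DiffForms k A) from Algebra.algebraMap_eq_smul_one r]
    rw [extD_smul, extD_one, smul_zero, zero_add, extD_dOne_mul, extD_one, mul_zero, neg_zero]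
  | add x y hx hy => rw [map_add, map_add, hx, hy, add_zero]
  | ι_mul x m hx =>
    have h : m ∈ Submodule.span A (Set.range (KaehlerDifferential.D k A)) := by
      rw [KaehlerDifferential.span_range_derivation]; trivial
    change extD k (extD k (ExteriorAlgebra.ι A m * x)) = 0
    induction h using Submodule.span_induction with
    | mem m hm =>
      obtain ⟨a, rfl⟩ := hm
      change extD k (extD k (dOne k a * x)) = 0
      rw [extD_dOne_mul, map_neg, extD_dOne_mul, hx, mul_zero, neg_zero, neg_zero]
    | zero => simp
    | add m n _ _ hm hn => rw [map_add, add_mul, map_add, map_add, hm, hn, add_zero]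
    | smul a m _ hm =>
      rw [map_smul, smul_mul_assoc, extD_smul, map_add, extD_smul, hm, smul_zero, zero_add,
        extD_dOne_mul, add_neg_cancel]

end ExteriorDerivativeLemmas

section LocalFormsLemmas

variable {k : Type v} {K : Type u} [CommRing k] [Field K] [Algebra k K]

theorem wedgeD_zero (x : Fin 0 → K) : wedgeD k x = 1 := by
  simp [wedgeD]

theorem wedgeD_succ {i : ℕ} (x : Fin (i + 1) → K) :
    wedgeD k x = dOne k (x 0) * wedgeD k (fun j => x j.succ) := by
  rw [wedgeD, ExteriorAlgebra.ιMulti_succ_apply]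
  rfl

theorem extD_wedgeD {i : ℕ} (x : Fin i → K) : extD k (wedgeD k x) = 0 := by
  induction i with
  | zero => rw [wedgeD_zero, extD_one]
  | succ i ih => rw [wedgeD_succ, extD_dOne_mul, ih, mul_zero, neg_zero]

variable {S : Subalgebra k K} {i : ℕ}

theorem smul_wedgeD_mem_localForms {a : K} (ha : a ∈ S) {x : Fin i → K} (hx : ∀ j, x j ∈ S) :
    a • wedgeD k x ∈ localForms S i :=
  AddSubgroup.subset_closure ⟨a, ha, x, hx, rfl⟩

theorem dOne_mul_mem_localForms {a : K} (ha : a ∈ S) {ω : DiffForms k K}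
    (hω : ω ∈ localForms S i) : dOne k a * ω ∈ localForms S (i + 1) := by
  induction hω using AddSubgroup.closure_induction with
  | mem ω h =>
    obtain ⟨b, hb, x, hx, rfl⟩ := h
    rw [mul_smul_comm, show dOne k a * wedgeD k x = wedgeD k (Fin.cons a x : Fin (i + 1) → K) by
      rw [wedgeD_succ]; rfl]
    exact smul_wedgeD_mem_localForms hb (Fin.cases (by simpa using ha) (by simpa using hx))
  | zero => simp
  | add _ _ _ _ h h' => rw [mul_add]; exact add_mem h h'
  | neg _ _ h => rw [mul_neg]; exact neg_mem h

theorem extD_mem_localForms {ω : DiffForms k K} (hω : ω ∈ localForms S i) :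
    extD k ω ∈ localForms S (i + 1) := by
  induction hω using AddSubgroup.closure_induction with
  | mem ω h =>
    obtain ⟨b, hb, x, hx, rfl⟩ := h
    rw [extD_smul, extD_wedgeD, smul_zero, zero_add, ← one_smul K (wedgeD k x)]
    exact dOne_mul_mem_localForms hb (smul_wedgeD_mem_localForms (one_mem S) hx)
  | zero => simp
  | add _ _ _ _ h h' => rw [map_add]; exact add_mem h h'
  | neg _ _ h => rw [map_neg]; exact neg_mem h

theorem localExact_le_localForms : localExact S i ≤ localForms S i := by
  cases i with
  | zero => exact bot_le
  | succ i =>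
    rintro _ ⟨ω, hω, rfl⟩
    exact extD_mem_localForms hω

theorem extD_eq_zero_of_mem_localExact {ω : DiffForms k K} (hω : ω ∈ localExact S i) :
    extD k ω = 0 := by
  cases i with
  | zero =>
    rw [localExact, AddSubgroup.mem_bot] at hω
    rw [hω, map_zero]
  | succ i =>
    obtain ⟨ω, -, rfl⟩ := hω
    exact extD_extD k ω

theorem extD_mem_localExact {ω : DiffForms k K} (hω : ω ∈ localForms S i) :
    extD k ω ∈ localExact S (i + 1) := ⟨ω, hω, rfl⟩

end LocalFormsLemmas

/-! ### The form y^{p-1} dy modulo exact forms -/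

/-- The polynomial `((y + z)ᵖ - yᵖ - zᵖ) / p`, evaluated at `y` and `z`. -/
def frobeniusDefect {A : Type u} [CommRing A] (p : ℕ) (y z : A) : A :=
  ∑ m ∈ Finset.Ico 1 p, (p.choose m / p : ℕ) • (y ^ m * z ^ (p - m))

section FrobeniusDefect

variable (k : Type v) {A : Type u} [CommRing k] [CommRing A] [Algebra k A]

/-- The absorption identity for binomial coefficients, divided by p. With its mirror image below it
identifies the partial derivatives of `frobeniusDefect`. -/
theorem mul_choose_div (p : ℕ) [hp : Fact p.Prime] {m : ℕ} (h0 : 0 < m) (h1 : m < p) :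
    p.choose m / p * m = (p - 1).choose (m - 1) := by
  obtain ⟨q, hq⟩ := hp.out.dvd_choose_self h0.ne' h1
  have hp0 := hp.out.pos
  rw [hq, Nat.mul_div_cancel_left _ hp0]
  have h := Nat.add_one_mul_choose_eq (p - 1) (m - 1)
  rw [Nat.sub_add_cancel hp0, Nat.sub_add_cancel h0, hq] at h
  have : p * ((p - 1).choose (m - 1)) = p * (q * m) := by rw [h]; ring
  exact (Nat.eq_of_mul_eq_mul_left hp0 this).symm

theorem mul_choose_div' (p : ℕ) [hp : Fact p.Prime] {m : ℕ} (h0 : 0 < m) (h1 : m < p) :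
    p.choose m / p * (p - m) = (p - 1).choose m := by
  have h := mul_choose_div p (m := p - m) (by omega) (by omega)
  rw [Nat.choose_symm h1.le] at h
  rw [h, ← Nat.choose_symm (by omega : m ≤ p - 1)]
  congr 1
  omega

/-- `y ↦ yᵖ⁻¹dy` is additive up to exact forms. -/
theorem pow_smul_D_add (p : ℕ) [hp : Fact p.Prime] (y z : A) :
    (y + z) ^ (p - 1) • KaehlerDifferential.D k A (y + z) =
      y ^ (p - 1) • KaehlerDifferential.D k A y + z ^ (p - 1) • KaehlerDifferential.D k A z +
        KaehlerDifferential.D k A (frobeniusDefect p y z) := by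
  have hp0 := hp.out.pos
  have hterm : ∀ m ∈ Finset.Ico 1 p,
      KaehlerDifferential.D k A ((p.choose m / p : ℕ) • (y ^ m * z ^ (p - m))) =
        ((p - 1).choose (m - 1) * (y ^ (m - 1) * z ^ (p - m)) : A) • KaehlerDifferential.D k A y +
        ((p - 1).choose m * (y ^ m * z ^ (p - 1 - m)) : A) • KaehlerDifferential.D k A z := by
    intro m hm
    rw [Finset.mem_Ico] at hm
    rw [map_nsmul, Derivation.leibniz, Derivation.leibniz_pow, Derivation.leibniz_pow,
      ← mul_choose_div p (by omega) hm.2, ← mul_choose_div' p (by omega) hm.2,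
      show p - m - 1 = p - 1 - m by omega]
    simp only [← Nat.cast_smul_eq_nsmul A, smul_add, smul_smul]
    rw [add_comm]
    push_cast
    congr 2 <;> ring
  have h1 : ∑ m ∈ Finset.Ico 1 p, ((p - 1).choose (m - 1) * (y ^ (m - 1) * z ^ (p - m)) : A) =
      (y + z) ^ (p - 1) - y ^ (p - 1) := by
    rw [add_pow, show p - 1 + 1 = p by omega, eq_sub_iff_add_eq,
      Finset.range_eq_Ico, Finset.sum_Ico_eq_sum_range, ← Finset.range_eq_Ico]
    conv_rhs => rw [show p = (p - 1) + 1 by omega, Finset.sum_range_succ]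
    congr 1
    · refine Finset.sum_congr (by congr 1) fun m hm => ?_
      rw [Finset.mem_range] at hm
      rw [show 1 + m - 1 = m by omega, show p - (1 + m) = p - 1 - m by omega,
        show p - 1 + 1 - 1 - m = p - 1 - m by omega, show p - 1 + 1 - 1 = p - 1 by omega]
      ring
    · simp
  have h2 : ∑ m ∈ Finset.Ico 1 p, ((p - 1).choose m * (y ^ m * z ^ (p - 1 - m)) : A) =
      (y + z) ^ (p - 1) - z ^ (p - 1) := by
    rw [add_pow, show p - 1 + 1 = p by omega, eq_sub_iff_add_eq, Finset.range_eq_Ico,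
      Finset.sum_eq_sum_Ico_succ_bot hp0, add_comm]
    congr 1
    · simp
    · exact Finset.sum_congr rfl fun m _ => by ring
  rw [frobeniusDefect, map_sum, Finset.sum_congr rfl hterm, Finset.sum_add_distrib,
    ← Finset.sum_smul, ← Finset.sum_smul, h1, h2, map_add, smul_add, sub_smul, sub_smul]
  abel

end FrobeniusDefect

theorem addMonoidEnd_mul_apply {M : Type u} [AddCommMonoid M] (f g : AddMonoid.End M) (x : M) :
    (f * g) x = f (g x) := rfl

/-! ### Logarithmic coordinates and Lie derivatives -/

section LogCoordinates

variable {k : Type v} {K : Type u} [CommRing k] [Field K] [Algebra k K]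

/-- A system of coordinates `x₁, …, xᵣ` on `S ⊆ K`, consisting of units: the forms `dxₗ / xₗ` are a
basis of `Ω_K` in which the differentials of elements of `S` have coordinates in `S`, and `S` is
generated by `Sᵖ` and the `xₗ`. -/
structure LogCoords (p : ℕ) (S : Subalgebra k K) (r : ℕ) where
  /-- The coordinates. -/
  x : Fin r → K
  ne_zero : ∀ l, x l ≠ 0
  mem : ∀ l, x l ∈ S
  inv_mem : ∀ l, (x l)⁻¹ ∈ S
  /-- The forms `dxₗ / xₗ`. -/
  basis : Module.Basis (Fin r) K (Ω[K⁄k])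
  basis_eq : ∀ l, basis l = (x l)⁻¹ • KaehlerDifferential.D k K (x l)
  coord_mem : ∀ a ∈ S, ∀ l, basis.coord l (KaehlerDifferential.D k K a) ∈ S
  gen : ∀ a ∈ S, a ∈ AddSubgroup.closure
    {b | ∃ c ∈ S, ∃ e : Fin r → ℕ, b = c ^ p * ∏ l, x l ^ e l}

namespace LogCoords

variable {p : ℕ} {S : Subalgebra k K} {r : ℕ} (X : LogCoords p S r)

/-- The form `dxₗ / xₗ`. -/
def dlog (l : Fin r) : DiffForms k K := ExteriorAlgebra.ι K (X.basis l)

/-- The form `dx_{l₁} / x_{l₁} ∧ ⋯ ∧ dx_{lᵢ} / x_{lᵢ}`. -/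
def dlogMulti {i : ℕ} (l : Fin i → Fin r) : DiffForms k K :=
  ExteriorAlgebra.ιMulti K i fun j => X.basis (l j)

theorem dlogMulti_zero (l : Fin 0 → Fin r) : X.dlogMulti l = 1 := by simp [dlogMulti]

theorem dlogMulti_succ {i : ℕ} (l : Fin (i + 1) → Fin r) :
    X.dlogMulti l = X.dlog (l 0) * X.dlogMulti fun j => l j.succ := by
  rw [dlogMulti, ExteriorAlgebra.ιMulti_succ_apply]
  rfl

theorem dlog_eq (l : Fin r) : X.dlog l = (X.x l)⁻¹ • dOne k (X.x l) := by
  rw [dlog, X.basis_eq, map_smul]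
  rfl

/-- The logarithmic derivation dual to `dxₗ / xₗ`. -/
def theta (l : Fin r) (a : K) : K := X.basis.coord l (KaehlerDifferential.D k K a)

theorem dOne_eq_sum (a : K) : dOne k a = ∑ l, X.theta l a • X.dlog l := by
  rw [dOne]
  conv_lhs => rw [← X.basis.sum_repr (KaehlerDifferential.D k K a), map_sum]
  simp only [map_smul]
  rfl

theorem theta_mul (l : Fin r) (a b : K) : X.theta l (a * b) = a * X.theta l b + b * X.theta l a := by
  simp [theta, Derivation.leibniz]

theorem theta_add (l : Fin r) (a b : K) : X.theta l (a + b) = X.theta l a + X.theta l b := by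
  simp [theta]

theorem theta_x (l m : Fin r) : X.theta l (X.x m) = if l = m then X.x m else 0 := by
  have : KaehlerDifferential.D k K (X.x m) = X.x m • X.basis m := by
    rw [X.basis_eq, smul_smul, mul_inv_cancel₀ (X.ne_zero m), one_smul]
  rw [theta, this, map_smul, Module.Basis.coord_apply, Module.Basis.repr_self,
    Finsupp.single_apply]
  simp [eq_comm]

theorem theta_pow_char [CharP K p] (l : Fin r) (a : K) : X.theta l (a ^ p) = 0 := by
  rw [theta, Derivation.leibniz_pow, ← Nat.cast_smul_eq_nsmul K]
  simp

theorem theta_x_pow (l m : Fin r) (e : ℕ) :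
    X.theta l (X.x m ^ e) = if l = m then (e : K) * X.x m ^ e else 0 := by
  induction e with
  | zero => simp [theta]
  | succ e ih =>
    rw [pow_succ, theta_mul, ih, theta_x]
    split_ifs
    · push_cast; ring
    · simp

theorem theta_prod_pow (l : Fin r) (e : Fin r → ℕ) :
    X.theta l (∏ m, X.x m ^ e m) = e l * ∏ m, X.x m ^ e m := by
  have : ∀ s : Finset (Fin r), X.theta l (∏ m ∈ s, X.x m ^ e m) =
      if l ∈ s then (e l : K) * ∏ m ∈ s, X.x m ^ e m else 0 := by
    intro s
    induction s using Finset.induction_on with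
    | empty => simp [theta]
    | insert m s hm ih =>
      rw [Finset.prod_insert hm, theta_mul, ih, theta_x_pow]
      by_cases hl : l = m
      · subst hl
        simp [hm]
        ring
      · by_cases hs : l ∈ s
        · simp [hl, hs]; ring
        · simp [hl, hs]
  simpa using this Finset.univ

/-- The factor c ^ p is a constant for derivations, so a monomial is an eigenvector whose eigenvalue
is its exponent, an element of the prime field. -/
theorem theta_monomial [CharP K p] (l : Fin r) (c : K) (e : Fin r → ℕ) :
    X.theta l (c ^ p * ∏ m, X.x m ^ e m) = e l * (c ^ p * ∏ m, X.x m ^ e m) := by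
  rw [theta_mul, theta_pow_char, theta_prod_pow]
  ring

theorem extD_dlog_mul (l : Fin r) (ω : DiffForms k K) :
    extD k (X.dlog l * ω) = -(X.dlog l * extD k ω) := by
  have h : dOne k (X.x l)⁻¹ * dOne k (X.x l) = 0 := by
    have : dOne k (X.x l)⁻¹ = (-(X.x l)⁻¹ ^ 2) • dOne k (X.x l) := by
      rw [dOne, Derivation.leibniz_inv, map_smul]
      rfl
    rw [this, smul_mul_assoc, dOne_mul_self, smul_zero]
  rw [dlog_eq, smul_mul_assoc, extD_smul, extD_dOne_mul, ← mul_assoc, h, zero_mul, add_zero,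
    smul_neg, smul_mul_assoc]

theorem extD_dlogMulti {i : ℕ} (l : Fin i → Fin r) : extD k (X.dlogMulti l) = 0 := by
  induction i with
  | zero => rw [dlogMulti_zero, extD_one]
  | succ i ih => rw [dlogMulti_succ, extD_dlog_mul, ih, mul_zero, neg_zero]

theorem dlogMulti_eq {i : ℕ} (l : Fin i → Fin r) :
    X.dlogMulti l = (∏ j, (X.x (l j))⁻¹) • wedgeD k fun j => X.x (l j) := by
  induction i with
  | zero => simp [dlogMulti_zero, wedgeD_zero]
  | succ i ih =>
    rw [dlogMulti_succ, ih, dlog_eq, wedgeD_succ, Fin.prod_univ_succ, smul_mul_smul_comm]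

theorem smul_dlogMulti_mem {i : ℕ} {a : K} (ha : a ∈ S) (l : Fin i → Fin r) :
    a • X.dlogMulti l ∈ localForms S i := by
  rw [dlogMulti_eq, smul_smul]
  exact smul_wedgeD_mem_localForms (mul_mem ha (prod_mem fun j _ => X.inv_mem _)) fun j => X.mem _

theorem localForms_eq (i : ℕ) : localForms S i =
    AddSubgroup.closure {ω | ∃ a ∈ S, ∃ l : Fin i → Fin r, ω = a • X.dlogMulti l} := by
  refine le_antisymm ((AddSubgroup.closure_le _).2 ?_) ((AddSubgroup.closure_le _).2 ?_)
  · suffices h : ∀ (i : ℕ) (a : K), a ∈ S → ∀ x : Fin i → K, (∀ j, x j ∈ S) → a • wedgeD k x ∈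
        AddSubgroup.closure {ω | ∃ a ∈ S, ∃ l : Fin i → Fin r, ω = a • X.dlogMulti l} by
      rintro _ ⟨a, ha, x, hx, rfl⟩
      exact h i a ha x hx
    intro i
    induction i with
    | zero =>
      intro a ha x _
      exact AddSubgroup.subset_closure ⟨a, ha, Fin.elim0, by rw [wedgeD_zero, dlogMulti_zero]⟩
    | succ i ih =>
      intro a ha x hx
      rw [wedgeD_succ, X.dOne_eq_sum, Finset.sum_mul, Finset.smul_sum]
      refine sum_mem fun l _ => ?_
      rw [← mul_smul_comm, smul_mul_assoc, ← mul_smul_comm, smul_smul]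
      have := ih (X.theta l (x 0) * a) (mul_mem (X.coord_mem _ (hx 0) l) ha)
        (fun j => x j.succ) fun j => hx j.succ
      generalize (X.theta l (x 0) * a) • wedgeD k (fun j => x j.succ) = η at this
      induction this using AddSubgroup.closure_induction with
      | mem ω h =>
        obtain ⟨b, hb, m, rfl⟩ := h
        rw [mul_smul_comm]
        refine AddSubgroup.subset_closure ⟨b, hb, (Fin.cons l m : Fin (i + 1) → Fin r), ?_⟩
        rw [dlogMulti_succ]
        rfl
      | zero => simp
      | add _ _ _ _ h h' => rw [mul_add]; exact add_mem h h'
      | neg _ _ h => rw [mul_neg]; exact neg_mem h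
  · rintro _ ⟨a, ha, l, rfl⟩
    exact X.smul_dlogMulti_mem ha l

/-- Reduces statements on forms to monomials times products of dx/x, which are simultaneous
eigenvectors of all `lie l`. -/
theorem localForms_induction {i : ℕ} {C : DiffForms k K → Prop} {ω : DiffForms k K}
    (hω : ω ∈ localForms S i) (h0 : C 0) (hadd : ∀ ω η, C ω → C η → C (ω + η))
    (hneg : ∀ ω, C ω → C (-ω))
    (hmon : ∀ c ∈ S, ∀ e : Fin r → ℕ, ∀ l : Fin i → Fin r,
      C ((c ^ p * ∏ m, X.x m ^ e m) • X.dlogMulti l)) : C ω := by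
  rw [X.localForms_eq] at hω
  induction hω using AddSubgroup.closure_induction with
  | mem ω h =>
    obtain ⟨a, ha, l, rfl⟩ := h
    have := X.gen a ha
    clear ha
    induction this using AddSubgroup.closure_induction with
    | mem a h =>
      obtain ⟨c, hc, e, rfl⟩ := h
      exact hmon c hc e l
    | zero => simpa using h0
    | add _ _ _ _ h h' => rw [add_smul]; exact hadd _ _ h h'
    | neg _ _ h => rw [neg_smul]; exact hneg _ h
  | zero => exact h0
  | add _ _ _ _ h h' => exact hadd _ _ h h'
  | neg _ _ h => exact hneg _ h

/-- The interior product with the logarithmic derivation `theta l`. -/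
def contract (l : Fin r) : DiffForms k K →ₗ[K] DiffForms k K :=
  CliffordAlgebra.contractLeft (X.basis.coord l)

theorem contract_ι_mul (l : Fin r) (μ : Ω[K⁄k]) (ω : DiffForms k K) :
    X.contract l (ExteriorAlgebra.ι K μ * ω) =
      X.basis.coord l μ • ω - ExteriorAlgebra.ι K μ * X.contract l ω :=
  CliffordAlgebra.contractLeft_ι_mul _ _ _

theorem contract_one (l : Fin r) : X.contract l 1 = 0 := CliffordAlgebra.contractLeft_one _ _

theorem contract_mem_localForms (l : Fin r) {i : ℕ} {ω : DiffForms k K}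
    (hω : ω ∈ localForms S (i + 1)) : X.contract l ω ∈ localForms S i := by
  rw [X.localForms_eq] at hω
  induction hω using AddSubgroup.closure_induction with
  | mem ω h =>
    obtain ⟨a, ha, m, rfl⟩ := h
    rw [map_smul]
    refine smul_mem_localForms ha ?_
    clear ha a
    induction i with
    | zero =>
      rw [dlogMulti_succ, dlog, contract_ι_mul, dlogMulti_zero, contract_one, mul_zero, sub_zero,
        Module.Basis.coord_apply, Module.Basis.repr_self, ← X.dlogMulti_zero Fin.elim0]
      refine X.smul_dlogMulti_mem ?_ _
      rw [Finsupp.single_apply]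
      split_ifs
      exacts [one_mem S, zero_mem S]
    | succ i ih =>
      rw [dlogMulti_succ, dlog, contract_ι_mul]
      refine sub_mem ?_ ?_
      · rw [Module.Basis.coord_apply, Module.Basis.repr_self]
        refine X.smul_dlogMulti_mem ?_ _
        rw [Finsupp.single_apply]
        split_ifs
        exacts [one_mem S, zero_mem S]
      · change X.dlog (m 0) * _ ∈ _
        rw [dlog_eq, smul_mul_assoc]
        exact smul_mem_localForms (X.inv_mem _) (dOne_mul_mem_localForms (X.mem _) (ih _))
  | zero => simp
  | add _ _ _ _ h h' => rw [map_add]; exact add_mem h h'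
  | neg _ _ h => rw [map_neg]; exact neg_mem h

theorem contract_eq_zero_of_mem_localForms_zero (l : Fin r) {ω : DiffForms k K}
    (hω : ω ∈ localForms S 0) : X.contract l ω = 0 := by
  induction hω using AddSubgroup.closure_induction with
  | mem ω h =>
    obtain ⟨a, ha, x, hx, rfl⟩ := h
    rw [map_smul, wedgeD_zero, contract_one, smul_zero]
  | zero => simp
  | add _ _ _ _ h h' => rw [map_add, h, h', add_zero]
  | neg _ _ h => rw [map_neg, h, neg_zero]

/-- The Lie derivative along the logarithmic derivation `theta l`. -/
def lie (l : Fin r) : AddMonoid.End (DiffForms k K) :=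
  (extD k).comp (X.contract l).toAddMonoidHom + (X.contract l).toAddMonoidHom.comp (extD k)

theorem lie_apply (l : Fin r) (ω : DiffForms k K) :
    X.lie l ω = extD k (X.contract l ω) + X.contract l (extD k ω) := rfl

theorem lie_smul (l : Fin r) (a : K) (ω : DiffForms k K) :
    X.lie l (a • ω) = X.theta l a • ω + a • X.lie l ω := by
  rw [lie_apply, lie_apply, map_smul, extD_smul, extD_smul, map_add, map_smul, dOne,
    contract_ι_mul, smul_add, theta]
  abel

theorem lie_dlog_mul (l m : Fin r) (ω : DiffForms k K) :
    X.lie l (X.dlog m * ω) = X.dlog m * X.lie l ω := by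
  have h : X.basis.coord l (X.basis m) = if m = l then 1 else 0 := by
    rw [Module.Basis.coord_apply, Module.Basis.repr_self, Finsupp.single_apply]
  rw [lie_apply, extD_dlog_mul, map_neg, dlog, contract_ι_mul, contract_ι_mul, map_sub, h,
    show ExteriorAlgebra.ι K (X.basis m) = X.dlog m from rfl, extD_dlog_mul, lie_apply, mul_add]
  split_ifs
  · simp
    abel
  · simp

theorem lie_one (l : Fin r) : X.lie l 1 = 0 := by
  rw [lie_apply, contract_one, extD_one, map_zero, map_zero, add_zero]

theorem lie_dlogMulti (l : Fin r) {i : ℕ} (m : Fin i → Fin r) : X.lie l (X.dlogMulti m) = 0 := by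
  induction i with
  | zero => rw [dlogMulti_zero, lie_one]
  | succ i ih => rw [dlogMulti_succ, lie_dlog_mul, ih, mul_zero]

theorem lie_extD (l : Fin r) (ω : DiffForms k K) : X.lie l (extD k ω) = extD k (X.lie l ω) := by
  rw [lie_apply, lie_apply, extD_extD, map_zero, add_zero, map_add, extD_extD, zero_add]

theorem lie_mem_localForms (l : Fin r) {i : ℕ} {ω : DiffForms k K} (hω : ω ∈ localForms S i) :
    X.lie l ω ∈ localForms S i := by
  rw [lie_apply]
  refine add_mem ?_ (X.contract_mem_localForms l (extD_mem_localForms hω))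
  cases i with
  | zero => rw [X.contract_eq_zero_of_mem_localForms_zero l hω, map_zero]; exact zero_mem _
  | succ i => exact extD_mem_localForms (X.contract_mem_localForms l hω)

/-- Cartan's formula: on a closed form only d of the contraction survives, and in degree zero the
contraction itself vanishes. -/
theorem lie_mem_localExact (l : Fin r) {i : ℕ} {ω : DiffForms k K} (hω : ω ∈ localForms S i)
    (hd : extD k ω = 0) : X.lie l ω ∈ localExact S i := by
  rw [lie_apply, hd, map_zero, add_zero]
  cases i with
  | zero => rw [X.contract_eq_zero_of_mem_localForms_zero l hω, map_zero]; exact zero_mem _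
  | succ i => exact extD_mem_localExact (X.contract_mem_localForms l hω)

theorem lie_monomial [CharP K p] (l : Fin r) (c : K) (e : Fin r → ℕ) {i : ℕ}
    (m : Fin i → Fin r) :
    X.lie l ((c ^ p * ∏ n, X.x n ^ e n) • X.dlogMulti m) =
      (e l : K) • (c ^ p * ∏ n, X.x n ^ e n) • X.dlogMulti m := by
  rw [lie_smul, lie_dlogMulti, smul_zero, add_zero, theta_monomial, mul_smul]

variable (p) in
/-- The projection onto the forms killed by `lie l`. -/
def proj (l : Fin r) : AddMonoid.End (DiffForms k K) := 1 - X.lie l ^ (p - 1)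

theorem proj_apply (l : Fin r) (ω : DiffForms k K) :
    X.proj p l ω = ω - (X.lie l ^ (p - 1)) ω := rfl

theorem lie_natCast_smul (l : Fin r) (n : ℕ) (ω : DiffForms k K) :
    X.lie l ((n : K) • ω) = (n : K) • X.lie l ω := by
  rw [Nat.cast_smul_eq_nsmul, map_nsmul, Nat.cast_smul_eq_nsmul]

theorem lie_pow_monomial [CharP K p] (l : Fin r) (c : K) (e : Fin r → ℕ) {i : ℕ}
    (m : Fin i → Fin r) (n : ℕ) :
    (X.lie l ^ n) ((c ^ p * ∏ n, X.x n ^ e n) • X.dlogMulti m) =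
      (e l : K) ^ n • (c ^ p * ∏ n, X.x n ^ e n) • X.dlogMulti m := by
  induction n with
  | zero => simp
  | succ n ih =>
    rw [pow_succ', addMonoidEnd_mul_apply, ih, ← Nat.cast_pow, lie_natCast_smul, lie_monomial,
      smul_smul]
    push_cast
    rw [← pow_succ]

/-- Fermat's little theorem: the (p - 1)-st power of the eigenvalue e l is 0 or 1, according to
whether p divides e l or not. -/
theorem proj_monomial [Fact p.Prime] [CharP K p] (l : Fin r) (c : K) (e : Fin r → ℕ) {i : ℕ}
    (m : Fin i → Fin r) :
    X.proj p l ((c ^ p * ∏ n, X.x n ^ e n) • X.dlogMulti m) =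
      if p ∣ e l then (c ^ p * ∏ n, X.x n ^ e n) • X.dlogMulti m else 0 := by
  have hp := (Fact.out : p.Prime)
  rw [proj_apply, lie_pow_monomial]
  split_ifs with h
  · rw [(CharP.cast_eq_zero_iff K p (e l)).2 h, zero_pow (by have := hp.two_le; omega), zero_smul,
      sub_zero]
  · have : (e l : K) ^ (p - 1) = 1 := by
      have h1 : ((e l : ZMod p)) ^ (p - 1) = 1 := by
        refine ZMod.pow_card_sub_one_eq_one ?_
        rwa [Ne, CharP.cast_eq_zero_iff (ZMod p) p]
      have := congrArg (ZMod.castHom (dvd_refl p) K) h1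
      simpa using this
    rw [this, one_smul, sub_self]

variable (p) in
/-- The projection onto the forms killed by all `lie l`. -/
def projAll : AddMonoid.End (DiffForms k K) := ((List.finRange r).map (X.proj p)).prod

theorem projAll_monomial [Fact p.Prime] [CharP K p] (c : K) (e : Fin r → ℕ) {i : ℕ}
    (m : Fin i → Fin r) :
    X.projAll p ((c ^ p * ∏ n, X.x n ^ e n) • X.dlogMulti m) =
      if ∀ l, p ∣ e l then (c ^ p * ∏ n, X.x n ^ e n) • X.dlogMulti m else 0 := by
  have : ∀ L : List (Fin r), (L.map (X.proj p)).prod ((c ^ p * ∏ n, X.x n ^ e n) • X.dlogMulti m) =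
      if ∀ l ∈ L, p ∣ e l then (c ^ p * ∏ n, X.x n ^ e n) • X.dlogMulti m else 0 := by
    intro L
    induction L with
    | nil => simp
    | cons l L ih =>
      rw [List.map_cons, List.prod_cons, addMonoidEnd_mul_apply, ih]
      by_cases hL : ∀ l ∈ L, p ∣ e l
      · rw [if_pos hL, proj_monomial]
        by_cases hl : p ∣ e l
        · rw [if_pos hl, if_pos (by simpa [hl] using hL)]
        · rw [if_neg hl, if_neg (by simp [hl])]
      · rw [if_neg hL, map_zero, if_neg (by simp only [List.forall_mem_cons]; tauto)]
  rw [projAll, this]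
  simp

theorem lie_pow_extD (l : Fin r) (n : ℕ) (ω : DiffForms k K) :
    (X.lie l ^ n) (extD k ω) = extD k ((X.lie l ^ n) ω) := by
  induction n with
  | zero => rfl
  | succ n ih => rw [pow_succ', addMonoidEnd_mul_apply, addMonoidEnd_mul_apply, ih, lie_extD]

theorem proj_extD (l : Fin r) (ω : DiffForms k K) :
    X.proj p l (extD k ω) = extD k (X.proj p l ω) := by
  rw [proj_apply, proj_apply, lie_pow_extD, map_sub]

theorem projAll_extD (ω : DiffForms k K) :
    X.projAll p (extD k ω) = extD k (X.projAll p ω) := by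
  rw [projAll]
  induction List.finRange r with
  | nil => rfl
  | cons l L ih =>
    rw [List.map_cons, List.prod_cons, addMonoidEnd_mul_apply, addMonoidEnd_mul_apply, ih,
      proj_extD]

theorem lie_pow_mem_localForms (l : Fin r) (n : ℕ) {i : ℕ} {ω : DiffForms k K}
    (hω : ω ∈ localForms S i) : (X.lie l ^ n) ω ∈ localForms S i := by
  induction n with
  | zero => exact hω
  | succ n ih => rw [pow_succ', addMonoidEnd_mul_apply]; exact X.lie_mem_localForms l ih

/-- The difference between 1 and `proj l` is a positive power of `lie l`, which maps closed forms to
exact ones. The projections are applied one after another; each changes the form by an exact form,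
so the result stays closed and regular. -/
theorem sub_projAll_mem_localExact [hp : Fact p.Prime] {i : ℕ} {ω : DiffForms k K}
    (hω : ω ∈ localForms S i) (hd : extD k ω = 0) : ω - X.projAll p ω ∈ localExact S i := by
  have h1 : ∀ (l : Fin r) (ω : DiffForms k K), ω ∈ localForms S i → extD k ω = 0 →
      ω - X.proj p l ω ∈ localExact S i := by
    intro l ω hω hd
    have : ω - X.proj p l ω = X.lie l ((X.lie l ^ (p - 2)) ω) := by
      rw [← addMonoidEnd_mul_apply, ← pow_succ',
        show p - 2 + 1 = p - 1 by have := hp.out.two_le; omega, proj_apply, sub_sub_cancel]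
    rw [this]
    refine X.lie_mem_localExact l (X.lie_pow_mem_localForms l _ hω) ?_
    rw [← lie_pow_extD, hd, map_zero]
  rw [projAll]
  suffices h : ∀ L : List (Fin r), ω - (L.map (X.proj p)).prod ω ∈ localExact S i from h _
  intro L
  induction L with
  | nil => rw [List.map_nil, List.prod_nil]; exact (sub_self ω).symm ▸ zero_mem _
  | cons l L ih =>
    rw [List.map_cons, List.prod_cons, addMonoidEnd_mul_apply]
    set η := (L.map (X.proj p)).prod ω with hη
    have hη' : η = ω - (ω - η) := (sub_sub_cancel _ _).symm
    have := add_mem ih (h1 l η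
      (by rw [hη']; exact sub_mem hω (localExact_le_localForms ih))
      (by rw [hη', map_sub, hd, extD_eq_zero_of_mem_localExact ih, sub_zero]))
    simpa using this

end LogCoords

end LogCoordinates

/-! ### Cartier's theorem in logarithmic coordinates -/

section CartierCoordinates

variable {k : Type v} {K : Type u} [CommRing k] [Field K] [Algebra k K]

/-- The algebra of forms over `K`, on which `a ∈ K` acts as `aᵖ`. -/
def FrobForms (k : Type v) (K : Type u) [CommRing k] [Field K] [Algebra k K] (_p : ℕ) : Type u :=
  DiffForms k K

namespace FrobForms

variable (k K) (p : ℕ)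

instance : Ring (FrobForms k K p) := inferInstanceAs (Ring (DiffForms k K))

instance [ExpChar K p] : Algebra K (FrobForms k K p) :=
  Algebra.compHom (DiffForms k K) (frobenius K p)

end FrobForms

theorem extD_pow_smul_dOne_mul (p : ℕ) (y : K) (τ : DiffForms k K) :
    extD k ((y ^ (p - 1) • dOne k y) * τ) = -((y ^ (p - 1) • dOne k y) * extD k τ) := by
  have h : dOne k (y ^ (p - 1)) * dOne k y = 0 := by
    have : dOne k (y ^ (p - 1)) = ((p - 1 : ℕ) • y ^ (p - 1 - 1)) • dOne k y := by
      rw [dOne, Derivation.leibniz_pow, map_nsmul, map_smul, smul_assoc]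
      rfl
    rw [this, smul_mul_assoc, dOne_mul_self, smul_zero]
  rw [smul_mul_assoc, extD_smul, extD_dOne_mul, ← mul_assoc, h, zero_mul, add_zero, smul_neg,
    smul_mul_assoc]

namespace LogCoords

variable {p : ℕ} [hp : Fact p.Prime] [CharP K p] {S : Subalgebra k K} {r : ℕ} (X : LogCoords p S r)

/-- The form `dxₗ / xₗ`, as an element of `FrobForms`. -/
def frobDlog (l : Fin r) : FrobForms k K p := X.dlog l

/-- The restriction to one-forms of the Frobenius lift `invC`. -/
def invCOne : Ω[K⁄k] →ₗ[K] FrobForms k K p := X.basis.constr ℕ X.frobDlog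

theorem invCOne_sq (μ : Ω[K⁄k]) : X.invCOne μ * X.invCOne μ = 0 := by
  have : X.invCOne μ = ExteriorAlgebra.ι K (∑ l, (X.basis.repr μ l) ^ p • X.basis l) := by
    rw [invCOne, Module.Basis.constr_apply_fintype, map_sum]
    refine Finset.sum_congr rfl fun l _ => ?_
    rw [map_smul]
    rfl
  rw [this]
  exact ExteriorAlgebra.ι_sq_zero _

/-- The Frobenius-semilinear ring endomorphism of the forms over `K` which fixes the `dxₗ / xₗ`. -/
def invC : DiffForms k K →+* DiffForms k K :=
  (ExteriorAlgebra.lift K ⟨X.invCOne, X.invCOne_sq⟩ : DiffForms k K →ₐ[K] FrobForms k K p).toRingHom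

theorem invC_smul (a : K) (ω : DiffForms k K) : X.invC (a • ω) = a ^ p • X.invC ω :=
  map_smul (ExteriorAlgebra.lift K ⟨X.invCOne, X.invCOne_sq⟩ :
    DiffForms k K →ₐ[K] FrobForms k K p) a ω

theorem invC_dlog (l : Fin r) : X.invC (X.dlog l) = X.dlog l := by
  have h : (ExteriorAlgebra.lift K ⟨X.invCOne, X.invCOne_sq⟩ :
    DiffForms k K →ₐ[K] FrobForms k K p) (ExteriorAlgebra.ι K (X.basis l)) = X.invCOne (X.basis l) :=
    ExteriorAlgebra.lift_ι_apply K _ _ _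
  refine Eq.trans h ?_
  rw [invCOne, Module.Basis.constr_basis]
  rfl

theorem invC_dlogMulti {i : ℕ} (l : Fin i → Fin r) : X.invC (X.dlogMulti l) = X.dlogMulti l := by
  induction i with
  | zero => rw [dlogMulti_zero, map_one]
  | succ i ih => rw [dlogMulti_succ, map_mul, ih, invC_dlog]

/-- In the basis of products of the dx/x, `invC` raises each coefficient to the p-th power. -/
theorem invC_injective : Function.Injective X.invC := by
  rw [injective_iff_map_eq_zero]
  intro ω hω
  let b := X.basis.ExteriorAlgebra
  have hb : ∀ s, X.invC (b s) = b s := by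
    intro s
    rw [ExteriorAlgebra.basis_apply]
    exact X.invC_dlogMulti _
  have hsum : ω = ∑ s, b.repr ω s • b s := (b.sum_repr ω).symm
  have h : ∑ s, (b.repr ω s) ^ p • b s = 0 := by
    rw [hsum, map_sum] at hω
    refine Eq.trans (Finset.sum_congr rfl fun s _ => ?_) hω
    rw [invC_smul, hb]
  have h' := Fintype.linearIndependent_iff.1 b.linearIndependent _ h
  rw [hsum]
  exact Finset.sum_eq_zero fun s _ => by
    rw [(pow_eq_zero_iff hp.out.ne_zero).1 (h' s), zero_smul]

theorem invC_mem_localForms {i : ℕ} {ω : DiffForms k K} (hω : ω ∈ localForms S i) :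
    X.invC ω ∈ localForms S i := by
  rw [X.localForms_eq] at hω
  induction hω using AddSubgroup.closure_induction with
  | mem ω h =>
    obtain ⟨a, ha, l, rfl⟩ := h
    rw [invC_smul, invC_dlogMulti]
    exact X.smul_dlogMulti_mem (pow_mem ha p) l
  | zero => simp
  | add _ _ _ _ h h' => rw [map_add]; exact add_mem h h'
  | neg _ _ h => rw [map_neg]; exact neg_mem h

theorem extD_invC {i : ℕ} {ω : DiffForms k K} (hω : ω ∈ localForms S i) :
    extD k (X.invC ω) = 0 := by
  rw [X.localForms_eq] at hω
  induction hω using AddSubgroup.closure_induction with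
  | mem ω h =>
    obtain ⟨a, ha, l, rfl⟩ := h
    rw [invC_smul, invC_dlogMulti, extD_pow_smul, extD_dlogMulti, smul_zero]
  | zero => simp
  | add _ _ _ _ h h' => rw [map_add, map_add, h, h', add_zero]
  | neg _ _ h => rw [map_neg, map_neg, h, neg_zero]

/-- A monomial that survives the projection has all exponents divisible by p, so its coefficient is
a p-th power. -/
theorem projAll_mem {i : ℕ} {ω : DiffForms k K} (hω : ω ∈ localForms S i) :
    ∃ η ∈ localForms S i, X.projAll p ω = X.invC η := by
  refine X.localForms_induction
    (C := fun ω => ∃ η ∈ localForms S i, X.projAll p ω = X.invC η) hω ⟨0, zero_mem _, by simp⟩ ?_ ?_ ?_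
  · rintro ω₁ ω₂ ⟨η₁, h₁, e₁⟩ ⟨η₂, h₂, e₂⟩
    exact ⟨η₁ + η₂, add_mem h₁ h₂, by rw [map_add, e₁, e₂, map_add]⟩
  · rintro ω₁ ⟨η₁, h₁, e₁⟩
    exact ⟨-η₁, neg_mem h₁, by rw [map_neg, e₁, map_neg]⟩
  · intro c hc e l
    rw [projAll_monomial]
    split_ifs with h
    · refine ⟨(c * ∏ m, X.x m ^ (e m / p)) • X.dlogMulti l,
        X.smul_dlogMulti_mem (mul_mem hc (prod_mem fun m _ => pow_mem (X.mem m) _)) l, ?_⟩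
      rw [invC_smul, invC_dlogMulti, mul_pow, ← Finset.prod_pow]
      congr 2
      refine Finset.prod_congr rfl fun m _ => ?_
      rw [← pow_mul, Nat.div_mul_cancel (h m)]
    · exact ⟨0, zero_mem _, by simp⟩

theorem projAll_invC {i : ℕ} {ω : DiffForms k K} (hω : ω ∈ localForms S i) :
    X.projAll p (X.invC ω) = X.invC ω := by
  rw [X.localForms_eq] at hω
  induction hω using AddSubgroup.closure_induction with
  | mem ω h =>
    obtain ⟨a, ha, l, rfl⟩ := h
    have := X.projAll_monomial a 0 l
    simpa [invC_smul, invC_dlogMulti] using this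
  | zero => simp
  | add _ _ _ _ h h' => rw [map_add, map_add, h, h']
  | neg _ _ h => rw [map_neg, map_neg, h]

/-- Every closed form is, up to exact forms, in the image of `invC`. -/
theorem exists_sub_invC_mem_localExact {i : ℕ} {ω : DiffForms k K} (hω : ω ∈ localForms S i)
    (hd : extD k ω = 0) : ∃ η ∈ localForms S i, ω - X.invC η ∈ localExact S i := by
  obtain ⟨η, hη, e⟩ := X.projAll_mem hω
  exact ⟨η, hη, e ▸ X.sub_projAll_mem_localExact hω hd⟩

/-- The injectivity half of Cartier's theorem. The projection commutes with d and takes values in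
the closed forms `invC η'`, so it kills exact forms; but it fixes `invC η`. -/
theorem eq_zero_of_invC_mem_localExact {i : ℕ} {η : DiffForms k K} (hη : η ∈ localForms S i)
    (h : X.invC η ∈ localExact S i) : η = 0 := by
  apply X.invC_injective
  rw [map_zero, ← X.projAll_invC hη]
  cases i with
  | zero => rw [show X.invC η = 0 from h, map_zero]
  | succ i =>
    obtain ⟨τ, hτ, e⟩ := h
    obtain ⟨η', hη', e'⟩ := X.projAll_mem hτ
    rw [← e, projAll_extD, e', X.extD_invC hη']

/-- `invC (dy)` is `yᵖ⁻¹ dy` up to an exact form. -/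
theorem invC_dOne {y : K} (hy : y ∈ S) :
    ∃ s ∈ S, X.invC (dOne k y) = y ^ (p - 1) • dOne k y + dOne k s := by
  have := X.gen y hy
  have hpow : ∀ y : K, y ^ (p - 1) • dOne k y =
      ExteriorAlgebra.ι K (y ^ (p - 1) • KaehlerDifferential.D k K y) := fun y => by
    rw [map_smul]; rfl
  have hadd : ∀ y z : K, dOne k (y + z) = dOne k y + dOne k z := fun y z => by simp [dOne]
  have hneg : ∀ y : K, dOne k (-y) = -dOne k y := fun y => by simp [dOne]
  -- Membership in S is carried along the induction, since in the case of a sum the correction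
  -- `frobeniusDefect p y z` has to lie in S.
  suffices h : y ∈ S ∧ ∃ s ∈ S, X.invC (dOne k y) = y ^ (p - 1) • dOne k y + dOne k s from h.2
  clear hy
  have hmon : ∀ y ∈ {b | ∃ c ∈ S, ∃ e : Fin r → ℕ, b = c ^ p * ∏ l, X.x l ^ e l},
      y ∈ S ∧ ∃ s ∈ S, X.invC (dOne k y) = y ^ (p - 1) • dOne k y + dOne k s := by
    rintro y ⟨c, hc, e, rfl⟩
    refine ⟨mul_mem (pow_mem hc p) (prod_mem fun l _ => pow_mem (X.mem l) _), 0, zero_mem S, ?_⟩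
    rw [X.dOne_eq_sum, map_sum, Finset.smul_sum, show dOne k (0 : K) = 0 by simp [dOne], add_zero]
    refine Finset.sum_congr rfl fun l _ => ?_
    rw [invC_smul, invC_dlog, theta_monomial, smul_smul, mul_pow]
    -- The logarithmic derivatives of a monomial lie in the prime field, where Frobenius is the
    -- identity.
    have : (e l : K) ^ p = e l := by
      have h1 : ((e l : ZMod p)) ^ p = e l := ZMod.pow_card _
      have := congrArg (ZMod.castHom (dvd_refl p) K) h1
      rwa [map_pow, map_natCast] at this
    rw [this]
    congr 1
    rw [← pow_sub_one_mul hp.out.ne_zero]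
    ring
  induction this using AddSubgroup.closure_induction with
  | mem y h => exact hmon y h
  | zero =>
    refine ⟨zero_mem S, 0, zero_mem S, ?_⟩
    simp [dOne]
  | add y z _ _ h h' =>
    obtain ⟨hy, s, hs, e⟩ := h
    obtain ⟨hz, t, ht, e'⟩ := h'
    have hdef : frobeniusDefect p y z ∈ S :=
      sum_mem fun m _ => nsmul_mem (mul_mem (pow_mem hy _) (pow_mem hz _)) _
    refine ⟨add_mem hy hz, s + t - frobeniusDefect p y z, sub_mem (add_mem hs ht) hdef, ?_⟩
    rw [hpow, pow_smul_D_add, map_add, map_add, ← hpow, ← hpow, hadd, map_add, e, e', sub_eq_add_neg,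
      hadd, hadd, hneg]
    change _ = _ + dOne k _ + _
    abel
  | neg y _ h =>
    obtain ⟨hy, s, hs, e⟩ := h
    refine ⟨neg_mem hy, -s, neg_mem hs, ?_⟩
    have h1 : (-y) ^ (p - 1) = y ^ (p - 1) := by
      rcases hp.out.eq_two_or_odd' with h2 | h2
      · have : CharP K 2 := h2 ▸ inferInstance
        rw [CharTwo.neg_eq]
      · exact (Nat.Odd.sub_odd h2 odd_one).neg_pow y
    rw [hneg, hneg, map_neg, e, h1, smul_neg, neg_add]

/-- Since `invC` is multiplicative, the factors can be corrected one at a time. The error of a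
factor is ds wedged with a closed form, which is exact; and wedging with the closed form y^{p-1} dy
preserves exactness. -/
theorem invC_wedgeD {i : ℕ} {y : Fin i → K} (hy : ∀ j, y j ∈ S) :
    X.invC (wedgeD k y) - (∏ j, y j ^ (p - 1)) • wedgeD k y ∈ localExact S i := by
  induction i with
  | zero => simp [wedgeD_zero]
  | succ i ih =>
    obtain ⟨s, hs, e⟩ := X.invC_dOne (hy 0)
    specialize ih fun j => hy j.succ
    set η := wedgeD k fun j => y j.succ with hη
    set c := ∏ j : Fin i, y j.succ ^ (p - 1) with hc
    set u := y 0 ^ (p - 1) • dOne k (y 0) with hu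
    have hηmem : η ∈ localForms S i := by
      rw [← one_smul K η]
      exact smul_wedgeD_mem_localForms (one_mem S) fun j => hy j.succ
    have hcη : extD k (c • η) = 0 := by
      have : c • η = X.invC η - (X.invC η - c • η) := (sub_sub_cancel _ _).symm
      rw [this, map_sub, X.extD_invC hηmem, extD_eq_zero_of_mem_localExact ih, sub_zero]
    have hcS : c ∈ S := prod_mem fun j _ => pow_mem (hy j.succ) _
    have e1 : X.invC (wedgeD k y) - (∏ j, y j ^ (p - 1)) • wedgeD k y =
        u * (X.invC η - c • η) + dOne k s * X.invC η := by
      rw [wedgeD_succ, map_mul, e, Fin.prod_univ_succ, ← hη, ← hc, add_mul, mul_sub, hu,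
        smul_mul_smul_comm]
      abel
    rw [e1]
    refine add_mem ?_ ?_
    · cases i with
      | zero =>
        rw [show X.invC η - c • η = 0 from ih, mul_zero]
        exact zero_mem _
      | succ i =>
        obtain ⟨τ, hτ, e2⟩ := ih
        rw [← e2]
        refine ⟨-(u * τ), neg_mem ?_, ?_⟩
        · rw [hu, smul_mul_assoc]
          exact smul_mem_localForms (pow_mem (hy 0) _) (dOne_mul_mem_localForms (hy 0) hτ)
        · rw [map_neg, hu, extD_pow_smul_dOne_mul, neg_neg]
    · refine ⟨s • X.invC η, smul_mem_localForms hs (X.invC_mem_localForms hηmem), ?_⟩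
      rw [extD_smul, X.extD_invC hηmem, smul_zero, zero_add]

/-- The graph of the Cartier operator in terms of coordinates. -/
theorem mem_cartierGraph_iff {i : ℕ} {ω η : DiffForms k K} :
    (ω, η) ∈ cartierGraph p S i ↔ η ∈ localForms S i ∧ ω - X.invC η ∈ localExact S i := by
  constructor
  · intro h
    suffices H : ∀ z ∈ cartierGraph p S i,
        z.2 ∈ localForms S i ∧ z.1 - X.invC z.2 ∈ localExact S i from H _ h
    intro z hz
    induction hz using AddSubgroup.closure_induction with
    | mem z h =>
      rcases h with ⟨a, ha, y, hy, rfl⟩ | ⟨h₁, h₂⟩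
      · refine ⟨smul_wedgeD_mem_localForms ha hy, ?_⟩
        dsimp only
        rw [invC_smul, mul_smul, ← smul_sub, ← neg_sub, smul_neg]
        exact neg_mem (pow_smul_mem_localExact ha (X.invC_wedgeD hy))
      · rw [h₂]
        exact ⟨zero_mem _, by simpa using h₁⟩
    | zero => simp
    | add x y _ _ h h' =>
      refine ⟨add_mem h.1 h'.1, ?_⟩
      rw [Prod.fst_add, Prod.snd_add, map_add, add_sub_add_comm]
      exact add_mem h.2 h'.2
    | neg x _ h =>
      refine ⟨neg_mem h.1, ?_⟩
      rw [Prod.fst_neg, Prod.snd_neg, map_neg, ← neg_sub']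
      exact neg_mem h.2
  · rintro ⟨hη, h⟩
    have h1 : (ω - X.invC η, (0 : DiffForms k K)) ∈ cartierGraph p S i :=
      AddSubgroup.subset_closure (Or.inr ⟨h, rfl⟩)
    have h2 : (X.invC η, η) ∈ cartierGraph p S i := by
      clear h h1
      rw [X.localForms_eq] at hη
      induction hη using AddSubgroup.closure_induction with
      | mem η h =>
        obtain ⟨a, ha, l, rfl⟩ := h
        refine AddSubgroup.subset_closure (Or.inl ⟨a * ∏ j, (X.x (l j))⁻¹,
          mul_mem ha (prod_mem fun j _ => X.inv_mem _), fun j => X.x (l j), fun j => X.mem _, ?_⟩)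
        rw [invC_smul, invC_dlogMulti, dlogMulti_eq, smul_smul, smul_smul, mul_pow, mul_assoc,
          ← Finset.prod_pow, ← Finset.prod_mul_distrib]
        congr 3
        refine Finset.prod_congr rfl fun j _ => ?_
        have := X.ne_zero (l j)
        rw [← pow_sub_one_mul hp.out.ne_zero (X.x (l j))⁻¹, mul_right_comm, ← mul_pow,
          inv_mul_cancel₀ this, one_pow, one_mul]
      | zero => rw [map_zero]; exact zero_mem _
      | add _ _ _ _ h h' => rw [map_add]; exact add_mem h h'
      | neg _ _ h => rw [map_neg]; exact neg_mem h
    simpa using add_mem h1 h2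

end LogCoords

end CartierCoordinates

/-! ### Generation of a ring over its p-th powers -/

section FrobeniusGeneration

open TensorProduct

/-- A finite unramified extension `T / S` with `Tᵖ ⊆ S` is trivial. -/
theorem surjective_algebraMap_of_formallyUnramified_of_pow_mem {S T : Type u} [CommRing S]
    [CommRing T] [Algebra S T] (p : ℕ) [Fact p.Prime] [CharP T p] [Module.Finite S T]
    [Algebra.FormallyUnramified S T] (h : ∀ t : T, ∃ s : S, algebraMap S T s = t ^ p) :
    Function.Surjective (algebraMap S T) := by
  have hp : p.Prime := Fact.out
  have hc : CharP (T ⊗[S] T) p ∨ Subsingleton (T ⊗[S] T) := by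
    rcases subsingleton_or_nontrivial (T ⊗[S] T) with h' | h'
    · exact Or.inr h'
    · left
      refine (CharP.charP_iff_prime_eq_zero hp).2 ?_
      rw [← map_natCast (algebraMap T (T ⊗[S] T)), CharP.cast_eq_zero, map_zero]
  -- The kernel of T ⊗ T → T is idempotent because T is unramified, and nilpotent because it is
  -- finitely generated by elements t ⊗ 1 - 1 ⊗ t with p-th power zero. So it vanishes, which makes
  -- S → T an epimorphism, and a finite epimorphism is surjective.
  rw [← Algebra.isEpi_iff_surjective_algebraMap_of_finite, Algebra.isEpi_iff_forall_one_tmul_eq]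
  intro t
  rcases hc with hc | hc
  swap
  · exact Subsingleton.elim _ _
  have hfg : (KaehlerDifferential.ideal S T).FG := KaehlerDifferential.ideal_fg S T
  have hidem : IsIdempotentElem (KaehlerDifferential.ideal S T) :=
    (Ideal.cotangent_subsingleton_iff _).1
      (Algebra.FormallyUnramified.subsingleton_kaehlerDifferential (R := S) (A := T))
  have hnil : KaehlerDifferential.ideal S T ≤ nilradical (T ⊗[S] T) := by
    rw [← KaehlerDifferential.span_range_eq_ideal, Ideal.span_le]
    rintro _ ⟨t, rfl⟩
    refine mem_nilradical.2 ⟨p, ?_⟩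
    obtain ⟨s, hs⟩ := h t
    dsimp only
    rw [sub_pow_char, Algebra.TensorProduct.tmul_pow, Algebra.TensorProduct.tmul_pow, one_pow,
      ← hs, sub_eq_zero, ← Algebra.TensorProduct.algebraMap_apply,
      ← Algebra.TensorProduct.algebraMap_apply']
  obtain ⟨n, hn⟩ := hfg.isNilpotent_iff_le_nilradical.2 hnil
  have hbot : KaehlerDifferential.ideal S T = ⊥ := by
    rcases Nat.eq_zero_or_pos n with h0 | h0
    · rw [h0, pow_zero, Submodule.zero_eq_bot] at hn
      exact le_bot_iff.1 (le_top.trans (Ideal.one_eq_top.symm.le.trans hn.le))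
    · exact (hidem.pow_eq h0.ne').symm.trans hn
  have := KaehlerDifferential.one_smul_sub_smul_one_mem_ideal S t
  rw [hbot, Ideal.mem_bot, sub_eq_zero] at this
  exact this

/-- A ring essentially of finite type over a perfect field is generated over its `p`-th powers by any
functions whose differentials generate the module of differentials. -/
theorem mem_closure_pow_mul_prod_pow {k : Type v} {T : Type u} [Field k] [PerfectField k]
    [CommRing T] [Algebra k T] [Algebra.EssFiniteType k T] (p : ℕ) [Fact p.Prime] [CharP k p]
    [CharP T p] {ι : Type w} [Fintype ι] (x : ι → T)
    (hx : Submodule.span T (Set.range fun l => KaehlerDifferential.D k T (x l)) = ⊤) (a : T) :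
    a ∈ AddSubgroup.closure {b | ∃ c : T, ∃ e : ι → ℕ, b = c ^ p * ∏ l, x l ^ e l} := by
  have hp : p.Prime := Fact.out
  let N : Submonoid T :=
    { carrier := {b | ∃ c : T, ∃ e : ι → ℕ, b = c ^ p * ∏ l, x l ^ e l}
      one_mem' := ⟨1, 0, by simp⟩
      mul_mem' := by
        rintro _ _ ⟨c, e, rfl⟩ ⟨c', e', rfl⟩
        exact ⟨c * c', e + e', by simp [pow_add, Finset.prod_mul_distrib]; ring⟩ }
  -- S contains k, as k is perfect, and all p-th powers, so T is integral over S. The generators dx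
  -- of Ω_{T/k} die in Ω_{T/S}, so T is also unramified over S, and thus S = T once T is known to be
  -- finite over S.
  let S : Subring T := Subring.closure N
  have hS : ∀ b : T, b ∈ S ↔ b ∈ AddSubgroup.closure (N : Set T) := fun b => by
    rw [Subring.mem_closure_iff, Submonoid.closure_eq]
  have hpow : ∀ t : T, t ^ p ∈ S := fun t => Subring.subset_closure ⟨t, 0, by simp⟩
  have hxS : ∀ l, x l ∈ S := fun l => by
    classical
    refine Subring.subset_closure ⟨1, Pi.single l 1, ?_⟩
    rw [one_pow, one_mul, Finset.prod_eq_single l] <;> simp +contextual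
  have hk : ∀ c : k, algebraMap k T c ∈ S := fun c => by
    have : ExpChar k p := ExpChar.prime hp
    obtain ⟨c', rfl⟩ := (PerfectRing.bijective_frobenius (R := k) (p := p)).2 c
    dsimp only
    rw [map_pow]
    exact hpow _
  let _ : Algebra k S := ((algebraMap k T).codRestrict S hk).toAlgebra
  have : IsScalarTower k S T := IsScalarTower.of_algebraMap_eq fun _ => rfl
  have : Algebra.IsIntegral S T := ⟨fun t => by
    refine IsIntegral.of_pow hp.pos ?_
    exact isIntegral_algebraMap (A := T) (x := (⟨t ^ p, hpow t⟩ : S))⟩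
  have : Algebra.FiniteType S T := by
    refine ⟨⟨Algebra.EssFiniteType.finset k T, ?_⟩⟩
    rw [eq_top_iff]
    rintro t -
    have hle : ∀ y : Algebra.EssFiniteType.subalgebra k T, (y : T) ∈
        Algebra.adjoin S (Algebra.EssFiniteType.finset k T : Set T) := fun y => by
      have : Algebra.EssFiniteType.subalgebra k T ≤
          (Algebra.adjoin S (Algebra.EssFiniteType.finset k T : Set T)).restrictScalars k :=
        Algebra.adjoin_le Algebra.subset_adjoin
      exact this y.2
    obtain ⟨y, s, rfl⟩ := IsLocalization.exists_mk'_eq (Algebra.EssFiniteType.submonoid k T) t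
    set t := IsLocalization.mk' T y s
    have hs : IsUnit ((s : Algebra.EssFiniteType.subalgebra k T) : T) := s.2
    obtain ⟨q, hq⟩ := hs
    have ht : t * q = y := by rw [hq]; exact IsLocalization.mk'_spec T y s
    -- Denominators can be turned into p-th powers, whose inverses lie in S; so T is of finite type
    -- over S and not only essentially so.
    have : t = ((⟨((q⁻¹ : Tˣ) : T) ^ p, hpow _⟩ : S) : T) * ((q : T) ^ (p - 1) * y) := by
      have h1 : ((q⁻¹ : Tˣ) : T) ^ p * (q : T) ^ p = 1 := by
        rw [← mul_pow, Units.inv_mul, one_pow]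
      calc t = ((q⁻¹ : Tˣ) : T) ^ p * (q : T) ^ p * t := by rw [h1, one_mul]
        _ = ((q⁻¹ : Tˣ) : T) ^ p * ((q : T) ^ (p - 1) * (t * q)) := by
          rw [← pow_sub_one_mul hp.ne_zero (q : T)]; ring
        _ = _ := by rw [ht]
    rw [this]
    refine mul_mem ?_ (mul_mem (pow_mem ?_ _) (hle y))
    · exact Subalgebra.algebraMap_mem _ (⟨((q⁻¹ : Tˣ) : T) ^ p, hpow _⟩ : S)
    · rw [hq]; exact hle s
  have : Module.Finite S T := Algebra.IsIntegral.finite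
  have : Algebra.FormallyUnramified S T := by
    rw [Algebra.formallyUnramified_iff]
    refine subsingleton_of_forall_eq 0 fun y => ?_
    obtain ⟨y, rfl⟩ := KaehlerDifferential.map_surjective k S T y
    have hy : y ∈ Submodule.span T (Set.range fun l => KaehlerDifferential.D k T (x l)) := by
      rw [hx]; trivial
    induction hy using Submodule.span_induction with
    | mem y hy =>
      obtain ⟨l, rfl⟩ := hy
      dsimp only
      rw [KaehlerDifferential.map_D]
      exact Derivation.map_algebraMap _ (⟨x l, hxS l⟩ : S)
    | zero => simp
    | add y z _ _ hy hz => rw [map_add, hy, hz, add_zero]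
    | smul c y _ hy => rw [map_smul, hy, smul_zero]
  obtain ⟨s, rfl⟩ := surjective_algebraMap_of_formallyUnramified_of_pow_mem (S := S) p
    (fun t => ⟨⟨t ^ p, hpow t⟩, rfl⟩) a
  exact (hS _).1 s.2

end FrobeniusGeneration

/-! ### Coordinates at smooth points -/

section SmoothPoints

variable (k : Type v) {R : Type u} [Field k] [CommRing R] [IsDomain R] [Algebra k R]

theorem mem_localRingAt_iff (P : PrimeSpectrum R) (x : FractionRing R) :
    x ∈ localRingAt k P ↔ ∃ a s : R, s ∉ P.asIdeal ∧
      x = algebraMap R (FractionRing R) a * (algebraMap R (FractionRing R) s)⁻¹ :=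
  ⟨fun ⟨a, s, hs, h⟩ => ⟨a, s, hs, h⟩, fun ⟨a, s, hs, h⟩ => ⟨a, s, hs, h⟩⟩

instance algebraLocalRingAt (P : PrimeSpectrum R) : Algebra R (localRingAt k P) :=
  inferInstanceAs (Algebra R (Localization.subalgebra.ofField (FractionRing R) P.asIdeal.primeCompl
    P.asIdeal.primeCompl_le_nonZeroDivisors))

instance (P : PrimeSpectrum R) : IsScalarTower k R (localRingAt k P) :=
  IsScalarTower.of_algebraMap_eq fun c =>
    Subtype.ext (IsScalarTower.algebraMap_apply k R (FractionRing R) c)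

instance (P : PrimeSpectrum R) : IsLocalization.AtPrime (localRingAt k P) P.asIdeal :=
  inferInstanceAs (IsLocalization P.asIdeal.primeCompl
    (Localization.subalgebra.ofField (FractionRing R) P.asIdeal.primeCompl
    P.asIdeal.primeCompl_le_nonZeroDivisors))

instance (P : PrimeSpectrum R) : IsFractionRing (localRingAt k P) (FractionRing R) :=
  inferInstanceAs (IsFractionRing (Localization.subalgebra.ofField (FractionRing R)
    P.asIdeal.primeCompl P.asIdeal.primeCompl_le_nonZeroDivisors) (FractionRing R))

instance (P : PrimeSpectrum R) : IsLocalRing (localRingAt k P) :=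
  IsLocalization.AtPrime.isLocalRing _ P.asIdeal

instance (P : PrimeSpectrum R) [Algebra.EssFiniteType k R] :
    Algebra.EssFiniteType k (localRingAt k P) :=
  have := Algebra.EssFiniteType.of_isLocalization (localRingAt k P) P.asIdeal.primeCompl
  Algebra.EssFiniteType.comp k R _

variable {k}

theorem formallySmooth_localRingAt {P : PrimeSpectrum R} (hP : P ∈ Algebra.smoothLocus k R) :
    Algebra.FormallySmooth k (localRingAt k P) :=
  have : Algebra.FormallySmooth k (Localization.AtPrime P.asIdeal) := hP
  Algebra.FormallySmooth.of_equiv ((IsLocalization.algEquiv P.asIdeal.primeCompl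
    (Localization.AtPrime P.asIdeal) (localRingAt k P)).restrictScalars k)

/-- In a local ring a or 1 - a is a unit. This makes it possible to choose coordinates that are
units. -/
theorem span_D_units {T : Type u} [CommRing T] [IsLocalRing T] [Algebra k T] :
    Submodule.span T (Set.range fun q : Tˣ => KaehlerDifferential.D k T q) = ⊤ := by
  rw [eq_top_iff, ← KaehlerDifferential.span_range_derivation, Submodule.span_le]
  rintro _ ⟨a, rfl⟩
  rcases IsLocalRing.isUnit_or_isUnit_one_sub_self a with h | h
  · exact Submodule.subset_span ⟨h.unit, rfl⟩
  · have : KaehlerDifferential.D k T a = -KaehlerDifferential.D k T (h.unit : T) := by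
      simp
    rw [this]
    exact Submodule.neg_mem _ (Submodule.subset_span ⟨h.unit, rfl⟩)

/-- Functions whose differentials form a basis of the differentials of the local ring at `P` give
a basis of the rational differentials. -/
def ratBasis {P : PrimeSpectrum R} {ι : Type w}
    (b : Module.Basis ι (localRingAt k P) (Ω[localRingAt k P⁄k])) :
    Module.Basis ι (FractionRing R) (Ω[FractionRing R⁄k]) :=
  b.ofIsLocalizedModule (FractionRing R) (localRingAt k P)⁰
    (KaehlerDifferential.map k k (localRingAt k P) (FractionRing R))

theorem ratBasis_apply {P : PrimeSpectrum R} {ι : Type w}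
    (b : Module.Basis ι (localRingAt k P) (Ω[localRingAt k P⁄k])) (l : ι) :
    ratBasis b l = KaehlerDifferential.map k k (localRingAt k P) (FractionRing R) (b l) :=
  b.ofIsLocalizedModule_apply _ _ _ l

theorem ratBasis_coord_D {P : PrimeSpectrum R} {ι : Type w}
    (b : Module.Basis ι (localRingAt k P) (Ω[localRingAt k P⁄k])) (l : ι) (a : localRingAt k P) :
    (ratBasis b).coord l (KaehlerDifferential.D k (FractionRing R) a) =
      (b.coord l (KaehlerDifferential.D k _ a) : FractionRing R) := by
  have := b.ofIsLocalizedModule_repr_apply (FractionRing R) (localRingAt k P)⁰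
    (KaehlerDifferential.map k k (localRingAt k P) (FractionRing R))
    (KaehlerDifferential.D k _ a) l
  rw [KaehlerDifferential.map_D] at this
  exact this

/-- Units with independent differentials at a smooth point are logarithmic coordinates. -/
def LogCoords.ofBasis {p : ℕ} [Fact p.Prime] [PerfectField k] [CharP k p] [CharP R p]
    [Algebra.EssFiniteType k R] {P : PrimeSpectrum R} {r : ℕ} (x : Fin r → (localRingAt k P)ˣ)
    (b : Module.Basis (Fin r) (localRingAt k P) (Ω[localRingAt k P⁄k]))
    (hb : ∀ l, b l = KaehlerDifferential.D k _ (x l : localRingAt k P)) :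
    LogCoords p (localRingAt k P) r where
  x l := ((x l : localRingAt k P) : FractionRing R)
  ne_zero l h := (x l).ne_zero (Subtype.ext h)
  mem l := (x l : localRingAt k P).2
  inv_mem l := by
    have h : (((x l)⁻¹ : (localRingAt k P)ˣ) : localRingAt k P) * (x l : localRingAt k P) = 1 :=
      (x l).inv_mul
    rw [← eq_inv_of_mul_eq_one_left (congrArg Subtype.val h)]
    exact ((((x l)⁻¹ : (localRingAt k P)ˣ)) : localRingAt k P).2
  basis := ratBasis (b.unitsSMul fun l => (x l)⁻¹)
  basis_eq l := by
    have h : (((x l)⁻¹ : (localRingAt k P)ˣ) : localRingAt k P) * (x l : localRingAt k P) = 1 :=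
      (x l).inv_mul
    rw [ratBasis_apply, Module.Basis.unitsSMul_apply, hb, Units.smul_def, map_smul,
      KaehlerDifferential.map_D, ← eq_inv_of_mul_eq_one_left (congrArg Subtype.val h)]
    rfl
  coord_mem a ha l := by
    rw [ratBasis_coord_D _ _ ⟨a, ha⟩]
    exact Subtype.prop _
  gen a ha := by
    have : CharP (localRingAt k P) p := 
      charP_of_injective_algebraMap (algebraMap k (localRingAt k P)).injective p
    have hx : Submodule.span (localRingAt k P)
        (Set.range fun l => KaehlerDifferential.D k _ (x l : localRingAt k P)) = ⊤ := by
      rw [← b.span_eq]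
      congr 2
      funext l
      exact (hb l).symm
    have := mem_closure_pow_mul_prod_pow p (fun l => (x l : localRingAt k P)) hx ⟨a, ha⟩
    have h2 := AddSubgroup.mem_map_of_mem
      (algebraMap (localRingAt k P) (FractionRing R)).toAddMonoidHom this
    rw [AddMonoidHom.map_closure] at h2
    refine AddSubgroup.closure_mono ?_ h2
    rintro _ ⟨_, ⟨c, e, rfl⟩, rfl⟩
    refine ⟨c, c.2, e, ?_⟩
    simp only [RingHom.toAddMonoidHom_eq_coe, AddMonoidHom.coe_coe, map_mul, map_pow, map_prod]
    rfl

/-- At a smooth point Ω is finitely presented and projective, and over a local ring a generating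
family of such a module contains a basis. -/
theorem exists_basis_D_of_span {P : PrimeSpectrum R} (hP : P ∈ Algebra.smoothLocus k R)
    [Algebra.EssFiniteType k R] {ι : Type u} (v : ι → localRingAt k P)
    (hv : Submodule.span (localRingAt k P) (Set.range fun l => KaehlerDifferential.D k _ (v l)) = ⊤) :
    ∃ (r : ℕ) (x : Fin r → ι) (b : Module.Basis (Fin r) (localRingAt k P) (Ω[localRingAt k P⁄k])),
      ∀ l, b l = KaehlerDifferential.D k _ (v (x l)) := by
  have := formallySmooth_localRingAt hP
  have : Module.FinitePresentation (localRingAt k P) (Ω[localRingAt k P⁄k]) := inferInstance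
  have : Module.Projective (localRingAt k P) (Ω[localRingAt k P⁄k]) := inferInstance
  have : Module.Flat (localRingAt k P) (Ω[localRingAt k P⁄k]) := Module.Flat.of_projective
  obtain ⟨κ, x, b, hb⟩ := Module.exists_basis_of_span_of_flat _ hv
  have := Module.Finite.finite_basis b
  have := Fintype.ofFinite κ
  let e := Fintype.equivFin κ
  exact ⟨_, x ∘ e.symm, b.reindex e, fun l => by simp [hb]⟩

theorem exists_logCoords (p : ℕ) [Fact p.Prime] [PerfectField k] [CharP k p] [CharP R p]
    [Algebra.EssFiniteType k R] {P : PrimeSpectrum R} (hP : P ∈ Algebra.smoothLocus k R) :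
    ∃ r, Nonempty (LogCoords p (localRingAt k P) r) := by
  obtain ⟨r, x, b, hb⟩ := exists_basis_D_of_span hP _
    (span_D_units (k := k) (T := localRingAt k P))
  exact ⟨r, ⟨LogCoords.ofBasis x b hb⟩⟩

end SmoothPoints

/-! ### Normal varieties are smooth in codimension one -/

section CodimensionOne

open Algebra IsLocalRing
open scoped TensorProduct

/-- The fibre is the residue field of T. -/
theorem isField_tensor_of_map_maximalIdeal {A T : Type*} [CommRing A] [CommRing T] [IsLocalRing A]
    [IsLocalRing T] [Algebra A T]
    (h : (maximalIdeal A).map (algebraMap A T) = maximalIdeal T) :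
    IsField (ResidueField A ⊗[A] T) := by
  let e : (T ⧸ (maximalIdeal A).map (algebraMap A T)) ≃ₐ[T] T ⊗[A] (A ⧸ maximalIdeal A) :=
    Algebra.TensorProduct.quotIdealMapEquivTensorQuot T (maximalIdeal A)
  have h1 : IsField (T ⧸ (maximalIdeal A).map (algebraMap A T)) := by
    rw [h]
    exact (Ideal.Quotient.maximal_ideal_iff_isField_quotient _).1 inferInstance
  have h2 : IsField (T ⊗[A] (A ⧸ maximalIdeal A)) := e.symm.toMulEquiv.isField h1
  exact (Algebra.TensorProduct.comm A (A ⧸ maximalIdeal A) T).toMulEquiv.isField h2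

/-- A flat finitely presented algebra is smooth at a prime that is generated, locally, by a prime with
perfect residue field. -/
theorem isSmoothAt_of_map_maximalIdeal {A B : Type*} [CommRing A] [CommRing B] [Algebra A B]
    [Module.Flat A B] [Algebra.FinitePresentation A B] (p : Ideal A) (q : Ideal B) [p.IsPrime]
    [q.IsPrime] [q.LiesOver p] [PerfectField p.ResidueField]
    (h : ∀ x ∈ q, ∃ s ∉ q, s * x ∈ p.map (algebraMap A B)) : Algebra.IsSmoothAt A q := by
  let Rp := Localization.AtPrime p
  let Sp := Localization (algebraMapSubmonoid B p.primeCompl)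
  let Sq := Localization.AtPrime q
  let := Localization.AtPrime.algebraOfLiesOver p q
  let f : Sp →ₐ[B] Sq := IsLocalization.liftAlgHom (M := algebraMapSubmonoid B p.primeCompl)
        (f := Algebra.ofId _ _) (by
      rintro ⟨_, x, hx, rfl⟩
      simpa using! IsLocalization.map_units (M := q.primeCompl) Sq ⟨algebraMap _ _ x,
        by simp_all [q.over_def p]⟩)
  algebraize [f.toRingHom]
  have : IsScalarTower A Sp Sq := .to₁₃₄ _ B _ _
  have : IsScalarTower Rp Sp Sq := .of_algebraMap_eq' <| by
    apply IsLocalization.ringHom_ext p.primeCompl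
    simp only [RingHom.comp_assoc, ← IsScalarTower.algebraMap_eq]
  have : IsLocalization (algebraMapSubmonoid Sp q.primeCompl) Sq :=
    .isLocalization_of_submonoid_le _ _ (algebraMapSubmonoid B p.primeCompl) _
    (by rintro _ ⟨x, hx, rfl⟩; simp_all [q.over_def p])
  have : FinitePresentation Rp Sp := by
    have : Algebra.IsPushout A Rp B Sp :=
      .symm <| Algebra.isPushout_of_isLocalization p.primeCompl _ _ _
    exact .equiv (Algebra.IsPushout.equiv A Rp B Sp)
  have hmap : (maximalIdeal Rp).map (algebraMap Rp Sq) = maximalIdeal Sq := by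
    rw [← Localization.AtPrime.map_eq_maximalIdeal, Ideal.map_map, ← IsScalarTower.algebraMap_eq,
      IsScalarTower.algebraMap_eq A B Sq, ← Ideal.map_map]
    refine le_antisymm ?_ ?_
    · rw [← Localization.AtPrime.map_eq_maximalIdeal]
      refine Ideal.map_mono ?_
      rw [Ideal.map_le_iff_le_comap, q.over_def p]
    · rw [← Localization.AtPrime.map_eq_maximalIdeal, Ideal.map_le_iff_le_comap]
      intro x hx
      obtain ⟨s, hs, hsx⟩ := h x hx
      have hu : IsUnit (algebraMap B Sq s) := IsLocalization.map_units (M := q.primeCompl) Sq ⟨s, hs⟩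
      rw [Ideal.mem_comap, ← Ideal.unit_mul_mem_iff_mem _ hu, ← map_mul]
      exact Ideal.mem_map_of_mem _ hsx
  -- The local fibre is a field essentially of finite type over a perfect field, hence formally
  -- smooth; flatness lifts this to the total space.
  have : FormallySmooth (ResidueField Rp) (ResidueField Rp ⊗[Rp] Sq) := by
    have : EssFiniteType Sp Sq := .of_isLocalization _ (algebraMapSubmonoid Sp q.primeCompl)
    have : EssFiniteType Rp Sq := .comp Rp Sp Sq
    have : EssFiniteType (ResidueField Rp) (ResidueField Rp ⊗[Rp] Sq) := inferInstance
    let := (isField_tensor_of_map_maximalIdeal hmap).toField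
    have : PerfectField (ResidueField Rp) := inferInstanceAs (PerfectField p.ResidueField)
    exact Algebra.FormallySmooth.of_perfectField
  have := FormallySmooth.of_formallySmooth_residueField_tensor
    (R := Rp) (S := Sq) (P := Sp) (algebraMapSubmonoid _ q.primeCompl)
  exact .comp A Rp Sq

end CodimensionOne

section SmoothLocus

variable {k : Type v} {R : Type u} [Field k] [PerfectField k] [CommRing R] [IsDomain R]
  [Algebra k R] [Algebra.FiniteType k R]

open Polynomial in
-- Through t, R is a torsion-free and hence flat algebra over k[X]. As t generates Q locally, the
-- local fibre over X = 0 is a field, so R is smooth over k[X] at Q and therefore over k.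
theorem mem_smoothLocus_of_locally_principal {Q : PrimeSpectrum R} {t : R} (ht : t ∈ Q.asIdeal)
    (ht0 : t ≠ 0) (h : ∀ q ∈ Q.asIdeal, ∃ s ∉ Q.asIdeal, t ∣ s * q) :
    Q ∈ Algebra.smoothLocus k R := by
  let _ : Algebra k[X] R := (aeval t).toAlgebra
  have hX : algebraMap k[X] R X = t := aeval_X t
  have : IsScalarTower k k[X] R := IsScalarTower.of_algebraMap_eq' (aeval t).comp_algebraMap.symm
  let 𝔭 : Ideal k[X] := Ideal.span {X}
  have hmax : 𝔭.IsMaximal := PrincipalIdealRing.isMaximal_of_irreducible irreducible_X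
  have hprime : 𝔭.IsPrime := hmax.isPrime
  have hover : Q.asIdeal.LiesOver 𝔭 := ⟨by
    refine hmax.eq_of_le (Ideal.IsPrime.under k[X] Q.asIdeal).ne_top ?_
    rw [Ideal.span_le, Set.singleton_subset_iff]
    exact show algebraMap k[X] R X ∈ Q.asIdeal by rwa [hX]⟩
  have hker : Function.Injective (algebraMap k[X] R) := by
    rw [injective_iff_map_eq_zero]
    intro f hf
    by_contra hf0
    obtain ⟨g, hg, hg'⟩ := exists_eq_pow_rootMultiplicity_mul_and_not_dvd f hf0 0
    rw [map_zero, sub_zero] at hg hg'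
    rw [hg, map_mul, map_pow, hX, mul_eq_zero] at hf
    rcases hf with hf | hf
    · exact ht0 (eq_zero_of_pow_eq_zero hf)
    · have : g ∈ 𝔭 := by
        rw [hover.over, Ideal.mem_comap, hf]
        exact zero_mem _
      exact hg' (Ideal.mem_span_singleton.1 this)
  have : FaithfulSMul k[X] R := (faithfulSMul_iff_algebraMap_injective _ _).2 hker
  have : Module.Flat k[X] R := by
    rw [Module.Flat.flat_iff_torsion_eq_bot_of_isBezout, ← Submodule.isTorsionFree_iff_torsion_eq_bot]
    infer_instance
  have : Algebra.FinitePresentation k[X] R := by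
    have := Algebra.FiniteType.of_restrictScalars_finiteType k k[X] R
    exact Algebra.FinitePresentation.of_finiteType.1 this
  have : PerfectField 𝔭.ResidueField := by
    have : Algebra.IsAlgebraic k 𝔭.ResidueField := ⟨fun y => by
      obtain ⟨y, rfl⟩ := (Ideal.bijective_algebraMap_quotient_residueField 𝔭).2 y
      obtain ⟨f, rfl⟩ := Ideal.Quotient.mk_surjective y
      have : Ideal.Quotient.mk 𝔭 f = Ideal.Quotient.mk 𝔭 (algebraMap k k[X] (f.coeff 0)) := by
        rw [Ideal.Quotient.eq, Ideal.mem_span_singleton, X_dvd_iff]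
        simp
      rw [this, ← Ideal.Quotient.algebraMap_eq, ← IsScalarTower.algebraMap_apply,
        ← IsScalarTower.algebraMap_apply]
      exact isAlgebraic_algebraMap _⟩
    exact Algebra.IsAlgebraic.perfectField (K := k)
  have h2 : Algebra.IsSmoothAt k[X] Q.asIdeal := by
    refine isSmoothAt_of_map_maximalIdeal 𝔭 Q.asIdeal fun x hx => ?_
    obtain ⟨s, hs, hsx⟩ := h x hx
    refine ⟨s, hs, ?_⟩
    rwa [Ideal.map_span, Set.image_singleton, hX, Ideal.mem_span_singleton]
  exact Algebra.FormallySmooth.comp k k[X] _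

/-- Q is the conductor of y. If y Q ⊆ Q, then y is integral over R, so y ∈ R by normality and Q is
not proper. Otherwise some t ∈ Q has s = t y ∉ Q, and s q = t (q y) shows that t generates Q
locally. -/
theorem exists_locally_principal_of_conductor [IsNoetherianRing R] [IsIntegrallyClosed R]
    {Q : Ideal R} [Q.IsPrime] {y : FractionRing R}
    (hQ : ∀ r : R, r ∈ Q ↔ r • y ∈ (1 : Submodule R (FractionRing R))) :
    ∃ t ∈ Q, t ≠ 0 ∧ ∀ q ∈ Q, ∃ s ∉ Q, t ∣ s * q := by
  have hQy : ∀ q ∈ Q, ∃ a : R, algebraMap R (FractionRing R) a = q • y := fun q hq =>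
    Submodule.mem_one.1 ((hQ q).1 hq)
  by_cases H : ∀ t ∈ Q, ∀ s, algebraMap R (FractionRing R) s = t • y → s ∈ Q
  · exfalso
    have hy0 : Q ≠ ⊥ := by
      rintro rfl
      obtain ⟨a, b, hb, rfl⟩ := IsFractionRing.div_surjective R y
      refine nonZeroDivisors.ne_zero hb ((Submodule.mem_bot R).1 ((hQ b).2 ?_))
      rw [Algebra.smul_def, mul_div_cancel₀ _
        (IsFractionRing.to_map_ne_zero_of_mem_nonZeroDivisors hb)]
      exact Submodule.algebraMap_mem a
    have hint : IsIntegral R y := by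
      refine isIntegral_of_smul_mem_submodule (M := FractionRing R)
        (Submodule.map (Algebra.linearMap R (FractionRing R)) Q) ?_
        ((IsNoetherian.noetherian Q).map _) y ?_
      · rw [Ne, ← Submodule.map_bot (Algebra.linearMap R (FractionRing R)),
          (Submodule.map_injective_of_injective
            (IsFractionRing.injective R (FractionRing R))).eq_iff]
        exact hy0
      · rintro _ ⟨q, hq, rfl⟩
        obtain ⟨a, ha⟩ := hQy q hq
        refine ⟨a, H q hq a ha, ?_⟩
        rw [Algebra.linearMap_apply, ha, Algebra.smul_def, Algebra.linearMap_apply, smul_eq_mul,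
          mul_comm]
    obtain ⟨a, ha⟩ := IsIntegrallyClosed.isIntegral_iff.1 hint
    refine (Ideal.ne_top_iff_one Q).1 (Ideal.IsPrime.ne_top ‹_›) ((hQ 1).2 ?_)
    rw [one_smul]
    exact Submodule.mem_one.2 ⟨a, ha⟩
  · push Not at H
    obtain ⟨t, ht, s, hs, hsQ⟩ := H
    refine ⟨t, ht, ?_, fun q hq => ⟨s, hsQ, ?_⟩⟩
    · rintro rfl
      rw [zero_smul, map_eq_zero_iff _ (IsFractionRing.injective R (FractionRing R))] at hs
      exact hsQ (hs ▸ zero_mem Q)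
    · obtain ⟨a, ha⟩ := hQy q hq
      refine ⟨a, IsFractionRing.injective R (FractionRing R) ?_⟩
      rw [map_mul, map_mul, ha, hs, Algebra.smul_def, Algebra.smul_def]
      ring

/-- A normal variety is smooth in codimension one, so functions that are regular on the smooth locus
are regular. -/
theorem mem_range_of_mem_localRingAt [IsIntegrallyClosed R] {x : FractionRing R}
    (hx : ∀ P ∈ Algebra.smoothLocus k R, x ∈ localRingAt k P) :
    ∃ a : R, algebraMap R (FractionRing R) a = x := by
  have : IsNoetherianRing R := Algebra.FiniteType.isNoetherianRing k R
  by_contra H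
  have hx0 : Submodule.Quotient.mk (p := (1 : Submodule R (FractionRing R))) x ≠ 0 := fun h =>
    H (Submodule.mem_one.1 ((Submodule.Quotient.mk_eq_zero _).1 h))
  -- An associated prime Q of the submodule of K/R generated by x is the conductor of some multiple
  -- c x. By normality it is locally principal, hence smooth; but a denominator s ∉ Q of x then
  -- satisfies s c x ∈ R, a contradiction.
  let M := Submodule.span R {Submodule.Quotient.mk (p := (1 : Submodule R (FractionRing R))) x}
  have : Nontrivial M := Submodule.nontrivial_iff_ne_bot.2 (by simpa [M] using hx0)
  obtain ⟨Q, hQ⟩ := associatedPrimes.nonempty R M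
  obtain ⟨hQp, ⟨z, hz⟩, hzQ⟩ := isAssociatedPrime_iff.1 hQ
  obtain ⟨c, rfl⟩ := Submodule.mem_span_singleton.1 hz
  have hcQ : ∀ r : R, r ∈ Q ↔ r • c • x ∈ (1 : Submodule R (FractionRing R)) := fun r => by
    rw [hzQ, Submodule.mem_colon_singleton, Submodule.mem_bot, ← Submodule.Quotient.mk_eq_zero,
      Submodule.Quotient.mk_smul, Submodule.Quotient.mk_smul, Subtype.ext_iff]
    rfl
  obtain ⟨t, ht, ht0, h⟩ := exists_locally_principal_of_conductor hcQ
  obtain ⟨a, s, hs, rfl⟩ := (mem_localRingAt_iff k _ _).1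
    (hx ⟨Q, hQp⟩ (mem_smoothLocus_of_locally_principal ht ht0 h))
  refine hs ((hcQ s).2 ?_)
  have hs0 : algebraMap R (FractionRing R) s ≠ 0 := fun h0 => hs (by
    rw [map_eq_zero_iff _ (IsFractionRing.injective R (FractionRing R))] at h0
    rw [h0]
    exact zero_mem _)
  refine Submodule.mem_one.2 ⟨c * a, ?_⟩
  rw [Algebra.smul_def, Algebra.smul_def, map_mul]
  field_simp

variable (k R) in
theorem bot_mem_smoothLocus : (⊥ : PrimeSpectrum R) ∈ Algebra.smoothLocus k R := by
  have : IsLocalization.AtPrime (FractionRing R) (⊥ : PrimeSpectrum R).asIdeal := by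
    have h : (⊥ : PrimeSpectrum R).asIdeal.primeCompl = R⁰ := by
      ext x
      rw [mem_nonZeroDivisors_iff_ne_zero]
      exact Iff.rfl
    unfold IsLocalization.AtPrime
    rw [h]
    infer_instance
  have : Algebra.EssFiniteType R (FractionRing R) := .of_isLocalization _ R⁰
  have : Algebra.EssFiniteType k (FractionRing R) := .comp k R _
  have : Algebra.FormallySmooth k (FractionRing R) := Algebra.FormallySmooth.of_perfectField
  exact Algebra.FormallySmooth.of_equiv ((IsLocalization.algEquiv
    (⊥ : PrimeSpectrum R).asIdeal.primeCompl (FractionRing R)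
    (Localization.AtPrime (⊥ : PrimeSpectrum R).asIdeal)).restrictScalars k)

variable (k R) in
/-- The singular locus is contained in a hypersurface. -/
theorem exists_ne_zero_forall_mem : ∃ f : R, f ≠ 0 ∧
    ∀ P : PrimeSpectrum R, f ∉ P.asIdeal → P ∈ Algebra.smoothLocus k R := by
  have : Algebra.FinitePresentation k R := Algebra.FinitePresentation.of_finiteType.1 inferInstance
  obtain ⟨_, ⟨f, rfl⟩, hf, hsub⟩ := PrimeSpectrum.isTopologicalBasis_basic_opens.exists_subset_of_mem_open
    (bot_mem_smoothLocus k R) Algebra.isOpen_smoothLocus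
  exact ⟨f, fun h => hf (h ▸ zero_mem _), fun P hP => hsub hP⟩

end SmoothLocus

/-! ### Iterated Cartier operators at a smooth point -/

section Monotonicity

variable {k : Type v} {K : Type u} [CommRing k] [Field K] [Algebra k K] {p : ℕ}
  {S T : Subalgebra k K} {i : ℕ}

theorem localForms_mono (h : S ≤ T) : localForms S i ≤ localForms T i :=
  AddSubgroup.closure_mono fun _ ⟨a, ha, x, hx, e⟩ => ⟨a, h ha, x, fun j => h (hx j), e⟩

theorem localExact_mono (h : S ≤ T) : localExact S i ≤ localExact T i := by
  cases i with
  | zero => exact le_rfl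
  | succ i => exact AddSubgroup.map_mono (localForms_mono h)

theorem cartierGraph_mono (h : S ≤ T) : cartierGraph p S i ≤ cartierGraph p T i := by
  refine AddSubgroup.closure_mono (Set.union_subset_union ?_ ?_)
  · exact fun _ ⟨a, ha, x, hx, e⟩ => ⟨a, h ha, x, fun j => h (hx j), e⟩
  · exact fun z hz => ⟨localExact_mono h hz.1, hz.2⟩

theorem cartierGraphIter_mono (h : S ≤ T) (n : ℕ) :
    cartierGraphIter p S i n ≤ cartierGraphIter p T i n := by
  induction n with
  | zero => exact AddSubgroup.map_mono (localForms_mono h)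
  | succ n ih => exact fun _ ⟨θ, h₁, h₂⟩ => ⟨θ, cartierGraph_mono h h₁, ih h₂⟩

theorem mem_cartierGraphIter_zero {ω η : DiffForms k K} :
    (ω, η) ∈ cartierGraphIter p S i 0 ↔ ω ∈ localForms S i ∧ η = ω := by
  constructor
  · rintro ⟨θ, hθ, h⟩
    obtain ⟨rfl, rfl⟩ := Prod.ext_iff.1 h
    exact ⟨hθ, rfl⟩
  · rintro ⟨h, rfl⟩
    exact ⟨η, h, rfl⟩

theorem mem_cartierGraphIter_succ {n : ℕ} {ω η : DiffForms k K} :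
    (ω, η) ∈ cartierGraphIter p S i (n + 1) ↔
      ∃ θ, (ω, θ) ∈ cartierGraph p S i ∧ (θ, η) ∈ cartierGraphIter p S i n :=
  Iff.rfl

end Monotonicity

namespace LogCoords

variable {k : Type v} {K : Type u} [CommRing k] [Field K] [Algebra k K]
variable {p : ℕ} [hp : Fact p.Prime] [CharP K p] {S : Subalgebra k K} {r : ℕ}
  {i : ℕ}

theorem exists_mem_cartierGraph (X : LogCoords p S r) {ω : DiffForms k K} (hω : ω ∈ localForms S i)
    (h : extD k ω = 0) : ∃ η, (ω, η) ∈ cartierGraph p S i := by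
  obtain ⟨η, hη, h⟩ := X.exists_sub_invC_mem_localExact hω h
  exact ⟨η, X.mem_cartierGraph_iff.2 ⟨hη, h⟩⟩

theorem mem_localForms_of_mem_cartierGraph (X : LogCoords p S r) {ω η : DiffForms k K}
    (h : (ω, η) ∈ cartierGraph p S i) : ω ∈ localForms S i ∧ extD k ω = 0 ∧ η ∈ localForms S i := by
  obtain ⟨hη, h⟩ := X.mem_cartierGraph_iff.1 h
  have e : ω = (ω - X.invC η) + X.invC η := (sub_add_cancel _ _).symm
  refine ⟨?_, ?_, hη⟩
  · rw [e]
    exact add_mem (localExact_le_localForms h) (X.invC_mem_localForms hη)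
  · rw [e, map_add, extD_eq_zero_of_mem_localExact h, X.extD_invC hη, add_zero]

theorem mem_cartierGraph_zero_iff (X : LogCoords p S r) {ω : DiffForms k K} :
    (ω, 0) ∈ cartierGraph p S i ↔ ω ∈ localExact S i := by
  rw [X.mem_cartierGraph_iff, map_zero, sub_zero]
  exact and_iff_right (zero_mem _)

theorem eq_zero_of_mem_cartierGraph (X : LogCoords p S r) {η : DiffForms k K} (h : (0, η) ∈ cartierGraph p S i) :
    η = 0 := by
  obtain ⟨hη, h⟩ := X.mem_cartierGraph_iff.1 h
  rw [zero_sub] at h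
  exact X.eq_zero_of_invC_mem_localExact hη (by simpa using neg_mem h)

theorem mem_localForms_of_mem_cartierGraphIter (X : LogCoords p S r) {n : ℕ} {ω η : DiffForms k K}
    (h : (ω, η) ∈ cartierGraphIter p S i n) : ω ∈ localForms S i ∧ η ∈ localForms S i := by
  induction n generalizing ω with
  | zero =>
    obtain ⟨h, rfl⟩ := mem_cartierGraphIter_zero.1 h
    exact ⟨h, h⟩
  | succ n ih =>
    obtain ⟨θ, h₁, h₂⟩ := h
    exact ⟨(X.mem_localForms_of_mem_cartierGraph h₁).1, (ih h₂).2⟩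

theorem eq_zero_of_mem_cartierGraphIter (X : LogCoords p S r) {n : ℕ} {η : DiffForms k K}
    (h : (0, η) ∈ cartierGraphIter p S i n) : η = 0 := by
  induction n with
  | zero => exact (mem_cartierGraphIter_zero.1 h).2
  | succ n ih =>
    obtain ⟨θ, h₁, h₂⟩ := mem_cartierGraphIter_succ.1 h
    obtain rfl := X.eq_zero_of_mem_cartierGraph h₁
    exact ih h₂

theorem eq_of_mem_cartierGraphIter (X : LogCoords p S r) {n : ℕ} {ω η η' : DiffForms k K}
    (h : (ω, η) ∈ cartierGraphIter p S i n) (h' : (ω, η') ∈ cartierGraphIter p S i n) :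
    η = η' := by
  have := sub_mem h h'
  rw [Prod.mk_sub_mk, sub_self] at this
  exact sub_eq_zero.1 (X.eq_zero_of_mem_cartierGraphIter this)

/-- Associativity of composition. Boundaries are defined by splitting off the first Cartier
operator, cycles by a condition on the target of C_n, for which the last one must be split off. -/
theorem mem_cartierGraphIter_succ' (X : LogCoords p S r) {n : ℕ} {ω η : DiffForms k K} :
    (ω, η) ∈ cartierGraphIter p S i (n + 1) ↔
      ∃ θ, (ω, θ) ∈ cartierGraphIter p S i n ∧ (θ, η) ∈ cartierGraph p S i := by
  induction n generalizing ω with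
  | zero =>
    rw [mem_cartierGraphIter_succ]
    constructor
    · rintro ⟨θ, h₁, h₂⟩
      obtain ⟨-, rfl⟩ := mem_cartierGraphIter_zero.1 h₂
      exact ⟨ω, mem_cartierGraphIter_zero.2 ⟨(X.mem_localForms_of_mem_cartierGraph h₁).1, rfl⟩, h₁⟩
    · rintro ⟨θ, h₁, h₂⟩
      obtain ⟨-, rfl⟩ := mem_cartierGraphIter_zero.1 h₁
      exact ⟨η, h₂,
        mem_cartierGraphIter_zero.2 ⟨(X.mem_localForms_of_mem_cartierGraph h₂).2.2, rfl⟩⟩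
  | succ n ih =>
    rw [mem_cartierGraphIter_succ]
    constructor
    · rintro ⟨θ, h₁, h₂⟩
      obtain ⟨θ', h₃, h₄⟩ := ih.1 h₂
      exact ⟨θ', ⟨θ, h₁, h₃⟩, h₄⟩
    · rintro ⟨θ, ⟨θ', h₁, h₂⟩, h₃⟩
      exact ⟨θ', h₁, ih.2 ⟨θ, h₂, h₃⟩⟩

theorem mem_localCycles_iff (X : LogCoords p S r) {n : ℕ} {ω : DiffForms k K} :
    ω ∈ localCycles p S i n ↔ ∃ η, (ω, η) ∈ cartierGraphIter p S i n := by
  induction n with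
  | zero => exact ⟨fun h => ⟨ω, mem_cartierGraphIter_zero.2 ⟨h, rfl⟩⟩,
      fun ⟨_, h⟩ => (mem_cartierGraphIter_zero.1 h).1⟩
  | succ n ih =>
    constructor
    · rintro ⟨-, θ, hθ, h⟩
      obtain ⟨η, hη⟩ := X.exists_mem_cartierGraph (X.mem_localForms_of_mem_cartierGraphIter h).2 hθ
      exact ⟨η, X.mem_cartierGraphIter_succ'.2 ⟨θ, h, hη⟩⟩
    · rintro ⟨η, h⟩
      obtain ⟨θ, h₁, h₂⟩ := X.mem_cartierGraphIter_succ'.1 h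
      exact ⟨ih.2 ⟨θ, h₁⟩, θ, (X.mem_localForms_of_mem_cartierGraph h₂).2.1, h₁⟩

theorem mem_localBoundaries_iff (X : LogCoords p S r) {n : ℕ} {ω : DiffForms k K} :
    ω ∈ localBoundaries p S i n ↔ (ω, 0) ∈ cartierGraphIter p S i n := by
  induction n using Nat.twoStepInduction generalizing ω with
  | zero =>
    rw [mem_cartierGraphIter_zero, localBoundaries, AddSubgroup.mem_bot]
    exact ⟨fun h => ⟨h ▸ zero_mem _, h.symm⟩, fun h => h.2.symm⟩
  | one =>
    rw [localBoundaries, ← X.mem_cartierGraph_zero_iff, mem_cartierGraphIter_succ]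
    constructor
    · exact fun h => ⟨0, h, zero_mem _⟩
    · rintro ⟨θ, h₁, h₂⟩
      obtain ⟨-, rfl⟩ := mem_cartierGraphIter_zero.1 h₂
      exact h₁
  | more n _ ih =>
    constructor
    · rintro ⟨θ, h, h₁⟩
      exact ⟨θ, h₁, ih.1 h⟩
    · rintro ⟨θ, h₁, h⟩
      exact ⟨θ, ih.2 h, h₁⟩

end LogCoords

/-! ### Cartier operators on reflexive forms -/

section GlobalCartier

theorem localRingAt_le_bot {k : Type v} {R : Type u} [Field k] [CommRing R] [IsDomain R]
    [Algebra k R] (P : PrimeSpectrum R) : localRingAt k P ≤ localRingAt k ⊥ := by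
  intro x hx
  obtain ⟨a, s, hs, rfl⟩ := (mem_localRingAt_iff k P x).1 hx
  exact (mem_localRingAt_iff k _ _).2 ⟨a, s, fun h => hs ((Submodule.mem_bot R).1 h ▸ zero_mem _), rfl⟩

theorem exists_graph_eq {A M N : Type*} [CommRing A] [AddCommGroup M] [Module A M] [AddCommGroup N]
    [Module A N] (G : Submodule A (M × N)) (h : ∀ x, ∃ y, (x, y) ∈ G)
    (h' : ∀ y, ((0 : M), y) ∈ G → y = 0) : ∃ f : M →ₗ[A] N, f.graph = G := by
  choose f hf using h
  have huniq : ∀ {x y y'}, (x, y) ∈ G → (x, y') ∈ G → y = y' := fun {x y y'} h₁ h₂ => by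
    have := G.sub_mem h₁ h₂
    rw [Prod.mk_sub_mk, sub_self] at this
    exact sub_eq_zero.1 (h' _ this)
  refine ⟨{ toFun := f, map_add' := fun x y => huniq (hf _) (G.add_mem (hf x) (hf y)),
            map_smul' := fun a x => huniq (hf _) (G.smul_mem a (hf x)) }, ?_⟩
  ext ⟨x, y⟩
  rw [LinearMap.mem_graph_iff]
  constructor
  · intro h
    rw [show y = f x from h]
    exact hf x
  · exact fun h => huniq h (hf x)

variable {k : Type v} {R : Type u} [Field k] [PerfectField k] [CommRing R] [IsDomain R]
  [Algebra k R] [Algebra.FiniteType k R] {p : ℕ} [Fact p.Prime] [CharP k p] [CharP R p]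

/-- By Cartier's theorem there is a value at each smooth point. These values agree, since every
local graph is contained in the graph at the generic point, which is single-valued. -/
theorem graph_cartier (n i : ℕ) : (cartier k R p n i).graph = reflCartierGraph k R p n i := by
  have : CharP (FractionRing R) p := IsFractionRing.charP_of_isFractionRing R p
  obtain ⟨r₀, ⟨X₀⟩⟩ := exists_logCoords p (bot_mem_smoothLocus k R)
  refine graph_linearMapOfGraph (exists_graph_eq _ (fun ω => ?_) fun η h => ?_)
  · have h : ∀ P ∈ Algebra.smoothLocus k R,
        ∃ η, (ω.1.form, η) ∈ cartierGraphIter p (localRingAt k P) i n := fun P hP => by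
      obtain ⟨r, ⟨X⟩⟩ := exists_logCoords p hP
      exact X.mem_localCycles_iff.1 (ω.2 P hP)
    obtain ⟨η, hη⟩ := h ⊥ (bot_mem_smoothLocus k R)
    have h' : ∀ P ∈ Algebra.smoothLocus k R,
        (ω.1.form, η) ∈ cartierGraphIter p (localRingAt k P) i n := fun P hP => by
      obtain ⟨η', hη'⟩ := h P hP
      rwa [X₀.eq_of_mem_cartierGraphIter hη (cartierGraphIter_mono (localRingAt_le_bot P) n hη')]
    refine ⟨⟨η, fun P hP => ?_⟩, h'⟩
    obtain ⟨r, ⟨X⟩⟩ := exists_logCoords p hP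
    exact (X.mem_localForms_of_mem_cartierGraphIter (h' P hP)).2
  · exact Subtype.ext (X₀.eq_zero_of_mem_cartierGraphIter (h ⊥ (bot_mem_smoothLocus k R)))

theorem cartier_eq_iff {n i : ℕ} {ω : reflCycles k R p n i} {η : reflForms k R i} :
    cartier k R p n i ω = η ↔ ∀ P ∈ Algebra.smoothLocus k R,
      (ω.1.form, η.1) ∈ cartierGraphIter p (localRingAt k P) i n := by
  rw [eq_comm, ← LinearMap.mem_graph_iff (f := cartier k R p n i) (x := (ω, η)), graph_cartier]
  exact Iff.rfl

theorem mem_reflCycles_of_forall {n i : ℕ} {ω : PushForms k R p n i} {η : DiffForms k (FractionRing R)}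
    (h : ∀ P ∈ Algebra.smoothLocus k R, (ω.form, η) ∈ cartierGraphIter p (localRingAt k P) i n) :
    ω ∈ reflCycles k R p n i := fun P hP => by
  have : CharP (FractionRing R) p := IsFractionRing.charP_of_isFractionRing R p
  obtain ⟨r, ⟨X⟩⟩ := exists_logCoords p hP
  exact X.mem_localCycles_iff.2 ⟨η, h P hP⟩

/-- As C_{n+1} = C_n ∘ C, a preimage under C_n is regarded as a plain form and lifted once more
under C. -/
theorem cartier_surjective {i : ℕ} (h : Function.Surjective (cartier k R p 1 i)) (n : ℕ) :
    Function.Surjective (cartier k R p n i) := by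
  have : CharP (FractionRing R) p := IsFractionRing.charP_of_isFractionRing R p
  induction n with
  | zero =>
    intro η
    have h0 : ∀ P ∈ Algebra.smoothLocus k R, (PushForms.form (p := p) (n := 0) η, η.1) ∈
        cartierGraphIter p (localRingAt k P) i 0 :=
      fun P hP => mem_cartierGraphIter_zero.2 ⟨η.2 P hP, rfl⟩
    exact ⟨⟨η, mem_reflCycles_of_forall h0⟩, cartier_eq_iff.2 h0⟩
  | succ n ih =>
    intro η
    obtain ⟨θ, hθ⟩ := ih η
    obtain ⟨ω, hω⟩ := h (show reflForms k R i from θ.1)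
    rw [cartier_eq_iff] at hθ hω
    have h0 : ∀ P ∈ Algebra.smoothLocus k R,
        (PushForms.form (p := p) (n := n + 1) (show reflForms k R i from ω.1), η.1) ∈
          cartierGraphIter p (localRingAt k P) i (n + 1) := fun P hP => by
      obtain ⟨θ', h₁, h₂⟩ := hω P hP
      obtain ⟨-, rfl⟩ := mem_cartierGraphIter_zero.1 h₂
      exact ⟨_, h₁, hθ P hP⟩
    exact ⟨⟨_, mem_reflCycles_of_forall h0⟩, cartier_eq_iff.2 h0⟩

theorem mem_reflBoundaries_iff {n i : ℕ} {ω : PushForms k R p n i} :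
    ω ∈ reflBoundaries k R p n i ↔
      ∃ h : ω ∈ reflCycles k R p n i, cartier k R p n i ⟨ω, h⟩ = 0 := by
  have : CharP (FractionRing R) p := IsFractionRing.charP_of_isFractionRing R p
  have key : ω ∈ reflBoundaries k R p n i ↔ ∀ P ∈ Algebra.smoothLocus k R,
      (ω.form, 0) ∈ cartierGraphIter p (localRingAt k P) i n := by
    refine forall₂_congr fun P hP => ?_
    obtain ⟨r, ⟨X⟩⟩ := exists_logCoords p hP
    exact X.mem_localBoundaries_iff
  rw [key]
  exact ⟨fun h => ⟨mem_reflCycles_of_forall h, cartier_eq_iff.2 h⟩, fun ⟨_, h⟩ => cartier_eq_iff.1 h⟩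

theorem reflBoundaries_le_reflCycles (n i : ℕ) :
    reflBoundaries k R p n i ≤ reflCycles k R p n i := fun _ h =>
  (mem_reflBoundaries_iff.1 h).1

theorem ker_cartier (n i : ℕ) : LinearMap.ker (cartier k R p n i) =
    (reflBoundaries k R p n i).comap (reflCycles k R p n i).subtype := by
  ext ω
  rw [LinearMap.mem_ker, Submodule.mem_comap, mem_reflBoundaries_iff]
  exact ⟨fun h => ⟨ω.2, h⟩, fun ⟨_, h⟩ => h⟩

/-- Totality of the relation is surjectivity of C_n; single-valuedness holds because the kernel of
C_n is B_n. -/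
theorem graph_invCartier {n i : ℕ} (h : Function.Surjective (cartier k R p n i)) :
    (invCartier k R p n i).graph = LinearMap.range ((cartier k R p n i).prod
      ((reflBoundaries k R p n i).mkQ ∘ₗ (reflCycles k R p n i).subtype)) := by
  refine graph_linearMapOfGraph (exists_graph_eq _ (fun η => ?_) fun z hz => ?_)
  · obtain ⟨ω, rfl⟩ := h η
    exact ⟨_, ω, rfl⟩
  · obtain ⟨ω, hω⟩ := hz
    obtain ⟨h₁, h₂⟩ := Prod.ext_iff.1 hω
    change _ = z at h₂
    rw [← h₂]
    have : ω ∈ LinearMap.ker (cartier k R p n i) := h₁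
    rw [ker_cartier] at this
    exact (Submodule.Quotient.mk_eq_zero _).2 this

theorem invCartier_cartier {n i : ℕ} (h : Function.Surjective (cartier k R p n i))
    (ω : reflCycles k R p n i) : invCartier k R p n i (cartier k R p n i ω) =
      (reflBoundaries k R p n i).mkQ ω.1 := by
  have : (cartier k R p n i ω, (reflBoundaries k R p n i).mkQ ω.1) ∈
      (invCartier k R p n i).graph := by
    rw [graph_invCartier h]
    exact ⟨ω, rfl⟩
  exact ((LinearMap.mem_graph_iff _ _).1 this).symm

end GlobalCartier

/-! ### Coefficients, denominators and finiteness of reflexive forms -/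

namespace LogCoords

variable {k : Type v} {K : Type u} [CommRing k] [Field K] [Algebra k K]
variable {p : ℕ} {S : Subalgebra k K} {r : ℕ} (X : LogCoords p S r) {i : ℕ}

/-- The basis of the algebra of forms given by the products of the `dxₗ / xₗ`. -/
def formBasis : Module.Basis (Finset (Fin r)) K (DiffForms k K) := X.basis.ExteriorAlgebra

theorem formBasis_eq {J : Finset (Fin r)} (h : J.card = i) :
    X.formBasis J = X.dlogMulti (J.orderEmbOfFin h) :=
  ExteriorAlgebra.basis_apply_ofCard X.basis h

theorem dlogMulti_eq_zero_or (l : Fin i → Fin r) :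
    X.dlogMulti l = 0 ∨ ∃ J : Finset (Fin r), J.card = i ∧
      (X.dlogMulti l = X.formBasis J ∨ X.dlogMulti l = -X.formBasis J) := by
  by_cases hl : Function.Injective l
  swap
  · left
    refine AlternatingMap.map_eq_zero_of_not_injective _ _ fun h => hl ?_
    exact Function.Injective.of_comp (f := X.basis) h
  right
  let J := Finset.univ.image l
  have hJ : J.card = i := by rw [Finset.card_image_of_injective _ hl, Finset.card_fin]
  let σ : Equiv.Perm (Fin i) := (Equiv.ofInjective l hl).trans ((Equiv.setCongr
    (by rw [Finset.range_orderEmbOfFin]; simp [J])).trans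
    (Equiv.ofInjective _ (J.orderEmbOfFin hJ).injective).symm)
  have hσ : (fun j => X.basis (l j)) = (fun j => X.basis (J.orderEmbOfFin hJ j)) ∘ σ := by
    funext j
    have : J.orderEmbOfFin hJ (σ j) = l j := by
      simp only [σ, Equiv.trans_apply]
      rw [Equiv.apply_ofInjective_symm (J.orderEmbOfFin hJ).injective]
      rfl
    rw [Function.comp_apply, this]
  refine ⟨J, hJ, ?_⟩
  rw [X.formBasis_eq hJ, dlogMulti, hσ, AlternatingMap.map_perm]
  rcases Int.units_eq_one_or (Equiv.Perm.sign σ) with h | h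
  · left; rw [h, one_smul]; rfl
  · right; rw [h, Units.neg_smul, one_smul]; rfl

theorem formBasis_mem {J : Finset (Fin r)} (h : J.card = i) : X.formBasis J ∈ localForms S i := by
  rw [X.formBasis_eq h]
  simpa using X.smul_dlogMulti_mem (one_mem S) (J.orderEmbOfFin h)

theorem formBasis_repr_mem_of_mem_closure {T : Subalgebra k K} {ω : DiffForms k K}
    (hω : ω ∈ AddSubgroup.closure {ω | ∃ a ∈ T, ∃ l : Fin i → Fin r, ω = a • X.dlogMulti l})
    (J : Finset (Fin r)) : X.formBasis.repr ω J ∈ T ∧ (J.card ≠ i → X.formBasis.repr ω J = 0) := by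
  induction hω using AddSubgroup.closure_induction with
  | mem ω h =>
    obtain ⟨a, ha, l, rfl⟩ := h
    rw [map_smul, Finsupp.smul_apply, smul_eq_mul]
    rcases X.dlogMulti_eq_zero_or l with h | ⟨J', hJ', h | h⟩
    · rw [h, map_zero, Finsupp.zero_apply, mul_zero]
      exact ⟨zero_mem _, fun _ => rfl⟩
    · rw [h, Module.Basis.repr_self, Finsupp.single_apply]
      split_ifs with e
      · rw [mul_one]
        exact ⟨ha, fun h => (h (e ▸ hJ')).elim⟩
      · rw [mul_zero]
        exact ⟨zero_mem _, fun _ => rfl⟩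
    · rw [h, map_neg, Module.Basis.repr_self, Finsupp.neg_apply, Finsupp.single_apply]
      split_ifs with e
      · rw [mul_neg, mul_one]
        exact ⟨neg_mem ha, fun h => (h (e ▸ hJ')).elim⟩
      · rw [neg_zero, mul_zero]
        exact ⟨zero_mem _, fun _ => rfl⟩
  | zero =>
    rw [map_zero]
    exact ⟨zero_mem _, fun _ => rfl⟩
  | add _ _ _ _ h h' =>
    rw [map_add, Finsupp.add_apply]
    exact ⟨add_mem h.1 h'.1, fun hJ => by rw [h.2 hJ, h'.2 hJ, add_zero]⟩
  | neg _ _ h =>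
    rw [map_neg, Finsupp.neg_apply]
    exact ⟨neg_mem h.1, fun hJ => by rw [h.2 hJ, neg_zero]⟩

theorem formBasis_repr_mem {ω : DiffForms k K} (hω : ω ∈ localForms S i) (J : Finset (Fin r)) :
    X.formBasis.repr ω J ∈ S ∧ (J.card ≠ i → X.formBasis.repr ω J = 0) :=
  X.formBasis_repr_mem_of_mem_closure (X.localForms_eq i ▸ hω) J

/-- Multiplying by a common denominator of the derivatives of the elements of `T`, forms over `T`
have coefficients in `T`. -/
theorem pow_smul_mem_closure_of_theta {T : Subalgebra k K} {h : K}
    (hθ : ∀ l, ∀ a ∈ T, h * X.theta l a ∈ T) {ω : DiffForms k K} (hω : ω ∈ localForms T i) :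
    h ^ i • ω ∈ AddSubgroup.closure {ω | ∃ a ∈ T, ∃ l : Fin i → Fin r, ω = a • X.dlogMulti l} := by
  induction hω using AddSubgroup.closure_induction with
  | mem ω hω =>
    obtain ⟨a, ha, x, hx, rfl⟩ := hω
    induction i generalizing a with
    | zero =>
      refine AddSubgroup.subset_closure ⟨a, ha, Fin.elim0, ?_⟩
      rw [pow_zero, one_smul, wedgeD_zero, dlogMulti_zero]
    | succ i ih =>
      have h1 := ih a ha (fun j => x j.succ) fun j => hx j.succ
      have e : h ^ (i + 1) • a • wedgeD k x =
          (h • dOne k (x 0)) * (h ^ i • a • wedgeD k fun j => x j.succ) := by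
        rw [wedgeD_succ, smul_mul_smul_comm, mul_smul_comm, pow_succ']
      rw [e]
      generalize h ^ i • a • wedgeD k (fun j => x j.succ) = τ at h1
      rw [dOne_eq_sum, Finset.smul_sum, Finset.sum_mul]
      refine sum_mem fun l _ => ?_
      rw [smul_smul]
      induction h1 using AddSubgroup.closure_induction with
      | mem τ hτ =>
        obtain ⟨b, hb, m, rfl⟩ := hτ
        refine AddSubgroup.subset_closure ⟨_, mul_mem (hθ l _ (hx 0)) hb, Fin.cons l m, ?_⟩
        rw [dlogMulti_succ, smul_mul_smul_comm]
        rfl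
      | zero => rw [mul_zero]; exact zero_mem _
      | add _ _ _ _ h h' => rw [mul_add]; exact add_mem (h l ‹_›) (h' l ‹_›)
      | neg _ _ h => rw [mul_neg]; exact neg_mem (h l ‹_›)
  | zero => rw [smul_zero]; exact zero_mem _
  | add _ _ _ _ h h' => rw [smul_add]; exact add_mem h h'
  | neg _ _ h => rw [smul_neg]; exact neg_mem h

end LogCoords

section Denominators

variable (k : Type v) {R : Type u} [Field k] [CommRing R] [Algebra k R]

variable (R) in
/-- The ring `R`, as a subring of its field of fractions. -/
def globalRing : Subalgebra k (FractionRing R) :=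
  (IsScalarTower.toAlgHom k R (FractionRing R)).range

variable {k}

theorem algebraMap_mem_globalRing (a : R) : algebraMap R (FractionRing R) a ∈ globalRing k R :=
  ⟨a, rfl⟩

variable [IsDomain R]

theorem globalRing_le_localRingAt (P : PrimeSpectrum R) : globalRing k R ≤ localRingAt k P := by
  rintro _ ⟨a, rfl⟩
  exact algebraMap_mem_localRingAt k P a

/-- Denominators are cleared one differential at a time by the quotient rule t² d(b/t) = t db - b
dt. -/
theorem exists_smul_mem_localForms_globalRing {P : PrimeSpectrum R} {i : ℕ}
    {ω : DiffForms k (FractionRing R)} (hω : ω ∈ localForms (localRingAt k P) i) :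
    ∃ s ∉ P.asIdeal, algebraMap R (FractionRing R) s • ω ∈ localForms (globalRing k R) i := by
  induction hω using AddSubgroup.closure_induction with
  | mem ω hω =>
    obtain ⟨a, ha, x, hx, rfl⟩ := hω
    induction i with
    | zero =>
      obtain ⟨b, s, hs, rfl⟩ := (mem_localRingAt_iff k P a).1 ha
      have hs0 : algebraMap R (FractionRing R) s ≠ 0 := fun h0 => hs (by
        rw [map_eq_zero_iff _ (IsFractionRing.injective R (FractionRing R))] at h0
        rw [h0]; exact zero_mem _)
      refine ⟨s, hs, ?_⟩
      rw [smul_smul, mul_left_comm, mul_inv_cancel₀ hs0, mul_one]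
      exact smul_wedgeD_mem_localForms (algebraMap_mem_globalRing b) fun j => j.elim0
    | succ i ih =>
      obtain ⟨s, hs, h⟩ := ih (fun j => x j.succ) fun j => hx j.succ
      obtain ⟨b, t, ht, hb⟩ := (mem_localRingAt_iff k P _).1 (hx 0)
      have ht0 : algebraMap R (FractionRing R) t ≠ 0 := fun h0 => ht (by
        rw [map_eq_zero_iff _ (IsFractionRing.injective R (FractionRing R))] at h0
        rw [h0]; exact zero_mem _)
      set b' := algebraMap R (FractionRing R) b
      set t' := algebraMap R (FractionRing R) t
      have e : t' ^ 2 • dOne k (x 0) = t' • dOne k b' - b' • dOne k t' := by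
        have : dOne k (t' * x 0) = t' • dOne k (x 0) + x 0 • dOne k t' := by
          simp [dOne, Derivation.leibniz]
        have h2 : t' * x 0 = b' := by rw [hb]; field_simp
        rw [h2] at this
        rw [this, smul_add, smul_smul, smul_smul, h2, ← pow_two, add_sub_cancel_right]
      refine ⟨s * t ^ 2, fun h' => (P.2.mem_or_mem h').elim hs fun h'' =>
        ht (P.2.mem_of_pow_mem _ h''), ?_⟩
      have e' : algebraMap R (FractionRing R) (s * t ^ 2) • a • wedgeD k x =
          (t' ^ 2 • dOne k (x 0)) *
            (algebraMap R (FractionRing R) s • a • wedgeD k fun j => x j.succ) := by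
        rw [wedgeD_succ, smul_mul_smul_comm, mul_smul_comm, map_mul, map_pow, mul_comm (_ ^ 2)]
      rw [e', e, sub_mul, smul_mul_assoc, smul_mul_assoc]
      exact sub_mem
        (smul_mem_localForms (algebraMap_mem_globalRing t)
          (dOne_mul_mem_localForms (algebraMap_mem_globalRing b) h))
        (smul_mem_localForms (algebraMap_mem_globalRing b)
          (dOne_mul_mem_localForms (algebraMap_mem_globalRing t) h))
  | zero => exact ⟨1, fun h => P.2.ne_top ((Ideal.eq_top_iff_one _).2 h), by
      rw [smul_zero]; exact zero_mem _⟩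
  | add ω η _ _ h h' =>
    obtain ⟨s, hs, h⟩ := h
    obtain ⟨t, ht, h'⟩ := h'
    refine ⟨s * t, fun h' => (P.2.mem_or_mem h').elim hs ht, ?_⟩
    rw [smul_add, map_mul, mul_smul, mul_smul]
    refine add_mem ?_ (smul_mem_localForms (algebraMap_mem_globalRing s) h')
    rw [smul_comm]
    exact smul_mem_localForms (algebraMap_mem_globalRing t) h
  | neg _ _ h =>
    obtain ⟨s, hs, h⟩ := h
    exact ⟨s, hs, by rw [smul_neg]; exact neg_mem h⟩

theorem exists_smul_mem_reflForms {P : PrimeSpectrum R} {i : ℕ}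
    {ω : DiffForms k (FractionRing R)} (hω : ω ∈ localForms (localRingAt k P) i) :
    ∃ s ∉ P.asIdeal, s • ω ∈ reflForms k R i := by
  obtain ⟨s, hs, h⟩ := exists_smul_mem_localForms_globalRing hω
  refine ⟨s, hs, fun Q _ => localForms_mono (globalRing_le_localRingAt Q) ?_⟩
  rwa [algebraMap_smul] at h

theorem exists_finset_smul_mem_reflForms {P : PrimeSpectrum R} {i : ℕ} {ι : Type w} (s : Finset ι)
    (ω : ι → DiffForms k (FractionRing R)) (hω : ∀ l, ω l ∈ localForms (localRingAt k P) i) :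
    ∃ t ∉ P.asIdeal, ∀ l ∈ s, t • ω l ∈ reflForms k R i := by
  classical
  choose f hf hf' using fun l => exists_smul_mem_reflForms (hω l)
  refine ⟨∏ l ∈ s, f l, fun h => ?_, fun l hl => ?_⟩
  · obtain ⟨l, _, hl⟩ := (Ideal.IsPrime.prod_mem_iff).1 h
    exact hf l hl
  · rw [← Finset.prod_erase_mul _ _ hl, mul_smul]
    exact Submodule.smul_mem _ _ (hf' l)

end Denominators

section FiniteGeneration

variable {k : Type v} {R : Type u} [Field k] [CommRing R] [IsDomain R]
  [Algebra k R] [Algebra.FiniteType k R]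

/-- A common denominator h of the derivatives of finitely many algebra generators works on R by the
Leibniz rule, and on every local ring by the quotient rule. It is the same h for all P. -/
theorem exists_denominator_theta {p : ℕ} {S : Subalgebra k (FractionRing R)} {r : ℕ}
    (X : LogCoords p S r) : ∃ h : R, h ≠ 0 ∧ ∀ P : PrimeSpectrum R, ∀ l, ∀ a ∈ localRingAt k P,
      algebraMap R (FractionRing R) h * X.theta l a ∈ localRingAt k P := by
  classical
  obtain ⟨s, hs⟩ := ‹Algebra.FiniteType k R›.out
  obtain ⟨h, hh⟩ := IsLocalization.exist_integer_multiples_of_finset R⁰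
    ((Finset.univ ×ˢ s).image fun z : Fin r × R => X.theta z.1 (algebraMap R (FractionRing R) z.2))
  have hR : ∀ l (a : R), algebraMap R (FractionRing R) h * X.theta l (algebraMap R _ a) ∈
      globalRing k R := fun l a => by
    have ha : a ∈ Algebra.adjoin k (s : Set R) := hs ▸ Algebra.mem_top
    induction ha using Algebra.adjoin_induction with
    | mem a ha =>
      obtain ⟨b, hb⟩ := hh _ (Finset.mem_image_of_mem _
        (Finset.mk_mem_product (Finset.mem_univ l) ha))
      rw [← Algebra.smul_def]
      exact ⟨b, hb⟩
    | algebraMap c =>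
      rw [← IsScalarTower.algebraMap_apply, LogCoords.theta, Derivation.map_algebraMap, map_zero,
        mul_zero]
      exact zero_mem _
    | add a b _ _ ha hb => rw [map_add, X.theta_add, mul_add]; exact add_mem ha hb
    | mul a b _ _ ha hb =>
      rw [map_mul, X.theta_mul, mul_add, mul_left_comm, mul_left_comm _ (algebraMap R _ b)]
      exact add_mem (mul_mem (algebraMap_mem_globalRing a) hb)
        (mul_mem (algebraMap_mem_globalRing b) ha)
  refine ⟨h, nonZeroDivisors.ne_zero h.2, fun P l a ha => ?_⟩
  obtain ⟨b, t, ht, rfl⟩ := (mem_localRingAt_iff k P a).1 ha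
  have ht0 : algebraMap R (FractionRing R) t ≠ 0 := fun h0 => ht (by
    rw [map_eq_zero_iff _ (IsFractionRing.injective R (FractionRing R))] at h0
    rw [h0]; exact zero_mem _)
  have htinv : (algebraMap R (FractionRing R) t)⁻¹ ∈ localRingAt k P :=
    (mem_localRingAt_iff k P _).2 ⟨1, t, ht, by rw [map_one, one_mul]⟩
  have e : X.theta l (algebraMap R (FractionRing R) t)⁻¹ =
      -((algebraMap R (FractionRing R) t)⁻¹ ^ 2 * X.theta l (algebraMap R (FractionRing R) t)) := by
    rw [LogCoords.theta, Derivation.leibniz_inv, map_smul, smul_eq_mul, neg_mul]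
    rfl
  rw [X.theta_mul, e, mul_add, mul_neg, mul_neg, mul_left_comm, mul_left_comm _ (_ ^ 2),
    mul_left_comm _ (_⁻¹)]
  have h1 := fun a => globalRing_le_localRingAt P (hR l a)
  exact add_mem (neg_mem (mul_mem (algebraMap_mem_localRingAt k P b)
    (mul_mem (pow_mem htinv 2) (h1 t)))) (mul_mem htinv (h1 b))

/-- Reflexive differential forms on a normal variety form a finite module. -/
theorem finite_reflForms [PerfectField k] (p : ℕ) [Fact p.Prime] [CharP k p] [CharP R p] [IsIntegrallyClosed R]
    (i : ℕ) : Module.Finite R (reflForms k R i) := by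
  have : IsNoetherianRing R := Algebra.FiniteType.isNoetherianRing k R
  obtain ⟨r, ⟨X⟩⟩ := exists_logCoords p (bot_mem_smoothLocus k R)
  obtain ⟨h, h0, hθ⟩ := exists_denominator_theta X
  set h' := algebraMap R (FractionRing R) h
  have hh' : h' ≠ 0 := fun e => h0 (IsFractionRing.injective R (FractionRing R) (by
    rw [map_zero]; exact e))
  -- After multiplication by h ^ i, the coefficients in a basis at the generic point are regular at
  -- all smooth points, hence lie in R by normality. So reflexive forms embed into a finite module
  -- over a noetherian ring.
  let f : DiffForms k (FractionRing R) →ₗ[R] (Finset (Fin r) → FractionRing R) :=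
    (X.formBasis.equivFun.toLinearMap ∘ₗ (h' ^ i • LinearMap.id)).restrictScalars R
  let g : (Finset (Fin r) → R) →ₗ[R] (Finset (Fin r) → FractionRing R) :=
    (Algebra.linearMap R (FractionRing R)).compLeft _
  have hf : ∀ ω ∈ reflForms k R i, f ω ∈ LinearMap.range g := fun ω hω => by
    have hint : ∀ J, ∃ a : R, algebraMap R (FractionRing R) a = f ω J := fun J => by
      refine mem_range_of_mem_localRingAt (k := k) fun P hP => ?_
      exact (X.formBasis_repr_mem_of_mem_closure (X.pow_smul_mem_closure_of_theta
        (hθ P) (hω P hP)) J).1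
    choose a ha using hint
    exact ⟨a, funext ha⟩
  refine Module.Finite.of_injective
    ((f ∘ₗ (reflForms k R i).subtype).codRestrict (LinearMap.range g) fun ω => hf ω.1 ω.2) ?_
  intro ω η hωη
  have h1 : f ω.1 = f η.1 := congrArg Subtype.val hωη
  have h2 := X.formBasis.equivFun.injective h1
  exact Subtype.ext (smul_right_injective _ (pow_ne_zero i hh') h2)

end FiniteGeneration

/-! ### Integrality under perturbation of generators -/

section ValuativeIntegrality

variable {k : Type v} {K : Type u} [Field k] [Field K] [Algebra k K]

/-- The exponent c comes from a polynomial expression for a in the y l, and so it is the same for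
all valuation rings. -/
theorem exists_valuation_le_pow_of_mem_adjoin {ι : Type w} {y : ι → K} {a : K}
    (ha : a ∈ Algebra.adjoin k (Set.range y)) : ∃ c : ℕ, ∀ V : ValuationSubring K,
      (∀ b : k, algebraMap k K b ∈ V) → ∀ g, 1 ≤ g → (∀ l, V.valuation (y l) ≤ g) →
      V.valuation a ≤ g ^ c := by
  induction ha using Algebra.adjoin_induction with
  | mem a ha =>
    obtain ⟨l, rfl⟩ := ha
    exact ⟨1, fun V _ g _ h => by simpa using h l⟩
  | algebraMap b => exact ⟨0, fun V hV g _ _ => by simpa using (V.valuation_le_one_iff _).2 (hV b)⟩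
  | add a b _ _ ha hb =>
    obtain ⟨c, hc⟩ := ha
    obtain ⟨c', hc'⟩ := hb
    exact ⟨max c c', fun V hV g hg h => (V.valuation.map_add a b).trans
      (max_le ((hc V hV g hg h).trans (pow_le_pow_right₀ hg (le_max_left _ _)))
        ((hc' V hV g hg h).trans (pow_le_pow_right₀ hg (le_max_right _ _))))⟩
  | mul a b _ _ ha hb =>
    obtain ⟨c, hc⟩ := ha
    obtain ⟨c', hc'⟩ := hb
    exact ⟨c + c', fun V hV g hg h => by
      rw [map_mul, pow_add]
      exact mul_le_mul' (hc V hV g hg h) (hc' V hV g hg h)⟩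

/-- If the valuation of t exceeded g ^ C, the leading term of an integral equation would strictly
dominate all other terms. -/
theorem exists_valuation_le_pow_of_isIntegral {ι : Type w} {y : ι → K} {t : K}
    (ht : IsIntegral (Algebra.adjoin k (Set.range y)) t) : ∃ c : ℕ, ∀ V : ValuationSubring K,
      (∀ b : k, algebraMap k K b ∈ V) → ∀ g, 1 ≤ g → (∀ l, V.valuation (y l) ≤ g) →
      V.valuation t ≤ g ^ c := by
  obtain ⟨f, hf, hft⟩ := ht
  choose c hc using fun j => exists_valuation_le_pow_of_mem_adjoin (f.coeff j).2
  refine ⟨(Finset.range f.natDegree).sup c, fun V hV g hg h => ?_⟩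
  set C := (Finset.range f.natDegree).sup c
  by_contra H
  rw [not_le] at H
  have h1 : 1 < V.valuation t := (one_le_pow₀ hg).trans_lt H
  have hn : f.natDegree ≠ 0 := fun h0 => by
    rw [hf.natDegree_eq_zero.1 h0] at hft
    simp at hft
  rw [hf.as_sum] at hft
  simp only [Polynomial.eval₂_add, Polynomial.eval₂_pow, Polynomial.eval₂_X,
    Polynomial.eval₂_finsetSum, Polynomial.eval₂_mul, Polynomial.eval₂_C] at hft
  have h2 : V.valuation (∑ j ∈ Finset.range f.natDegree,
      algebraMap (Algebra.adjoin k (Set.range y)) K (f.coeff j) * t ^ j) <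
      V.valuation (t ^ f.natDegree) := by
    refine V.valuation.map_sum_lt (by
      rw [map_pow]
      exact pow_ne_zero _ (ne_of_gt (zero_lt_one.trans h1))) fun j hj => ?_
    rw [map_mul, map_pow, map_pow]
    have hjn : j + 1 ≤ f.natDegree := Finset.mem_range.1 hj
    calc _ ≤ g ^ C * V.valuation t ^ j := mul_le_mul_left
          (((hc j) V hV g hg h).trans (pow_le_pow_right₀ hg (Finset.le_sup hj))) _
      _ < V.valuation t * V.valuation t ^ j :=
        mul_lt_mul_of_pos_right H (pow_pos (zero_lt_one.trans h1) j)
      _ = V.valuation t ^ (j + 1) := (pow_succ' _ _).symm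
      _ ≤ _ := pow_le_pow_right₀ h1.le hjn
  have h3 := V.valuation.map_add_eq_of_lt_left h2
  rw [hft, map_zero, map_pow] at h3
  exact pow_ne_zero _ (ne_of_gt (zero_lt_one.trans h1)) h3.symm

/-- If the `tₗ` are integral over `k[y]`, then the `yₗ` are integral over `k[t + y ^ N]` for large
`N`. -/
theorem exists_isIntegral_add_pow {s : ℕ} {y t : Fin s → K}
    (ht : ∀ l, IsIntegral (Algebra.adjoin k (Set.range y)) (t l)) : ∃ N₀ : ℕ, ∀ N ≥ N₀, ∀ l,
      IsIntegral (Algebra.adjoin k (Set.range fun l => t l + y l ^ N)) (y l) := by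
  choose c hc using fun l => exists_valuation_le_pow_of_isIntegral (ht l)
  refine ⟨Finset.univ.sup c + 1, fun N hN l => ?_⟩
  set x := fun l => t l + y l ^ N
  have hle : Subring.closure (Set.range (algebraMap k K) ∪ Set.range x) ≤
      (Algebra.adjoin k (Set.range x)).toSubring := by
    rw [Subring.closure_le]
    rintro _ (⟨b, rfl⟩ | hz)
    · exact Subalgebra.algebraMap_mem _ b
    · exact Algebra.subset_adjoin hz
  -- The integral closure is an intersection of valuation rings V. If some y l were not in V, take y
  -- m of maximal valuation: N exceeds the exponent bounding t m, so y m ^ N dominates t m and x m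
  -- would not lie in V.
  have key : y l ∈ (integralClosure
      (Subring.closure (Set.range (algebraMap k K) ∪ Set.range x)) K).toSubring := by
    rw [← iInf_valuationSubring_superset, Subring.mem_iInf]
    rintro ⟨V, hV⟩
    have hVk : ∀ b : k, algebraMap k K b ∈ V := fun b => hV (Or.inl ⟨b, rfl⟩)
    have hVx : ∀ l, x l ∈ V := fun l => hV (Or.inr ⟨l, rfl⟩)
    obtain ⟨m, -, hm⟩ := Finset.exists_max_image Finset.univ (fun l => V.valuation (y l))
      ⟨l, Finset.mem_univ l⟩
    by_contra H
    have h1 : 1 < V.valuation (y m) := by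
      refine lt_of_lt_of_le ?_ (hm l (Finset.mem_univ l))
      rw [← not_le, V.valuation_le_one_iff]
      exact H
    have h2 := hc m V hVk _ h1.le fun l => hm l (Finset.mem_univ l)
    have h3 : V.valuation (t m) < V.valuation (y m ^ N) := by
      rw [map_pow]
      refine h2.trans_lt (pow_lt_pow_right₀ h1 ?_)
      exact (Nat.lt_succ_of_le (Finset.le_sup (Finset.mem_univ m))).trans_le hN
    have h4 : V.valuation (x m) = V.valuation (y m) ^ N := by
      rw [← map_pow]
      exact (congrArg V.valuation (add_comm _ _)).trans (V.valuation.map_add_eq_of_lt_left h3)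
    have h5 := (V.valuation_le_one_iff _).2 (hVx m)
    rw [h4] at h5
    exact not_lt.2 h5 (one_lt_pow₀ h1 (by omega))
  exact IsIntegral.map_of_comp_eq (Subring.inclusion hle) (RingHom.id K) rfl key

end ValuativeIntegrality

/-! ### Rank of differentials, dimension and Noether normalization -/

section DifferentialRank

variable {k : Type v} {K : Type u} [Field k] [Field K] [Algebra k K]

-- K is formally étale over k[z], being separable algebraic over its fraction field k(z), so the dz
-- form a basis of Ω.
open scoped IntermediateField.algebraAdjoinAdjoin in
theorem finrank_kaehlerDifferential_of_isSeparable {ι : Type w} [Fintype ι] {z : ι → K}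
    (hz : AlgebraicIndependent k z)
    [Algebra.IsSeparable (IntermediateField.adjoin k (Set.range z)) K] :
    Module.finrank K (Ω[K⁄k]) = Fintype.card ι := by
  let _ : Algebra (MvPolynomial ι k) K := (MvPolynomial.aeval z).toAlgebra
  let _ : Algebra (MvPolynomial ι k) (Algebra.adjoin k (Set.range z)) :=
    hz.aevalEquiv.toRingHom.toAlgebra
  have : IsScalarTower k (MvPolynomial ι k) K :=
    IsScalarTower.of_algebraMap_eq' (MvPolynomial.aeval z).comp_algebraMap.symm
  have : IsScalarTower (MvPolynomial ι k) (Algebra.adjoin k (Set.range z)) K :=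
    IsScalarTower.of_algebraMap_eq fun f => (hz.algebraMap_aevalEquiv f).symm
  have h1 : Algebra.FormallyEtale (MvPolynomial ι k) (Algebra.adjoin k (Set.range z)) :=
    Algebra.FormallyEtale.of_equiv (AlgEquiv.ofRingEquiv (f := hz.aevalEquiv.toRingEquiv)
      fun _ => rfl : MvPolynomial ι k ≃ₐ[MvPolynomial ι k] _)
  have h2 : Algebra.FormallyEtale (Algebra.adjoin k (Set.range z)) K := by
    have : Algebra.FormallyEtale (Algebra.adjoin k (Set.range z))
        (IntermediateField.adjoin k (Set.range z)) := .of_isLocalization (nonZeroDivisors _)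
    have : Algebra.FormallyEtale (IntermediateField.adjoin k (Set.range z)) K :=
      Algebra.FormallyEtale.of_isSeparable _ K
    exact .comp _ (IntermediateField.adjoin k (Set.range z)) _
  have h3 : Algebra.FormallyEtale (MvPolynomial ι k) K :=
    .comp _ (Algebra.adjoin k (Set.range z)) _
  rw [← (KaehlerDifferential.tensorKaehlerEquivOfFormallyEtale k (MvPolynomial ι k) K).finrank_eq]
  rw [Module.finrank_eq_card_basis ((KaehlerDifferential.mvPolynomialBasis k ι).baseChange K)]

/-- The given basis y need not be separating; but a separating one exists over a perfect field, and
it has the same cardinality. -/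
theorem finrank_kaehlerDifferential_of_isTranscendenceBasis [PerfectField k]
    [Algebra.EssFiniteType k K] {s : ℕ} {y : Fin s → K} (hy : IsTranscendenceBasis k y) :
    Module.finrank K (Ω[K⁄k]) = s := by
  obtain ⟨z, hz, hsep⟩ := exists_isTranscendenceBasis_and_isSeparable_of_perfectField k K
  have : Algebra.IsSeparable (IntermediateField.adjoin k (Set.range ((↑) : z → K))) K := by
    convert! hsep <;> simp
  rw [finrank_kaehlerDifferential_of_isSeparable hz.1]
  have := hz.lift_cardinalMk_eq hy
  simpa using this

end DifferentialRank

section Dimension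

theorem ringKrullDim_le_of_isIntegral {A B : Type*} [CommRing A] [CommRing B] [Algebra A B]
    [Algebra.IsIntegral A B] : ringKrullDim B ≤ ringKrullDim A :=
  Order.krullDim_le_of_strictMono (PrimeSpectrum.comap (algebraMap A B)) fun I J h =>
    Ideal.IsIntegral.comap_lt_comap (R := A) (I := I.asIdeal) (J := J.asIdeal) h

/-- Noether normalization, with the number of variables expressed by differentials. -/
theorem exists_noether_normalization {k : Type v} {R : Type u} [Field k] [PerfectField k]
    [CommRing R] [IsDomain R] [Algebra k R] [Algebra.FiniteType k R] {d r : ℕ}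
    (hd : ringKrullDim R = d) (hr : Module.finrank (FractionRing R) (Ω[FractionRing R⁄k]) = r) :
    d ≤ r ∧ ∃ y : Fin r → R, Algebra.IsIntegral (Algebra.adjoin k (Set.range y)) R := by
  obtain ⟨s, g, hg, hfin⟩ := exists_finite_inj_algHom_of_fg k R
  let y : Fin s → R := fun l => g (MvPolynomial.X l)
  have hgy : g = MvPolynomial.aeval y := MvPolynomial.algHom_ext fun l => by simp [y]
  have hint : Algebra.IsIntegral (Algebra.adjoin k (Set.range y)) R := by
    rw [Algebra.adjoin_range_eq_range_aeval, ← hgy]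
    let _ := g.toRingHom.toAlgebra
    exact ⟨fun a => IsIntegral.map_of_comp_eq g.rangeRestrict.toRingHom (RingHom.id R) rfl
      (hfin.to_isIntegral a)⟩
  have hind : AlgebraicIndependent k y := by
    rw [AlgebraicIndependent, ← hgy]
    exact hg
  have : Algebra.EssFiniteType R (FractionRing R) := .of_isLocalization _ R⁰
  have : Algebra.EssFiniteType k (FractionRing R) := .comp k R _
  have htr : IsTranscendenceBasis k y :=
    hind.isTranscendenceBasis_iff_isAlgebraic.2 inferInstance
  have hrs : s = r := by
    have : Algebra.IsAlgebraic R (FractionRing R) := IsLocalization.isAlgebraic _ R⁰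
    rw [← hr, finrank_kaehlerDifferential_of_isTranscendenceBasis
      (htr.algebraMap_comp (A := FractionRing R))]
  subst hrs
  refine ⟨?_, y, hint⟩
  -- Only the inequality d ≤ r is needed: an integral algebra does not have larger dimension than
  -- its base.
  let _ := g.toRingHom.toAlgebra
  have : Algebra.IsIntegral (MvPolynomial (Fin s) k) R := ⟨hfin.to_isIntegral⟩
  have h := ringKrullDim_le_of_isIntegral (A := MvPolynomial (Fin s) k) (B := R)
  rw [hd, MvPolynomial.ringKrullDim_of_isNoetherianRing, ringKrullDim_eq_zero_of_field,
    Nat.card_fin, zero_add] at h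
  exact_mod_cast h

end Dimension

/-! ### Finite maps to affine space that are étale at a given point -/

section EtaleCoordinates

open TensorProduct

/-- A formally smooth algebra is formally étale over a formally smooth subalgebra with the same
differentials. -/
theorem formallyEtale_of_bijective_mapBaseChange {k A T : Type*} [CommRing k] [CommRing A]
    [CommRing T] [Algebra k A] [Algebra k T] [Algebra A T] [IsScalarTower k A T]
    [Algebra.FormallySmooth k T]
    (h : Function.Bijective (KaehlerDifferential.mapBaseChange k A T)) :
    Algebra.FormallyEtale A T where
  subsingleton_kaehlerDifferential := by
    refine subsingleton_of_forall_eq 0 fun y => ?_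
    obtain ⟨y, rfl⟩ := KaehlerDifferential.map_surjective k A T y
    exact (KaehlerDifferential.exact_mapBaseChange_map k A T y).2 (h.2 y)
  subsingleton_h1Cotangent := by
    refine subsingleton_of_forall_eq 0 fun y => ?_
    -- In the Jacobi–Zariski sequence, δ lands in the kernel of the base change map and is injective
    -- because the first cotangent homology of T over k vanishes.
    have h1 : Algebra.H1Cotangent.δ k A T y = 0 := h.1 (by
      rw [map_zero]
      exact (Algebra.H1Cotangent.exact_δ_mapBaseChange k A T _).2 ⟨y, rfl⟩)
    obtain ⟨z, rfl⟩ := (Algebra.H1Cotangent.exact_map_δ k A T y).1 h1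
    rw [Subsingleton.elim z 0, map_zero]

theorem D_pow_char {k T : Type*} [CommRing k] [CommRing T] [Algebra k T] (p : ℕ) [CharP T p]
    (a : T) : KaehlerDifferential.D k T (a ^ p) = 0 := by
  rw [Derivation.leibniz_pow, ← Nat.cast_smul_eq_nsmul T, CharP.cast_eq_zero, zero_smul]

theorem formallyEtale_of_basis {k T : Type*} [CommRing k] [CommRing T] [Algebra k T]
    [Algebra.FormallySmooth k T] {ι : Type*} (x : ι → T) [Algebra (MvPolynomial ι k) T]
    [IsScalarTower k (MvPolynomial ι k) T]
    (hx : ∀ l, algebraMap (MvPolynomial ι k) T (MvPolynomial.X l) = x l)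
    (b : Module.Basis ι T (Ω[T⁄k])) (hb : ∀ l, b l = KaehlerDifferential.D k T (x l)) :
    Algebra.FormallyEtale (MvPolynomial ι k) T := by
  refine formallyEtale_of_bijective_mapBaseChange (k := k) ?_
  let e := ((KaehlerDifferential.mvPolynomialBasis k ι).baseChange T).equiv b (Equiv.refl ι)
  have : (e : T ⊗[MvPolynomial ι k] Ω[MvPolynomial ι k⁄k] →ₗ[T] Ω[T⁄k]) =
      KaehlerDifferential.mapBaseChange k (MvPolynomial ι k) T := by
    refine ((KaehlerDifferential.mvPolynomialBasis k ι).baseChange T).ext fun l => ?_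
    rw [LinearEquiv.coe_coe, Module.Basis.equiv_apply, Module.Basis.baseChange_apply,
      KaehlerDifferential.mvPolynomialBasis_apply, KaehlerDifferential.mapBaseChange_tmul, one_smul,
      KaehlerDifferential.map_D, hx, Equiv.refl_apply, hb]
  rw [← this]
  exact e.bijective

/-- Étaleness at P extends to a basic open neighbourhood, which is flat over A; the local ring is a
further localization. -/
theorem flat_of_isEtaleAt {A B : Type*} [CommRing A] [CommRing B] [Algebra A B]
    [Algebra.FinitePresentation A B] (P : Ideal B) [P.IsPrime] [Algebra.IsEtaleAt A P] :
    Module.Flat A (Localization.AtPrime P) := by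
  obtain ⟨f, hf, h⟩ := Algebra.exists_etale_of_isEtaleAt (R := A) P
  let φ : Localization.Away f →ₐ[B] Localization.AtPrime P :=
    IsLocalization.liftAlgHom (M := Submonoid.powers f) (f := Algebra.ofId _ _) (by
      rintro ⟨_, n, rfl⟩
      rw [Algebra.ofId_apply, map_pow]
      exact (IsLocalization.map_units (M := P.primeCompl) (Localization.AtPrime P) ⟨f, hf⟩).pow n)
  let _ := φ.toRingHom.toAlgebra
  have : IsScalarTower B (Localization.Away f) (Localization.AtPrime P) :=
    IsScalarTower.of_algebraMap_eq' φ.comp_algebraMap.symm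
  have : IsScalarTower A (Localization.Away f) (Localization.AtPrime P) := .to₁₃₄ _ B _ _
  have : IsLocalization (Algebra.algebraMapSubmonoid (Localization.Away f) P.primeCompl)
      (Localization.AtPrime P) := by
    refine .isLocalization_of_submonoid_le _ _ (Submonoid.powers f) _ ?_
    rintro _ ⟨n, rfl⟩
    exact P.primeCompl.pow_mem hf n
  have : Module.Flat (Localization.Away f) (Localization.AtPrime P) :=
    IsLocalization.flat _ (Algebra.algebraMapSubmonoid (Localization.Away f) P.primeCompl)
  exact Module.Flat.trans A (Localization.Away f) _

theorem isIntegral_of_adjoin {A B : Type*} [CommRing A] [CommRing B] [Algebra A B]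
    {ι : Type*} {y : ι → B} (hy : Algebra.IsIntegral (Algebra.adjoin A (Set.range y)) B)
    {C : Subalgebra A B} (h : ∀ l, IsIntegral C (y l)) : Algebra.IsIntegral C B := by
  have hle : Algebra.adjoin A (Set.range y) ≤ (integralClosure C B).restrictScalars A := by
    refine Algebra.adjoin_le ?_
    rintro _ ⟨l, rfl⟩
    exact h l
  refine ⟨fun a => isIntegral_trans (A := integralClosure C B) a ?_⟩
  exact IsIntegral.map_of_comp_eq (Subalgebra.inclusion hle).toRingHom (RingHom.id B) rfl
    (hy.isIntegral a)

/-- The valuative argument takes place in the field of fractions, and integrality descends to R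
along the injection. -/
theorem exists_isIntegral_adjoin_add_pow {k : Type v} {R : Type u} [Field k] [CommRing R] [IsDomain R]
    [Algebra k R] {s : ℕ} {y : Fin s → R}
    (hy : Algebra.IsIntegral (Algebra.adjoin k (Set.range y)) R) (t : Fin s → R) :
    ∃ N₀ : ℕ, ∀ N ≥ N₀,
      Algebra.IsIntegral (Algebra.adjoin k (Set.range fun l => t l + y l ^ N)) R := by
  let ι := IsScalarTower.toAlgHom k R (FractionRing R)
  have hι : Function.Injective ι := IsFractionRing.injective R (FractionRing R)
  have hadj : ∀ z : Fin s → R, Algebra.adjoin k (Set.range fun l => ι (z l)) =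
      (Algebra.adjoin k (Set.range z)).map ι := fun z => by
    rw [AlgHom.map_adjoin, ← Set.range_comp]
    rfl
  obtain ⟨N₀, hN₀⟩ := exists_isIntegral_add_pow (k := k) (y := fun l => ι (y l))
    (t := fun l => ι (t l)) fun l => by
      rw [hadj]
      exact IsIntegral.map_of_comp_eq
        ((Algebra.adjoin k (Set.range y)).equivMapOfInjective ι hι).toRingEquiv.toRingHom
        ι.toRingHom rfl (hy.isIntegral (t l))
  refine ⟨N₀, fun N hN => isIntegral_of_adjoin hy fun l => ?_⟩
  have h := hN₀ N hN l
  have e : (fun l => ι (t l) + ι (y l) ^ N) = fun l => ι (t l + y l ^ N) := by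
    funext l
    rw [map_add, map_pow]
  rw [e, hadj] at h
  rw [← isIntegral_algebraMap_iff (IsFractionRing.injective R (FractionRing R))]
  refine IsIntegral.map_of_comp_eq (((Algebra.adjoin k
    (Set.range fun l => t l + y l ^ N)).equivMapOfInjective ι hι).symm : _ →+* _)
    (RingHom.id _) ?_ h
  ext a
  obtain ⟨a, rfl⟩ := ((Algebra.adjoin k
    (Set.range fun l => t l + y l ^ N)).equivMapOfInjective ι hι).surjective a
  simp
  rfl

variable {k : Type v} {R : Type u} [Field k] [CommRing R] [Algebra k R]
  [Algebra.FiniteType k R]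

theorem finite_aeval_of_isIntegral_adjoin {s : ℕ} {x : Fin s → R}
    (hx : Algebra.IsIntegral (Algebra.adjoin k (Set.range x)) R) :
    (MvPolynomial.aeval (R := k) x).toRingHom.Finite := by
  rw [Algebra.adjoin_range_eq_range_aeval] at hx
  let _ : Algebra (MvPolynomial (Fin s) k) R := (MvPolynomial.aeval x).toAlgebra
  let _ : Algebra (MvPolynomial (Fin s) k) (MvPolynomial.aeval (R := k) x).range :=
    (MvPolynomial.aeval x).rangeRestrict.toRingHom.toAlgebra
  have : IsScalarTower (MvPolynomial (Fin s) k) (MvPolynomial.aeval (R := k) x).range R :=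
    IsScalarTower.of_algebraMap_eq fun _ => rfl
  have : IsScalarTower k (MvPolynomial (Fin s) k) R :=
    IsScalarTower.of_algebraMap_eq' (MvPolynomial.aeval x).comp_algebraMap.symm
  have : Algebra.IsIntegral (MvPolynomial (Fin s) k) (MvPolynomial.aeval (R := k) x).range :=
    Algebra.isIntegral_of_surjective (MvPolynomial.aeval x).rangeRestrict_surjective
  have : Algebra.IsIntegral (MvPolynomial (Fin s) k) R :=
    Algebra.IsIntegral.trans (MvPolynomial.aeval (R := k) x).range
  have := Algebra.FiniteType.of_restrictScalars_finiteType k (MvPolynomial (Fin s) k) R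
  exact Algebra.IsIntegral.finite

variable [IsDomain R]

theorem flat_aeval_of_basis {s : ℕ} {x : Fin s → R} {P : PrimeSpectrum R}
    (hP : P ∈ Algebra.smoothLocus k R)
    (b : Module.Basis (Fin s) (localRingAt k P) (Ω[localRingAt k P⁄k]))
    (hb : ∀ l, b l = KaehlerDifferential.D k _ (algebraMap R (localRingAt k P) (x l))) :
    ((algebraMap R (localRingAt k P)).comp (MvPolynomial.aeval (R := k) x).toRingHom).Flat := by
  let _ : Algebra (MvPolynomial (Fin s) k) R := (MvPolynomial.aeval x).toAlgebra
  let _ : Algebra (MvPolynomial (Fin s) k) (localRingAt k P) :=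
    ((algebraMap R (localRingAt k P)).comp (MvPolynomial.aeval (R := k) x).toRingHom).toAlgebra
  have : IsScalarTower k (MvPolynomial (Fin s) k) R :=
    IsScalarTower.of_algebraMap_eq' (MvPolynomial.aeval x).comp_algebraMap.symm
  have : IsScalarTower (MvPolynomial (Fin s) k) R (localRingAt k P) :=
    IsScalarTower.of_algebraMap_eq fun _ => rfl
  have : IsScalarTower k (MvPolynomial (Fin s) k) (localRingAt k P) := .to₁₂₄ _ _ R _
  have := formallySmooth_localRingAt hP
  have h1 : Algebra.FormallyEtale (MvPolynomial (Fin s) k) (localRingAt k P) :=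
    formallyEtale_of_basis (fun l => algebraMap R (localRingAt k P) (x l)) (fun l => by
      rw [IsScalarTower.algebraMap_apply (MvPolynomial (Fin s) k) R]
      exact congrArg _ (MvPolynomial.aeval_X x l)) b hb
  let e := (IsLocalization.algEquiv P.asIdeal.primeCompl (localRingAt k P)
    (Localization.AtPrime P.asIdeal)).restrictScalars (MvPolynomial (Fin s) k)
  have h2 : Algebra.IsEtaleAt (MvPolynomial (Fin s) k) P.asIdeal := .of_equiv e
  have := Algebra.FiniteType.of_restrictScalars_finiteType k (MvPolynomial (Fin s) k) R
  have : Algebra.FinitePresentation (MvPolynomial (Fin s) k) R :=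
    Algebra.FinitePresentation.of_finiteType.1 this
  have := flat_of_isEtaleAt (A := MvPolynomial (Fin s) k) P.asIdeal
  exact Module.Flat.of_linearEquiv e.toLinearEquiv

variable [PerfectField k]

/-- The differentials of the functions in a maximal ideal generate all differentials, at every
point. -/
theorem span_D_maximal (p : ℕ) [Fact p.Prime] [CharP R p] (P : PrimeSpectrum R) (𝔪 : Ideal R)
    [𝔪.IsMaximal] : Submodule.span (localRingAt k P) (Set.range fun t : 𝔪 =>
      KaehlerDifferential.D k _ (algebraMap R (localRingAt k P) t)) = ⊤ := by
  have hp : p.Prime := Fact.out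
  have hu : ∀ u ∉ P.asIdeal, IsUnit (algebraMap R (localRingAt k P) u) := fun u hu =>
    IsLocalization.map_units (M := P.asIdeal.primeCompl) _ ⟨u, hu⟩
  have key : ∀ (a : R) (N : Submodule (localRingAt k P) (Ω[localRingAt k P⁄k])) (u : R),
      u ∉ P.asIdeal → algebraMap R (localRingAt k P) u •
        KaehlerDifferential.D k _ (algebraMap R (localRingAt k P) a) ∈ N →
        KaehlerDifferential.D k _ (algebraMap R (localRingAt k P) a) ∈ N := fun a N u hu' h =>
    (Submodule.smul_mem_iff_of_isUnit N (hu u hu')).1 h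
  rw [eq_top_iff, ← KaehlerDifferential.span_range_map_derivation_of_isLocalization k R
    (localRingAt k P) P.asIdeal.primeCompl, Submodule.span_le]
  rintro _ ⟨a, rfl⟩
  rw [Function.comp_apply, KaehlerDifferential.map_D]
  -- If P = 𝔪 and f is the minimal polynomial of a modulo 𝔪, then f(a) ∈ 𝔪 and d f(a) = f'(a) da,
  -- with f'(a) a unit at P by separability. Otherwise there is u ∈ 𝔪 outside P, and d(uᵖ a) = uᵖ da
  -- with uᵖ a ∈ 𝔪.
  by_cases h : 𝔪 ≤ P.asIdeal
  · have hP : 𝔪 = P.asIdeal := (‹𝔪.IsMaximal›).eq_of_le P.2.ne_top h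
    let _ := Ideal.Quotient.field 𝔪
    have : Module.Finite k (R ⧸ 𝔪) := finite_of_finite_type_of_isJacobsonRing k (R ⧸ 𝔪)
    have hsep := Algebra.IsSeparable.isSeparable k (Ideal.Quotient.mk 𝔪 a)
    set f := minpoly k (Ideal.Quotient.mk 𝔪 a)
    have hev : ∀ g : Polynomial k, Ideal.Quotient.mk 𝔪 (Polynomial.aeval a g) =
        Polynomial.aeval (Ideal.Quotient.mk 𝔪 a) g := fun g =>
      (Polynomial.aeval_algHom_apply (Ideal.Quotient.mkₐ k 𝔪) a g).symm
    have h1 : Polynomial.aeval a f ∈ 𝔪 := by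
      rw [← Ideal.Quotient.eq_zero_iff_mem, hev, minpoly.aeval]
    have h2 : Polynomial.aeval a (Polynomial.derivative f) ∉ P.asIdeal := by
      rw [← hP, ← Ideal.Quotient.eq_zero_iff_mem, hev]
      exact hsep.aeval_derivative_ne_zero (minpoly.aeval _ _)
    refine key a _ _ h2 ?_
    have h3 := (KaehlerDifferential.D k (localRingAt k P)).map_aeval f
      (algebraMap R (localRingAt k P) a)
    rw [Polynomial.aeval_algebraMap_apply, Polynomial.aeval_algebraMap_apply] at h3
    rw [← h3]
    exact Submodule.subset_span ⟨⟨_, h1⟩, rfl⟩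
  · obtain ⟨u, hu, hu'⟩ := SetLike.not_le_iff_exists.1 h
    refine key a _ (u ^ p) (fun h => hu' (P.2.mem_of_pow_mem _ h)) ?_
    have h3 : KaehlerDifferential.D k (localRingAt k P)
        (algebraMap R (localRingAt k P) (u ^ p * a)) = algebraMap R (localRingAt k P) (u ^ p) •
        KaehlerDifferential.D k _ (algebraMap R (localRingAt k P) a) := by
      have : CharP (localRingAt k P) p :=
        charP_of_injective_algebraMap (IsLocalization.injective (localRingAt k P)
          P.asIdeal.primeCompl_le_nonZeroDivisors) p
      rw [map_mul, map_pow, Derivation.leibniz, D_pow_char, smul_zero, add_zero]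
    rw [← h3]
    exact Submodule.subset_span ⟨⟨u ^ p * a, Ideal.mul_mem_right _ _
      (Ideal.pow_mem_of_mem _ hu _ hp.pos)⟩, rfl⟩

/-- Integral generators may be chosen in a given maximal ideal. -/
theorem exists_isIntegral_adjoin_mem_maximal {s : ℕ} {y : Fin s → R}
    (hy : Algebra.IsIntegral (Algebra.adjoin k (Set.range y)) R) (𝔪 : Ideal R) [𝔪.IsMaximal] :
    ∃ z : Fin s → R, (∀ l, z l ∈ 𝔪) ∧ Algebra.IsIntegral (Algebra.adjoin k (Set.range z)) R := by
  let _ := Ideal.Quotient.field 𝔪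
  have : Module.Finite k (R ⧸ 𝔪) := finite_of_finite_type_of_isJacobsonRing k (R ⧸ 𝔪)
  -- The element z l = f l (y l) vanishes modulo 𝔪, and y l is a root of the monic polynomial f l -
  -- z l.
  let f := fun l => minpoly k (Ideal.Quotient.mk 𝔪 (y l))
  have hfm : ∀ l, (f l).Monic := fun l => minpoly.monic (Algebra.IsIntegral.isIntegral _)
  let z := fun l => Polynomial.aeval (y l) (f l)
  refine ⟨z, fun l => ?_, ?_⟩
  · rw [← Ideal.Quotient.eq_zero_iff_mem]
    exact (Polynomial.aeval_algHom_apply (Ideal.Quotient.mkₐ k 𝔪) (y l) (f l)).symm.trans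
      (minpoly.aeval _ _)
  · refine isIntegral_of_adjoin hy fun l => ?_
    let zl : Algebra.adjoin k (Set.range z) := ⟨z l, Algebra.subset_adjoin ⟨l, rfl⟩⟩
    refine ⟨(f l).map (algebraMap k _) - Polynomial.C zl, ?_, ?_⟩
    · refine ((hfm l).map _).sub_of_left (Polynomial.degree_C_le.trans_lt ?_)
      rw [(hfm l).degree_map]
      exact minpoly.degree_pos (Algebra.IsIntegral.isIntegral _)
    · rw [Polynomial.eval₂_sub, Polynomial.eval₂_C, Polynomial.eval₂_map,
        ← IsScalarTower.algebraMap_eq]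
      exact sub_self _

/-- For a smooth point `P` and a closed point `𝔪` of an affine variety, there is a finite map to affine
space which is flat at `P` and maps `𝔪` to the origin. -/
theorem exists_finite_flat_coordinates (p : ℕ) [Fact p.Prime] [CharP R p] {d : ℕ}
    (hd : ringKrullDim R = d) {P : PrimeSpectrum R} (hP : P ∈ Algebra.smoothLocus k R)
    (𝔪 : Ideal R) [𝔪.IsMaximal] :
    ∃ (r : ℕ) (x : Fin r → R), d ≤ r ∧ (∀ l, x l ∈ 𝔪) ∧
      (MvPolynomial.aeval (R := k) x).toRingHom.Finite ∧
      ((algebraMap R (localRingAt k P)).comp (MvPolynomial.aeval (R := k) x).toRingHom).Flat := by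
  have hp : p.Prime := Fact.out
  obtain ⟨r, t, b, hb⟩ := exists_basis_D_of_span hP
    (fun t : 𝔪 => algebraMap R (localRingAt k P) t) (span_D_maximal p P 𝔪)
  have hrank : Module.finrank (FractionRing R) (Ω[FractionRing R⁄k]) = r := by
    rw [Module.finrank_eq_card_basis (ratBasis b), Fintype.card_fin]
  obtain ⟨hdr, y', hy'⟩ := exists_noether_normalization hd hrank
  obtain ⟨y, hym, hy⟩ := exists_isIntegral_adjoin_mem_maximal hy' 𝔪
  obtain ⟨N₀, hN₀⟩ := exists_isIntegral_adjoin_add_pow hy fun l => (t l : R)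
  -- The exponent is at least N₀, for finiteness, and a multiple of p, so that the differentials at
  -- P remain the basis d(t l).
  refine ⟨r, fun l => t l + y l ^ ((N₀ + 1) * p), hdr, fun l => ?_,
    finite_aeval_of_isIntegral_adjoin (hN₀ _ ?_), flat_aeval_of_basis hP b fun l => ?_⟩
  · exact add_mem (t l).2 (Ideal.pow_mem_of_mem _ (hym l) _ (Nat.mul_pos N₀.succ_pos hp.pos))
  · exact (Nat.le_succ N₀).trans (Nat.le_mul_of_pos_right _ hp.pos)
  · have : CharP (localRingAt k P) p :=
      charP_of_injective_algebraMap (IsLocalization.injective (localRingAt k P)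
        P.asIdeal.primeCompl_le_nonZeroDivisors) p
    rw [hb, map_add, map_add, pow_mul, map_pow, D_pow_char, add_zero]

end EtaleCoordinates

/-! ### Uniform annihilation of local cohomology at smooth points -/

section FrobeniusAnnihilation

variable {R : Type u} [CommRing R] {A : Type w} [CommRing A] {B : Type v} [CommRing B]

/-- Lets A act on G through ψ. It is applied with ψ an iterate of Frobenius, to treat Fⁿ_* of a
module. -/
theorem LocCoh.map_pow_eq_zero_of_comp {I : Ideal R} (φ : A →+* R) (ψ : A →+* B) (rs : List A)
    (hI : ∀ a ∈ rs, φ a ∈ I) {G : Type*} [AddCommGroup G] [Module B G]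
    (hG : IsPowRegular G (rs.map ψ))
    {M : Type u} [AddCommGroup M] [Module R M] (f : M →ₗ[R] M) (α : M →+ G) (β : G →+ M)
    (hα : ∀ a m, α (φ a • m) = ψ a • α m) (hβ : ∀ a g, β (ψ a • g) = φ a • β g)
    (hf : ∀ m, f m = β (α m)) {j : ℕ} (hj : j < rs.length) (z : LocCoh I j M) :
    LocCoh.map I j (f ^ rs.length) z = 0 := by
  let _ : Module A G := Module.compHom G ψ
  let _ : Algebra A B := ψ.toAlgebra
  have : IsScalarTower A B G := IsScalarTower.of_algebraMap_smul fun _ _ => rfl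
  refine LocCoh.map_pow_eq_zero_of_factorsThrough φ rs hI (G := G) (fun rs' h => ?_) f
    ⟨α, β, hα, hβ, hf⟩ hj z
  rw [← RingTheory.Sequence.isWeaklyRegular_map_algebraMap_iff B]
  refine hG _ ?_
  rw [List.forall₂_map_left_iff, List.forall₂_map_right_iff]
  exact h.imp fun a b ⟨e, he⟩ => ⟨e, by rw [he, map_pow]; rfl⟩

theorem FrobPush.map_smul_id_pow (p n : ℕ) [ExpChar R p] {M : Type u} [AddCommGroup M]
    [Module R M] (s : R) (r : ℕ) :
    FrobPush.map p n (s • LinearMap.id : M →ₗ[R] M) ^ r =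
      FrobPush.map p n (s ^ r • LinearMap.id : M →ₗ[R] M) := by
  induction r with
  | zero =>
    ext m
    exact (one_smul R (show M from m)).symm.trans (by rw [← pow_zero s]; rfl)
  | succ r ih =>
    rw [pow_succ', ih]
    refine LinearMap.ext fun (m : M) => ?_
    change s • (s ^ r • m) = s ^ (r + 1) • m
    rw [smul_smul, pow_succ']

/-- If multiplication by `s` on `M` factors through a module over a subring on which `rs` is
regular, then a power of `s` annihilates the local cohomology of all `Fⁿ_* M` in degrees less than
the length of `rs`. -/
theorem LocCoh.map_frobPush_smul_eq_zero {I : Ideal R} (p n : ℕ) [ExpChar R p] [ExpChar A p]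
    (φ : A →+* R) (rs : List A) (hI : ∀ a ∈ rs, φ a ∈ I) {G : Type*} [AddCommGroup G] [Module A G]
    (hG : IsPowRegular G rs) {M : Type u} [AddCommGroup M] [Module R M] (s : R)
    (hs : FactorsThrough φ G (s • LinearMap.id : M →ₗ[R] M)) {j : ℕ} (hj : j < rs.length)
    (z : LocCoh I j (FrobPush R p n M)) :
    LocCoh.map I j (FrobPush.map p n (s ^ rs.length • LinearMap.id : M →ₗ[R] M)) z = 0 := by
  obtain ⟨α, β, hα, hβ, hf⟩ := hs
  rw [← FrobPush.map_smul_id_pow]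
  have hφ : ∀ a, iterateFrobenius R p n (φ a) = φ (iterateFrobenius A p n a) := fun a => by
    simp only [iterateFrobenius_def, map_pow]
  refine LocCoh.map_pow_eq_zero_of_comp φ (iterateFrobenius A p n) rs hI (G := G) (M := FrobPush R p n M) ?_
    (FrobPush.map p n (s • LinearMap.id : M →ₗ[R] M)) α β
    (fun a m => ?_) (fun a g => ?_) ?_ hj z
  -- Powers of pⁿ-th powers are again powers, so regularity survives Frobenius; this makes the
  -- annihilator independent of n.
  · intro rs' h
    refine hG rs' ?_
    rw [List.forall₂_map_left_iff] at h
    exact h.imp fun a b ⟨e, he⟩ => ⟨p ^ n * e, by rw [he, iterateFrobenius_def, pow_mul]⟩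
  · refine Eq.trans ?_ (hα (iterateFrobenius A p n a) m)
    rw [← hφ]
    rfl
  · change β (iterateFrobenius A p n a • g) = iterateFrobenius R p n (φ a) • (β g)
    rw [hφ, hβ]
  · exact hf

end FrobeniusAnnihilation

section Factorization

theorem Module.Flat.pi_of_fintype (A : Type*) [CommRing A] (S : Type*) [AddCommGroup S] [Module A S]
    [Module.Flat A S] (J : Type*) [Finite J] : Module.Flat A (J → S) := by
  classical
  have := Fintype.ofFinite J
  exact Module.Flat.of_linearEquiv (DFinsupp.linearEquivFunOnFintype (M := fun _ : J => S) (R := A)).symm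

variable {A : Type w} [CommRing A] [IsNoetherianRing A] {R : Type u} [CommRing R]

/-- M is finitely presented over A, so its map into the flat module Sᴶ factors through a finite free
module. To return to M rather than to V, the images of the finitely many basis vectors are
multiplied by a common denominator s ∉ P. -/
theorem exists_factorsThrough_of_flat (φ : A →+* R) (hφ : φ.Finite) {V : Type u} [AddCommGroup V]
    [Module R V] (M : Submodule R V) [Module.Finite R M] (P : Ideal R) [P.IsPrime]
    {S : Type*} [CommRing S] [Algebra R S] (hS : ((algebraMap R S).comp φ).Flat) {J : Type*}
    [Finite J] (c : M →ₗ[R] (J → S)) (e : (J → S) →ₗ[R] V) (hce : ∀ m, e (c m) = m)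
    (he : ∀ (t : ℕ) (y : Fin t → J → S), ∃ s ∉ P, ∀ l, s • e (y l) ∈ M) :
    ∃ s ∉ P, ∃ t : ℕ, FactorsThrough φ (Fin t →₀ A) (s • LinearMap.id : M →ₗ[R] M) := by
  let _ : Algebra A R := φ.toAlgebra
  let _ : Algebra A S := ((algebraMap R S).comp φ).toAlgebra
  have : IsScalarTower A R S := IsScalarTower.of_algebraMap_eq fun _ => rfl
  let _ : Module A V := Module.compHom V φ
  have : IsScalarTower A R V := IsScalarTower.of_algebraMap_smul fun _ _ => rfl
  let _ : Module A M := Module.compHom M φ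
  have : IsScalarTower A R M := IsScalarTower.of_algebraMap_smul fun _ _ => rfl
  have : Module.Finite A R := hφ
  have : Module.Finite A M := Module.Finite.trans R M
  have : Module.FinitePresentation A M := Module.finitePresentation_of_finite A M
  have : Module.Flat A S := hS
  have : Module.Flat A (J → S) := Module.Flat.pi_of_fintype A S J
  obtain ⟨t, h₂, h₃, h⟩ :=
    Module.Flat.exists_factorization_of_finitePresentation (c.restrictScalars A)
  obtain ⟨s, hs, hs'⟩ := he t fun l => h₃ (Finsupp.single l 1)
  let β : (Fin t →₀ A) →ₗ[A] M :=
    Finsupp.linearCombination A fun l => (⟨s • e (h₃ (Finsupp.single l 1)), hs' l⟩ : M)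
  have hβ : ∀ y, (β y : V) = s • e (h₃ y) := by
    intro y
    induction y using Finsupp.induction_linear with
    | zero => simp
    | add y y' hy hy' => simp only [map_add, Submodule.coe_add, hy, hy', smul_add]
    | single l a =>
      have h1 : Finsupp.single l a = a • Finsupp.single l (1 : A) := by simp
      have h2 : β (Finsupp.single l a) = φ a • ⟨s • e (h₃ (Finsupp.single l 1)), hs' l⟩ := by
        simp only [β, Finsupp.linearCombination_single]; rfl
      have h3 : e (h₃ (Finsupp.single l a)) = φ a • e (h₃ (Finsupp.single l 1)) := by
        rw [h1, map_smul, ← map_smul e]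
        exact congrArg e (algebraMap_smul R a (h₃ (Finsupp.single l 1))).symm
      rw [h2, h3, smul_comm s]
      rfl
  refine ⟨s, hs, t, h₂.toAddMonoidHom, β.toAddMonoidHom, fun a m => h₂.map_smul a m,
    fun a g => β.map_smul a g, fun m => Subtype.ext ?_⟩
  change s • (m : V) = β (h₂ m)
  rw [hβ, ← LinearMap.comp_apply h₃, ← h]
  exact congrArg (s • ·) (hce m).symm

end Factorization

section SmoothAnnihilation

theorem coe_smul_localRingAt {k : Type v} {R : Type u} [Field k] [CommRing R] [IsDomain R]
    [Algebra k R] {P : PrimeSpectrum R} (a : R) (y : localRingAt k P) :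
    ((a • y : localRingAt k P) : FractionRing R) = algebraMap R (FractionRing R) a * y := by
  rw [Algebra.smul_def]
  rfl

variable {k : Type v} {R : Type u} [Field k] [PerfectField k] [CommRing R] [IsDomain R]
  [Algebra k R] [Algebra.FiniteType k R] [IsIntegrallyClosed R]

/-- The required maps take coordinates in a logarithmic basis at P and recombine them; only index
sets of cardinality i contribute. -/
theorem exists_factorsThrough_reflForms (p : ℕ) [Fact p.Prime] [CharP k p] [CharP R p]
    {P : PrimeSpectrum R} (hP : P ∈ Algebra.smoothLocus k R)
    {r : ℕ} (x : Fin r → R) (hx : (MvPolynomial.aeval (R := k) x).toRingHom.Finite)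
    (hx' : ((algebraMap R (localRingAt k P)).comp (MvPolynomial.aeval (R := k) x).toRingHom).Flat)
    (i : ℕ) : ∃ s ∉ P.asIdeal, ∃ t : ℕ,
      FactorsThrough (MvPolynomial.aeval (R := k) x).toRingHom
        (Fin t →₀ MvPolynomial (Fin r) k) (s • LinearMap.id : reflForms k R i →ₗ[R] _) := by
  have := finite_reflForms (k := k) (R := R) p i
  obtain ⟨r', ⟨X⟩⟩ := exists_logCoords p hP
  let c : reflForms k R i →ₗ[R] ({J : Finset (Fin r') // J.card = i} → localRingAt k P) :=
    { toFun := fun ω J => ⟨X.formBasis.repr ω.1 J.1, (X.formBasis_repr_mem (ω.2 P hP) J.1).1⟩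
      map_add' := fun ω η => by
        ext J
        simp
      map_smul' := fun a ω => by
        ext J
        have : ((a • ω : reflForms k R i) : DiffForms k (FractionRing R)) =
          algebraMap R (FractionRing R) a • ω.1 := (algebraMap_smul _ a ω.1).symm
        rw [RingHom.id_apply, Pi.smul_apply, coe_smul_localRingAt]
        change X.formBasis.repr ((a • ω : reflForms k R i) : DiffForms k (FractionRing R)) J.1 = _
        rw [this, map_smul, Finsupp.smul_apply, smul_eq_mul] }
  let e : ({J : Finset (Fin r') // J.card = i} → localRingAt k P) →ₗ[R]
      DiffForms k (FractionRing R) :=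
    { toFun := fun y => ∑ J, (y J : FractionRing R) • X.formBasis J.1
      map_add' := fun y y' => by simp [add_smul, Finset.sum_add_distrib]
      map_smul' := fun a y => by
        simp only [RingHom.id_apply, Finset.smul_sum]
        refine Finset.sum_congr rfl fun J _ => ?_
        rw [← algebraMap_smul (FractionRing R) a (_ • _ : DiffForms k (FractionRing R)), smul_smul,
          Pi.smul_apply, coe_smul_localRingAt] }
  refine exists_factorsThrough_of_flat _ hx (reflForms k R i) P.asIdeal hx' c e (fun ω => ?_)
    (fun t y => ?_)
  · change ∑ J : {J : Finset (Fin r') // J.card = i}, X.formBasis.repr ω.1 J.1 • X.formBasis J.1 =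
      ω.1
    conv_rhs => rw [← X.formBasis.sum_repr ω.1]
    rw [← Finset.sum_subtype (Finset.univ.filter fun J : Finset (Fin r') => J.card = i) (by simp)
      fun J => X.formBasis.repr ω.1 J • X.formBasis J]
    refine Finset.sum_subset (Finset.filter_subset _ _) fun J _ hJ => ?_
    rw [(X.formBasis_repr_mem (ω.2 P hP) J).2 (by simpa using hJ), zero_smul]
  · obtain ⟨s, hs, h⟩ := exists_finset_smul_mem_reflForms (P := P) (i := i) Finset.univ (fun l => e (y l))
      (fun l => AddSubgroup.sum_mem (localForms (localRingAt k P) i) (t := Finset.univ)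
        (f := fun J : {J : Finset (Fin r') // J.card = i} =>
          (y l J : FractionRing R) • X.formBasis J.1)
        fun J _ => smul_mem_localForms (y l J).2 (X.formBasis_mem J.2))
    exact ⟨s, hs, fun l => h l (Finset.mem_univ l)⟩

/-- There are r ≥ d coordinates in 𝔪, and the induction over them uses up r factors s. Being prime,
P still does not contain s ^ r. -/
theorem exists_annihilator {p : ℕ} [Fact p.Prime] [CharP k p] [CharP R p] {d : ℕ} (hd : ringKrullDim R = d) {P : PrimeSpectrum R}
    (hP : P ∈ Algebra.smoothLocus k R) (𝔪 : Ideal R) [𝔪.IsMaximal] (i : ℕ) :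
    ∃ s ∉ P.asIdeal, ∀ n j : ℕ, j < d → ∀ z : LocCoh 𝔪 j (PushForms k R p n i),
      LocCoh.map 𝔪 j (FrobPush.map p n (s • LinearMap.id : reflForms k R i →ₗ[R] _)) z = 0 := by
  obtain ⟨r, x, hdr, hxm, hx, hx'⟩ := exists_finite_flat_coordinates p hd hP 𝔪
  obtain ⟨s, hs, t, h⟩ := exists_factorsThrough_reflForms p hP x hx hx' i
  refine ⟨s ^ r, fun h' => hs (P.2.mem_of_pow_mem r h'), fun n j hj z => ?_⟩
  have := LocCoh.map_frobPush_smul_eq_zero p n _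
    (List.ofFn fun l => (MvPolynomial.X l : MvPolynomial (Fin r) k)) (I := 𝔪) (fun a ha => ?_)
    (MvPolynomial.isPowRegular_X k r _) s h (j := j) (by simpa using by omega) z
  · simpa using this
  · obtain ⟨l, rfl⟩ := (List.mem_ofFn' _ _).1 ha
    simpa using hxm l

end SmoothAnnihilation

/-! ### Twisting by multiples of a divisor through the singular locus -/

namespace EffCartierDiv

variable {R : Type u} [CommRing R] [IsDomain R] (D : EffCartierDiv R)

/-- An invertible ideal and its inverse generate the unit ideal. -/
theorem exists_sum_eq_one : ∃ (t : ℕ) (a : Fin t → R) (b : Fin t → FractionRing R),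
    (∀ l, a l ∈ D.ideal) ∧ (∀ l, b l ∈ D.functions) ∧ ∑ l, a l • b l = 1 := by
  obtain ⟨J, hJ⟩ := D.isUnit.exists_right_inv
  have h1 : (1 : FractionRing R) ∈
      (D.ideal : FractionalIdeal R⁰ (FractionRing R)) * J := by
    rw [hJ]
    exact FractionalIdeal.one_mem_one R⁰
  refine FractionalIdeal.mul_induction_on (C := fun x => ∃ (t : ℕ) (a : Fin t → R)
    (b : Fin t → FractionRing R), (∀ l, a l ∈ D.ideal) ∧ (∀ l, b l ∈ D.functions) ∧
      ∑ l, a l • b l = x) h1 ?_ ?_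
  · intro x hx y hy
    obtain ⟨a, ha, rfl⟩ := (FractionalIdeal.mem_coeIdeal R⁰).1 hx
    refine ⟨1, fun _ => a, fun _ => y, fun _ => ha, fun _ c hc => ?_, by
      simp [Algebra.smul_def]⟩
    have : algebraMap R (FractionRing R) c * y ∈
        (D.ideal : FractionalIdeal R⁰ (FractionRing R)) * J :=
      FractionalIdeal.mul_mem_mul (FractionalIdeal.mem_coeIdeal_of_mem R⁰ hc) hy
    rw [hJ] at this
    rw [Algebra.smul_def]
    simpa using this
  · intro x y hx hy
    obtain ⟨t, a, b, ha, hb, h⟩ := hx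
    obtain ⟨t', a', b', ha', hb', h'⟩ := hy
    refine ⟨t + t', Fin.append a a', Fin.append b b', fun l => ?_, fun l => ?_, ?_⟩
    · refine Fin.addCases (fun l => ?_) (fun l => ?_) l
      · simpa using ha l
      · simpa using ha' l
    · refine Fin.addCases (fun l => ?_) (fun l => ?_) l
      · simpa using hb l
      · simpa using hb' l
    · simp [Fin.sum_univ_add, h, h']

end EffCartierDiv

section FrobPush

variable {R : Type u} [CommRing R]

theorem FrobPush.map_comp (p n : ℕ) [ExpChar R p] {M N Q : Type u} [AddCommGroup M] [Module R M]
    [AddCommGroup N] [Module R N] [AddCommGroup Q] [Module R Q] (g : N →ₗ[R] Q) (f : M →ₗ[R] N) :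
    FrobPush.map p n (g ∘ₗ f) = FrobPush.map p n g ∘ₗ FrobPush.map p n f := rfl

theorem FrobPush.map_add (p n : ℕ) [ExpChar R p] {M N : Type u} [AddCommGroup M] [Module R M]
    [AddCommGroup N] [Module R N] (f g : M →ₗ[R] N) :
    FrobPush.map p n (f + g) = FrobPush.map p n f + FrobPush.map p n g := rfl

theorem FrobPush.map_zero (p n : ℕ) [ExpChar R p] {M N : Type u} [AddCommGroup M] [Module R M]
    [AddCommGroup N] [Module R N] : FrobPush.map p n (0 : M →ₗ[R] N) = 0 := rfl

theorem FrobPush.map_sum (p n : ℕ) [ExpChar R p] {M N : Type u} [AddCommGroup M] [Module R M]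
    [AddCommGroup N] [Module R N] {ι : Type*} (s : Finset ι) (f : ι → M →ₗ[R] N) :
    FrobPush.map p n (∑ l ∈ s, f l) = ∑ l ∈ s, FrobPush.map p n (f l) := by
  classical
  induction s using Finset.induction_on with
  | empty => rfl
  | insert a s ha ih => rw [Finset.sum_insert ha, Finset.sum_insert ha, FrobPush.map_add, ih]


/-- The elements that annihilate the local cohomology of all `Fⁿ_* M` in degrees below `d`. -/
def frobAnnihilator (p : ℕ) [ExpChar R p] (I : Ideal R) (M : Type u) [AddCommGroup M] [Module R M]
    (d : ℕ) : Ideal R where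
  carrier := {s | ∀ n j : ℕ, j < d → ∀ z : LocCoh I j (FrobPush R p n M),
    LocCoh.map I j (FrobPush.map p n (s • LinearMap.id : M →ₗ[R] M)) z = 0}
  zero_mem' n j _ z := by
    rw [zero_smul, FrobPush.map_zero, LocCoh.map_zero_apply]
  add_mem' {s t} hs ht n j hj z := by
    rw [add_smul, FrobPush.map_add, LocCoh.map_add_apply, hs n j hj, ht n j hj, add_zero]
  smul_mem' a s hs n j hj z := by
    have : ((a • s) • LinearMap.id : M →ₗ[R] M) = (a • LinearMap.id) ∘ₗ (s • LinearMap.id) := by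
      ext m
      simp [mul_smul]
    rw [this, FrobPush.map_comp, ← LocCoh.map_comp_apply, hs n j hj, _root_.map_zero]

end FrobPush

section Twist

variable {k : Type v} {R : Type u} [Field k] [CommRing R] [IsDomain R] [Algebra k R]

variable (k) in
/-- Multiplication by a section of `O_X(D)`, as a map `Ω^{[i]}_X → Ω^{[i]}_X(D)`. -/
def mulTwist (i : ℕ) (D : EffCartierDiv R) (b : D.functions) :
    reflForms k R i →ₗ[R] reflFormsTwist k i D :=
  ((DistribSMul.toLinearMap R (DiffForms k (FractionRing R)) (b : FractionRing R)) ∘ₗ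
    (reflForms k R i).subtype).codRestrict (reflFormsTwist k i D) fun ω a ha => by
      obtain ⟨c, hc⟩ := b.2 a ha
      change a • ((b : FractionRing R) • (ω : DiffForms k (FractionRing R))) ∈ _
      rw [← smul_assoc, ← hc]
      rw [LinearMap.toSpanSingleton_apply, smul_assoc, one_smul]
      exact Submodule.smul_mem _ c ω.2

variable (p : ℕ) [Fact p.Prime] [CharP R p]

/-- Write 1 = ∑ aₗ bₗ with aₗ in O_X(-D) and bₗ in O_X(D). The inclusion is then a sum of maps that
begin with multiplication by an annihilator aₗ. -/
theorem map_inclTwist_eq_zero {𝔪 : Ideal R} {i d : ℕ} {D : EffCartierDiv R}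
    (h : D.ideal ≤ frobAnnihilator p 𝔪 (reflForms k R i) d) {n j : ℕ} (hj : j < d)
    (z : LocCoh 𝔪 j (PushForms k R p n i)) :
    LocCoh.map 𝔪 j (FrobPush.map p n (inclTwist k i D)) z = 0 := by
  obtain ⟨t, a, b, ha, hb, hab⟩ := D.exists_sum_eq_one
  have : inclTwist k i D = ∑ l, mulTwist k i D ⟨b l, hb l⟩ ∘ₗ (a l • LinearMap.id) := by
    refine LinearMap.ext fun ω => Subtype.ext ?_
    rw [LinearMap.sum_apply, AddSubmonoidClass.coe_finsetSum]
    change (ω : DiffForms k (FractionRing R)) =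
      ∑ l, b l • (a l • (ω : DiffForms k (FractionRing R)))
    conv_lhs => rw [← one_smul (FractionRing R) (ω : DiffForms k (FractionRing R)), ← hab,
      Finset.sum_smul]
    refine Finset.sum_congr rfl fun l _ => ?_
    rw [smul_assoc, smul_comm]
  rw [this, FrobPush.map_sum, LocCoh.map_sum_apply]
  refine Finset.sum_eq_zero fun l _ => ?_
  rw [FrobPush.map_comp, ← LocCoh.map_comp_apply, h (ha l) n j hj, map_zero]

variable [Algebra.FiniteType k R]

/-- Every prime containing J is singular and so contains O_X(-D); hence O_X(-D) lies in the radical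
of J. -/
theorem exists_pow_le_of_containsSing {D : EffCartierDiv R} (hD : D.ContainsSing k) {J : Ideal R}
    (hJ : ∀ P ∈ Algebra.smoothLocus k R, ¬ J ≤ P.asIdeal) : ∃ N, D.ideal ^ N ≤ J := by
  have : IsNoetherianRing R := Algebra.FiniteType.isNoetherianRing k R
  refine Ideal.exists_pow_le_of_le_radical_of_fg ?_ (IsNoetherian.noetherian D.ideal)
  rw [Ideal.radical_eq_sInf]
  refine le_sInf fun Q ⟨hQ, hQ'⟩ => ?_
  exact hD (show (⟨Q, hQ'⟩ : PrimeSpectrum R) ∈ _ from fun h => hJ _ h hQ)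

variable [PerfectField k] [IsIntegrallyClosed R] [CharP k p]

variable {p} in
/-- If `D` contains the singular locus, then sufficiently high multiples of `D` annihilate the local
cohomology of all `Fⁿ_*Ω^{[i]}_X` below the top degree. -/
theorem exists_forall_map_inclTwist_mult_eq_zero {d : ℕ} (hd : ringKrullDim R = d)
    {D : EffCartierDiv R} (hD : D.ContainsSing k) (𝔪 : Ideal R) [𝔪.IsMaximal] (i : ℕ) :
    ∃ N, ∀ N' ≥ N, ∀ n j : ℕ, j < d → ∀ z : LocCoh 𝔪 j (PushForms k R p n i),
      LocCoh.map 𝔪 j (FrobPush.map p n (inclTwist k i (D.mult N'))) z = 0 := by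
  obtain ⟨N, hN⟩ := exists_pow_le_of_containsSing hD (J := frobAnnihilator p 𝔪 (reflForms k R i) d)
    fun P hP h => by
      obtain ⟨s, hs, hs'⟩ := exists_annihilator (p := p) hd hP 𝔪 i
      exact hs (h hs')
  exact ⟨N, fun N' hN' n j hj z =>
    map_inclTwist_eq_zero p (D := D.mult N') ((Ideal.pow_le_pow_right hN').trans hN) hj z⟩

end Twist

/-! ### Degree zero: functions, Frobenius and the inverse Cartier operator -/

section DegreeZero

variable {k : Type v} {K : Type u} [CommRing k] [Field K] [Algebra k K]

theorem smul_one_injective {a b : K} (h : a • (1 : DiffForms k K) = b • 1) : a = b := by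
  rw [← Algebra.algebraMap_eq_smul_one, ← Algebra.algebraMap_eq_smul_one] at h
  exact (ExteriorAlgebra.algebraMap_leftInverse (Ω[K⁄k])).injective h

variable {S : Subalgebra k K}

theorem mem_localForms_zero {ω : DiffForms k K} :
    ω ∈ localForms S 0 ↔ ∃ a ∈ S, ω = a • (1 : DiffForms k K) := by
  constructor
  · intro h
    induction h using AddSubgroup.closure_induction with
    | mem ω h =>
      obtain ⟨a, ha, x, -, rfl⟩ := h
      exact ⟨a, ha, by rw [wedgeD_zero]⟩
    | zero => exact ⟨0, zero_mem _, (zero_smul K _).symm⟩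
    | add _ _ _ _ h h' =>
      obtain ⟨a, ha, rfl⟩ := h
      obtain ⟨b, hb, rfl⟩ := h'
      exact ⟨a + b, add_mem ha hb, (add_smul a b _).symm⟩
    | neg _ _ h =>
      obtain ⟨a, ha, rfl⟩ := h
      exact ⟨-a, neg_mem ha, (neg_smul a _).symm⟩
  · rintro ⟨a, ha, rfl⟩
    exact AddSubgroup.subset_closure ⟨a, ha, Fin.elim0, fun j => j.elim0, by rw [wedgeD_zero]⟩

variable {p : ℕ} [Fact p.Prime] [CharP K p]

/-- There are no exact forms in degree zero, and additivity of Frobenius makes the generating pairs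
already a group. -/
theorem mem_cartierGraph_degree_zero {z : DiffForms k K × DiffForms k K} :
    z ∈ cartierGraph p S 0 ↔ ∃ a ∈ S, z = (a ^ p • 1, a • 1) := by
  have hp : p ≠ 0 := (Fact.out : p.Prime).ne_zero
  constructor
  · intro h
    induction h using AddSubgroup.closure_induction with
    | mem z h =>
      rcases h with ⟨a, ha, x, -, rfl⟩ | ⟨h₁, h₂⟩
      · exact ⟨a, ha, by simp [wedgeD_zero]⟩
      · exact ⟨0, zero_mem _, Prod.ext (by
          rw [zero_pow hp, zero_smul]; exact h₁) (by simpa using h₂)⟩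
    | zero => exact ⟨0, zero_mem _, by rw [zero_pow hp, zero_smul]; rfl⟩
    | add _ _ _ _ h h' =>
      obtain ⟨a, ha, rfl⟩ := h
      obtain ⟨b, hb, rfl⟩ := h'
      exact ⟨a + b, add_mem ha hb, by rw [add_pow_char, add_smul, add_smul]; rfl⟩
    | neg _ _ h =>
      obtain ⟨a, ha, rfl⟩ := h
      refine ⟨-a, neg_mem ha, ?_⟩
      have : (-a) ^ p = -a ^ p := map_neg (frobenius K p) a
      rw [this, neg_smul, neg_smul]
      rfl
  · rintro ⟨a, ha, rfl⟩
    exact AddSubgroup.subset_closure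
      (Or.inl ⟨a, ha, Fin.elim0, fun j => j.elim0, by simp [wedgeD_zero]⟩)

theorem mem_cartierGraphIter_degree_zero {n : ℕ} {ω η : DiffForms k K} :
    (ω, η) ∈ cartierGraphIter p S 0 n ↔ ∃ a ∈ S, ω = a ^ p ^ n • 1 ∧ η = a • 1 := by
  induction n generalizing ω with
  | zero =>
    rw [mem_cartierGraphIter_zero, mem_localForms_zero]
    constructor
    · rintro ⟨⟨a, ha, rfl⟩, rfl⟩
      exact ⟨a, ha, by simp, rfl⟩
    · rintro ⟨a, ha, rfl, rfl⟩
      exact ⟨⟨a, ha, by simp⟩, by simp⟩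
  | succ n ih =>
    rw [mem_cartierGraphIter_succ]
    constructor
    · rintro ⟨θ, h₁, h₂⟩
      obtain ⟨a, ha, h⟩ := mem_cartierGraph_degree_zero.1 h₁
      obtain ⟨b, hb, h', rfl⟩ := ih.1 h₂
      obtain ⟨rfl, rfl⟩ := Prod.ext_iff.1 h
      have : a = b ^ p ^ n := smul_one_injective (k := k) h'
      exact ⟨b, hb, by rw [this, ← pow_mul, ← pow_succ], rfl⟩
    · rintro ⟨b, hb, rfl, rfl⟩
      exact ⟨b ^ p ^ n • 1, mem_cartierGraph_degree_zero.2 ⟨b ^ p ^ n, pow_mem hb _, by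
        rw [← pow_mul, ← pow_succ]⟩, ih.2 ⟨b, hb, rfl, rfl⟩⟩

end DegreeZero

section Functions

variable (k : Type v) (R : Type u) [Field k] [CommRing R] [Algebra k R]

/-- A rational function, as a form of degree zero. -/
def functionForm : FractionRing R →ₗ[R] DiffForms k (FractionRing R) :=
  (LinearMap.toSpanSingleton (FractionRing R) (DiffForms k (FractionRing R)) 1).restrictScalars R

variable {k R}

theorem functionForm_apply (a : FractionRing R) : functionForm k R a = a • 1 := rfl

theorem functionForm_algebraMap (a : R) :
    functionForm k R (algebraMap R (FractionRing R) a) = a • 1 :=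
  algebraMap_smul (FractionRing R) a (1 : DiffForms k (FractionRing R))

variable [IsDomain R]

theorem functionForm_injective : Function.Injective (functionForm k R) :=
  fun _ _ h => smul_one_injective h

theorem one_mem_reflForms_zero : (1 : DiffForms k (FractionRing R)) ∈ reflForms k R 0 :=
  fun _ _ => mem_localForms_zero.2 ⟨1, one_mem _, (one_smul _ _).symm⟩

variable (k R) in
/-- The map `O_X → Ω^{[0]}_X`. -/
def toReflForms : R →ₗ[R] reflForms k R 0 :=
  LinearMap.toSpanSingleton R (reflForms k R 0) ⟨1, one_mem_reflForms_zero⟩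

theorem coe_toReflForms (a : R) : (toReflForms k R a : DiffForms k (FractionRing R)) =
    functionForm k R (algebraMap R (FractionRing R) a) := (functionForm_algebraMap a).symm

variable (k) in
/-- The map `O_X(D) → Ω^{[0]}_X(D)`. -/
def toReflFormsTwist (D : EffCartierDiv R) : D.functions →ₗ[R] reflFormsTwist k 0 D :=
  (functionForm k R ∘ₗ D.functions.subtype).codRestrict (reflFormsTwist k 0 D) fun b a ha => by
    obtain ⟨c, hc⟩ := b.2 a ha
    have : a • (functionForm k R ∘ₗ D.functions.subtype) b = toReflForms k R c := by
      rw [coe_toReflForms, ← map_smul]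
      refine congrArg (functionForm k R) (Eq.trans hc.symm ?_)
      simp [Algebra.algebraMap_eq_smul_one]
    rw [this]
    exact (toReflForms k R c).2

variable [Algebra.FiniteType k R] [PerfectField k] [IsIntegrallyClosed R]

theorem exists_functionForm_eq {ω : DiffForms k (FractionRing R)} (hω : ω ∈ reflForms k R 0) :
    ∃ a : R, functionForm k R (algebraMap R (FractionRing R) a) = ω := by
  obtain ⟨a, -, rfl⟩ := mem_localForms_zero.1 (hω ⊥ (bot_mem_smoothLocus k R))
  obtain ⟨b, rfl⟩ := mem_range_of_mem_localRingAt (k := k) (x := a) fun P hP => by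
    obtain ⟨b, hb, h⟩ := mem_localForms_zero.1 (hω P hP)
    rwa [smul_one_injective h]
  exact ⟨b, rfl⟩

theorem bijective_toReflForms : Function.Bijective (toReflForms k R) := by
  refine ⟨fun a b h => ?_, fun ω => ?_⟩
  · have := congrArg (fun ω : reflForms k R 0 => (ω : DiffForms k (FractionRing R))) h
    simp only [coe_toReflForms] at this
    exact IsFractionRing.injective R (FractionRing R) (functionForm_injective this)
  · obtain ⟨a, ha⟩ := exists_functionForm_eq ω.2
    exact ⟨a, Subtype.ext ((coe_toReflForms a).trans ha)⟩

theorem bijective_toReflFormsTwist (D : EffCartierDiv R) :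
    Function.Bijective (toReflFormsTwist k D) := by
  refine ⟨fun a b h => Subtype.ext (functionForm_injective (congrArg Subtype.val h)), fun ω => ?_⟩
  obtain ⟨t, a, b, ha, hb, hab⟩ := D.exists_sum_eq_one
  choose c hc using fun l => exists_functionForm_eq (ω.2 (a l) (ha l))
  have hω : functionForm k R (∑ l, b l * algebraMap R (FractionRing R) (c l)) = ω := by
    rw [map_sum, ← one_smul (FractionRing R) (ω : DiffForms k (FractionRing R)), ← hab,
      Finset.sum_smul]
    refine Finset.sum_congr rfl fun l _ => ?_
    rw [functionForm_apply, mul_smul, ← functionForm_apply, hc, smul_assoc, smul_comm]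
  refine ⟨⟨∑ l, b l * algebraMap R (FractionRing R) (c l), fun a ha => ?_⟩, Subtype.ext hω⟩
  obtain ⟨e, he⟩ := exists_functionForm_eq (ω.2 a ha)
  rw [← hω, ← map_smul] at he
  rw [← functionForm_injective he]
  exact Submodule.algebraMap_mem e

end Functions

theorem LocCoh.map_bijective {R : Type u} [CommRing R] (I : Ideal R) (j : ℕ) {M N : Type u}
    [AddCommGroup M] [Module R M] [AddCommGroup N] [Module R N] {f : M →ₗ[R] N}
    (hf : Function.Bijective f) : Function.Bijective (LocCoh.map I j f) := by
  let e := LinearEquiv.ofBijective f hf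
  have h₁ : e.symm.toLinearMap ∘ₗ f = LinearMap.id := LinearMap.ext e.symm_apply_apply
  have h₂ : f ∘ₗ e.symm.toLinearMap = LinearMap.id := LinearMap.ext e.apply_symm_apply
  refine Function.bijective_iff_has_inverse.2 ⟨LocCoh.map I j e.symm.toLinearMap, fun z => ?_,
    fun z => ?_⟩
  · rw [LocCoh.map_comp_apply, h₁, LocCoh.map_id_apply]
  · rw [LocCoh.map_comp_apply, h₂, LocCoh.map_id_apply]

theorem LocCoh.injective_comp_iff {R : Type u} [CommRing R] (I : Ideal R) (j : ℕ)
    {M N Q M' N' Q' : Type u} [AddCommGroup M] [Module R M] [AddCommGroup N] [Module R N]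
    [AddCommGroup Q] [Module R Q] [AddCommGroup M'] [Module R M'] [AddCommGroup N'] [Module R N']
    [AddCommGroup Q'] [Module R Q'] {f : M →ₗ[R] N} {g : N →ₗ[R] Q} {f' : M' →ₗ[R] N'}
    {g' : N' →ₗ[R] Q'} {e : M' →ₗ[R] M} {q : Q' →ₗ[R] Q} (he : Function.Bijective e)
    (hq : Function.Bijective q) (h : g ∘ₗ f ∘ₗ e = q ∘ₗ g' ∘ₗ f') :
    Function.Injective ((LocCoh.map I j g).comp (LocCoh.map I j f)) ↔
      Function.Injective ((LocCoh.map I j g').comp (LocCoh.map I j f')) := by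
  have hmap : ((LocCoh.map I j g).comp (LocCoh.map I j f)) ∘ LocCoh.map I j e =
      LocCoh.map I j q ∘ ((LocCoh.map I j g').comp (LocCoh.map I j f')) := by
    funext z
    simp only [Function.comp_apply, AddMonoidHom.comp_apply, LocCoh.map_comp_apply]
    exact congrArg (fun f => LocCoh.map I j f z) h
  rw [← (LocCoh.map_bijective I j hq).1.of_comp_iff, ← hmap,
    Function.Injective.of_comp_iff' _ (LocCoh.map_bijective I j he)]

section DegreeZeroCartier

variable {k : Type v} {R : Type u} [Field k] [CommRing R] [IsDomain R] [Algebra k R]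
  [Algebra.FiniteType k R] [PerfectField k] {p : ℕ} [Fact p.Prime] [CharP k p] [CharP R p]

theorem reflBoundaries_degree_zero (n : ℕ) : reflBoundaries k R p n 0 = ⊥ := by
  have : CharP (FractionRing R) p := IsFractionRing.charP_of_isFractionRing R p
  refine (Submodule.eq_bot_iff _).2 fun ω hω => ?_
  obtain ⟨r, ⟨X⟩⟩ := exists_logCoords p (bot_mem_smoothLocus k R)
  obtain ⟨a, -, h, h'⟩ := mem_cartierGraphIter_degree_zero.1
    (X.mem_localBoundaries_iff.1 (hω ⊥ (bot_mem_smoothLocus k R)))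
  have ha : a = 0 := smul_one_injective (k := k) (by rw [← h', zero_smul])
  have hp : p ≠ 0 := (Fact.out : p.Prime).ne_zero
  refine Subtype.ext (h.trans ?_)
  rw [ha, zero_pow (pow_ne_zero n hp), zero_smul]
  rfl

/-- In degree zero C_n extracts pⁿ-th roots, so its inverse is Fⁿ. -/
theorem invCartier_toReflForms {n : ℕ} (h : Function.Surjective (cartier k R p n 0)) (a : R) :
    invCartier k R p n 0 (toReflForms k R a) = (reflBoundaries k R p n 0).mkQ
      (FrobPush.map p n (toReflForms k R) (frobMap R p n a)) := by
  have : CharP (FractionRing R) p := IsFractionRing.charP_of_isFractionRing R p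
  have key : ∀ P ∈ Algebra.smoothLocus k R,
      (PushForms.form (FrobPush.map p n (toReflForms k R) (frobMap R p n a)),
        (toReflForms k R a : DiffForms k (FractionRing R))) ∈
        cartierGraphIter p (localRingAt k P) 0 n := fun P _ =>
    mem_cartierGraphIter_degree_zero.2 ⟨algebraMap R (FractionRing R) a,
      algebraMap_mem_localRingAt k P a, (coe_toReflForms (k := k) (iterateFrobenius R p n a)).trans
        (by rw [iterateFrobenius_def, map_pow]; rfl), coe_toReflForms a⟩
  have hω := mem_reflCycles_of_forall key
  have hcart : cartier k R p n 0 ⟨_, hω⟩ = toReflForms k R a := cartier_eq_iff.2 key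
  rw [← hcart, invCartier_cartier h]

/-- In degree zero, the maps in the definition of pre-`F`-rationality are those in the definition of
`F`-rationality. -/
theorem injective_degree_zero_iff [IsIntegrallyClosed R] {n : ℕ}
    (h : Function.Surjective (cartier k R p n 0)) (D : EffCartierDiv R) (I : Ideal R) (j : ℕ) :
    Function.Injective ((LocCoh.map I j (natTwist k R p n 0 D)).comp
        (LocCoh.map I j (invCartier k R p n 0))) ↔
      Function.Injective ((LocCoh.map I j (FrobPush.map p n D.inclFunctions)).comp
        (LocCoh.map I j (frobMap R p n))) := by
  have hinj : Function.Injective (Submodule.mkQ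
      ((reflBoundaries k R p n 0).map (FrobPush.map p n (inclTwist k 0 D)))) := by
    rw [← LinearMap.ker_eq_bot, Submodule.ker_mkQ, reflBoundaries_degree_zero, Submodule.map_bot]
  have hq : Function.Bijective (Submodule.mkQ
      ((reflBoundaries k R p n 0).map (FrobPush.map p n (inclTwist k 0 D))) ∘ₗ
        FrobPush.map p n (toReflFormsTwist k D)) := by
    rw [LinearMap.coe_comp]
    exact Function.Bijective.comp ⟨hinj, Submodule.mkQ_surjective _⟩
      (bijective_toReflFormsTwist (k := k) D)
  refine LocCoh.injective_comp_iff I j (bijective_toReflForms (k := k)) hq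
    (LinearMap.ext fun a => ?_)
  rw [LinearMap.comp_apply, LinearMap.comp_apply, invCartier_toReflForms h]
  refine congrArg (Submodule.mkQ _) (Subtype.ext ?_)
  exact coe_toReflForms (iterateFrobenius R p n a)

end DegreeZeroCartier

/-! ### Coordinates over the p-th powers and p⁻ᵉ-linear maps -/

namespace LogCoords

variable {k : Type v} {K : Type u} [CommRing k] [Field K] [Algebra k K] {p : ℕ} [Fact p.Prime]
  [CharP K p] {S : Subalgebra k K} {r : ℕ} (X : LogCoords p S r)

theorem projAll_monomial_one (c : K) (e : Fin r → ℕ) :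
    X.projAll p ((c ^ p * ∏ n, X.x n ^ e n) • (1 : DiffForms k K)) =
      if ∀ l, p ∣ e l then (c ^ p * ∏ n, X.x n ^ e n) • (1 : DiffForms k K) else 0 := by
  have := X.projAll_monomial c e (Fin.elim0 : Fin 0 → Fin r)
  rwa [dlogMulti_zero] at this

theorem projAll_pow_mul (c : K) {a : K} (ha : a ∈ S) :
    X.projAll p ((c ^ p * a) • (1 : DiffForms k K)) = c ^ p • X.projAll p (a • 1) := by
  have := X.gen a ha
  clear ha
  induction this using AddSubgroup.closure_induction with
  | mem a h =>
    obtain ⟨b, hb, e, rfl⟩ := h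
    rw [← mul_assoc, ← mul_pow, projAll_monomial_one, projAll_monomial_one]
    split_ifs
    · rw [mul_pow, mul_assoc, mul_smul]
    · rw [smul_zero]
  | zero => simp
  | add _ _ _ _ h h' => rw [mul_add, add_smul, map_add, h, h', add_smul, map_add, smul_add]
  | neg _ _ h => rw [mul_neg, neg_smul, map_neg, h, neg_smul, map_neg, smul_neg]

theorem exists_forall_dvd_add_iff (e : Fin r → ℕ) :
    ∃ J₀ : Fin r → Fin p, ∀ J : Fin r → Fin p, (∀ l, p ∣ e l + J l) ↔ J = J₀ := by
  have hp : 0 < p := (Fact.out : p.Prime).pos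
  -- This is the residue of -e l; the outer reduction handles the case p ∣ e l.
  refine ⟨fun l => ⟨(p - e l % p) % p, Nat.mod_lt _ hp⟩, fun J => ?_⟩
  rw [funext_iff]
  refine forall_congr' fun l => ?_
  rw [Fin.ext_iff]
  have h1 := (J l).2
  have h2 := Nat.mod_lt (e l) hp
  have h3 := Nat.div_add_mod (e l) p
  rw [← h3]
  rw [show p * (e l / p) + e l % p + J l = p * (e l / p) + (e l % p + J l) by ring,
    Nat.dvd_add_right (dvd_mul_right _ _)]
  simp only [Nat.mul_add_mod, Nat.mod_mod]
  rcases Nat.eq_zero_or_pos (e l % p) with h0 | h0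
  · rw [h0]
    simp only [zero_add, Nat.sub_zero, Nat.mod_self]
    exact ⟨fun h => Nat.eq_zero_of_dvd_of_lt h h1, fun h => h ▸ dvd_zero p⟩
  · rw [Nat.mod_eq_of_lt (by omega : p - e l % p < p)]
    constructor
    · rintro ⟨q, hq⟩
      have : q = 1 := by
        rcases Nat.lt_or_ge q 1 with h | h
        · have : q = 0 := by omega
          subst this
          omega
        · rcases Nat.lt_or_ge 1 q with h' | h'
          · have := Nat.mul_le_mul_left p h'
            omega
          · omega
      subst this
      omega
    · intro h
      exact ⟨1, by omega⟩

/-- For a monomial a exactly one J makes all exponents divisible by p, so exactly one summand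
survives, and it equals a. -/
theorem sum_projAll {a : K} (ha : a ∈ S) :
    ∑ J : Fin r → Fin p, (∏ l, X.x l ^ (J l : ℕ))⁻¹ •
      X.projAll p (((∏ l, X.x l ^ (J l : ℕ)) * a) • (1 : DiffForms k K)) = a • 1 := by
  have := X.gen a ha
  clear ha
  induction this using AddSubgroup.closure_induction with
  | mem a h =>
    obtain ⟨b, hb, e, rfl⟩ := h
    obtain ⟨J₀, hJ₀⟩ := exists_forall_dvd_add_iff (p := p) e
    have hJ : ∀ J : Fin r → Fin p, (∏ l, X.x l ^ (J l : ℕ)) * (b ^ p * ∏ l, X.x l ^ e l) =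
        b ^ p * ∏ l, X.x l ^ (e l + J l) := by
      intro J
      simp only [pow_add, Finset.prod_mul_distrib]
      ring
    simp only [hJ, projAll_monomial_one, hJ₀, smul_ite, smul_zero, Finset.sum_ite_eq',
      Finset.mem_univ, if_true]
    rw [← hJ, smul_smul, inv_mul_cancel_left₀]
    exact Finset.prod_ne_zero_iff.2 fun l _ => pow_ne_zero _ (X.ne_zero l)
  | zero => simp
  | add _ _ _ _ h h' =>
    simp only [mul_add, add_smul, map_add, smul_add, Finset.sum_add_distrib, h, h']
  | neg _ _ h =>
    simp only [mul_neg, neg_smul, map_neg, smul_neg, Finset.sum_neg_distrib, h]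

theorem exists_projAll_eq_pow (a : S) :
    ∃ b : S, X.projAll p ((a : K) • (1 : DiffForms k K)) = (b : K) ^ p • 1 := by
  obtain ⟨η, hη, h⟩ := X.projAll_mem (mem_localForms_zero.2 ⟨a, a.2, rfl⟩)
  obtain ⟨b, hb, rfl⟩ := mem_localForms_zero.1 hη
  exact ⟨⟨b, hb⟩, by rw [h, invC_smul, map_one]⟩

theorem pow_smul_one_injective {a b : K} (h : a ^ p • (1 : DiffForms k K) = b ^ p • 1) : a = b :=
  frobenius_inj K p (smul_one_injective h)

/-- The `p⁻¹`-linear coordinates of the elements of `S` in the basis of monomials over `Sᵖ`. -/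
theorem exists_coordinates (X : LogCoords p S r) : ∃ (φ : (Fin r → Fin p) → S →+ S) (y : (Fin r → Fin p) → S),
    (∀ J c a, φ J (c ^ p * a) = c * φ J a) ∧ ∀ a, a = ∑ J, φ J a ^ p * y J := by
  choose φ hφ using X.exists_projAll_eq_pow
  let x : (Fin r → Fin p) → S := fun J =>
    ⟨∏ l, X.x l ^ (J l : ℕ), prod_mem fun l _ => pow_mem (X.mem l) _⟩
  let y : (Fin r → Fin p) → S := fun J =>
    ⟨(∏ l, X.x l ^ (J l : ℕ))⁻¹, by
      rw [← Finset.prod_inv_distrib]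
      exact prod_mem fun l _ => by rw [← inv_pow]; exact pow_mem (X.inv_mem l) _⟩
  refine ⟨fun J =>
    { toFun := fun a => φ (x J * a)
      map_zero' := ?_
      map_add' := fun a b => ?_ }, y, fun J c a => ?_, fun a => ?_⟩
  · refine Subtype.ext (pow_smul_one_injective (k := k) (p := p) ?_)
    rw [← hφ]
    simp [zero_pow (Fact.out : p.Prime).ne_zero]
  · refine Subtype.ext (pow_smul_one_injective (k := k) (p := p) ?_)
    rw [← hφ, Subalgebra.coe_add, add_pow_char, add_smul, ← hφ, ← hφ, mul_add, Subalgebra.coe_add,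
      add_smul, map_add]
  · refine Subtype.ext (pow_smul_one_injective (k := k) (p := p) ?_)
    change ((φ (x J * (c ^ p * a)) : S) : K) ^ p • (1 : DiffForms k K) =
      ((c * φ (x J * a) : S) : K) ^ p • 1
    rw [← hφ, mul_left_comm, Subalgebra.coe_mul, Subalgebra.coe_pow, Subalgebra.coe_mul S c, mul_pow,
      X.projAll_pow_mul _ (x J * a).2, hφ, smul_smul]
  · refine Subtype.ext (smul_one_injective (k := k) ?_)
    rw [← X.sum_projAll a.2, AddSubmonoidClass.coe_finsetSum, Finset.sum_smul]
    refine Finset.sum_congr rfl fun J _ => ?_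
    have := hφ (x J * a)
    rw [Subalgebra.coe_mul] at this
    change _ = (((φ (x J * a) : S) : K) ^ p * (∏ l, X.x l ^ (J l : ℕ))⁻¹) • 1
    rw [mul_comm (_ ^ p), mul_smul _ (_ ^ p), ← this]

end LogCoords

section InvFrobLinear

/-- A `p⁻ᵉ`-linear map. -/
def IsInvFrobLinear {R : Type u} [CommRing R] (p e : ℕ) (φ : R →+ R) : Prop :=
  ∀ r a, φ (r ^ p ^ e * a) = r * φ a

variable {R : Type u} [CommRing R] {p e e' : ℕ}

theorem IsInvFrobLinear.comp {φ ψ : R →+ R} (hφ : IsInvFrobLinear p e φ)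
    (hψ : IsInvFrobLinear p e' ψ) : IsInvFrobLinear p (e + e') (ψ.comp φ) := fun r a => by
  rw [AddMonoidHom.comp_apply, pow_add, mul_comm (p ^ e), pow_mul, hφ, hψ]
  rfl

/-- The values at `c` of the `p⁻ᵉ`-linear endomorphisms of `R`. -/
def traceIdeal (p e : ℕ) (c : R) : Ideal R where
  carrier := {a | ∃ φ : R →+ R, IsInvFrobLinear p e φ ∧ φ c = a}
  zero_mem' := ⟨0, fun r a => by simp, rfl⟩
  add_mem' := by
    rintro _ _ ⟨φ, hφ, rfl⟩ ⟨ψ, hψ, rfl⟩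
    exact ⟨φ + ψ, fun r a => by
      rw [AddMonoidHom.add_apply, hφ, hψ, ← mul_add]; rfl, rfl⟩
  smul_mem' := by
    rintro b _ ⟨φ, hφ, rfl⟩
    exact ⟨(AddMonoidHom.mulLeft b).comp φ, fun r a => by
      
      change b * φ (r ^ p ^ e * a) = r * (b * φ a)
      rw [hφ]; ring, rfl⟩

theorem RingHom.Finite.exists_generators {A B : Type*} [CommRing A] [CommRing B] {f : A →+* B}
    (hf : f.Finite) : ∃ (t : ℕ) (g : Fin t → B), ∀ b, ∃ c : Fin t → A, b = ∑ l, f (c l) * g l := by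
  let _ : Algebra A B := f.toAlgebra
  have hf : Module.Finite A B := hf
  obtain ⟨t, g, hg⟩ := hf.exists_fin
  refine ⟨t, g, fun b => ?_⟩
  obtain ⟨c, hc⟩ := (Submodule.mem_span_range_iff_exists_fun A (x := b)).1 (hg ▸ Submodule.mem_top)
  exact ⟨c, hc.symm⟩

/-- Frobenius is integral, and it is of finite type because k is perfect; so it is finite. -/
theorem exists_finite_pow_generators {k : Type v} [Field k] [PerfectField k] [Algebra k R]
    [Algebra.FiniteType k R] (p : ℕ) [Fact p.Prime] [CharP k p] [CharP R p] :
    ∃ (t : ℕ) (g : Fin t → R), ∀ a, ∃ c : Fin t → R, a = ∑ l, c l ^ p * g l := by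
  have : PerfectRing k p := PerfectField.toPerfectRing p
  have h₁ : (frobenius R p).IsIntegral := fun x => by
    refine ⟨Polynomial.X ^ p - Polynomial.C x, Polynomial.monic_X_pow_sub_C x
      (Fact.out : p.Prime).ne_zero, by simp [frobenius_def]⟩
  have h₂ : (frobenius R p).FiniteType := by
    refine RingHom.FiniteType.of_comp_finiteType
      (f := (algebraMap k R).comp (frobeniusEquiv k p).symm.toRingHom) ?_
    have : (frobenius R p).comp ((algebraMap k R).comp (frobeniusEquiv k p).symm.toRingHom) =
        algebraMap k R := by
      ext a
      change (algebraMap k R ((frobeniusEquiv k p).symm a)) ^ p = _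
      rw [← map_pow]
      exact congrArg _ ((frobeniusEquiv k p).apply_symm_apply a)
    rw [this]
    exact RingHom.finiteType_algebraMap.2 inferInstance
  have h : (frobenius R p).Finite := h₁.to_finite h₂
  exact h.exists_generators

end InvFrobLinear

/-! ### Strong F-regularity of the smooth locus -/

section TestElements

variable {k : Type v} {R : Type u} [Field k] [CommRing R] [IsDomain R] [Algebra k R]

theorem algebraMap_mem_maximalIdeal_iff {P : PrimeSpectrum R} {a : R} :
    algebraMap R (localRingAt k P) a ∈ IsLocalRing.maximalIdeal (localRingAt k P) ↔
      a ∈ P.asIdeal :=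
  IsLocalization.AtPrime.to_map_mem_maximal_iff (localRingAt k P) P.asIdeal a

variable [PerfectField k] [Algebra.FiniteType k R] {p : ℕ} [Fact p.Prime] [CharP k p] [CharP R p]

/-- The coordinate maps of the local ring over its p-th powers carry R into R after multiplication
by one s ∉ P, since R is generated over Rᵖ by finitely many elements. Then sᵖ a is a combination of
the p-th powers of the T l a, so the order of vanishing is multiplied by p. -/
theorem exists_isInvFrobLinear_family {P : PrimeSpectrum R} (hP : P ∈ Algebra.smoothLocus k R) :
    ∃ (ι : Type) (T : ι → R →+ R), (∀ l, IsInvFrobLinear p 1 (T l)) ∧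
      ∀ (m : ℕ) (a : R),
        (∀ l, algebraMap R (localRingAt k P) (T l a) ∈
          IsLocalRing.maximalIdeal (localRingAt k P) ^ m) →
        algebraMap R (localRingAt k P) a ∈ IsLocalRing.maximalIdeal (localRingAt k P) ^ (p * m) := by
  have : CharP (FractionRing R) p := IsFractionRing.charP_of_isFractionRing R p
  obtain ⟨r, ⟨X⟩⟩ := exists_logCoords p hP
  obtain ⟨φ, y, hφ, hy⟩ := X.exists_coordinates
  obtain ⟨t, g, hg⟩ := exists_finite_pow_generators (k := k) (R := R) p
  obtain ⟨⟨s, hs⟩, hs'⟩ := IsLocalization.exist_integer_multiples_of_finite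
    P.asIdeal.primeCompl fun q : (Fin r → Fin p) × Fin t =>
      φ q.1 (algebraMap R (localRingAt k P) (g q.2))
  have hinj : Function.Injective (algebraMap R (localRingAt k P)) :=
    IsLocalization.injective _ P.asIdeal.primeCompl_le_nonZeroDivisors
  have hint : ∀ J a, ∃ b : R, algebraMap R (localRingAt k P) b =
      algebraMap R (localRingAt k P) s * φ J (algebraMap R (localRingAt k P) a) := by
    intro J a
    choose b hb using fun l => hs' (J, l)
    obtain ⟨c, hc⟩ := hg a
    refine ⟨∑ l, c l * b l, ?_⟩
    rw [hc, map_sum, map_sum, map_sum, Finset.mul_sum]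
    refine Finset.sum_congr rfl fun l _ => ?_
    rw [map_mul, hb, map_mul, map_pow, hφ, Algebra.smul_def]
    ring
  choose T hT using hint
  refine ⟨Fin r → Fin p, fun J =>
    { toFun := T J
      map_zero' := hinj (by rw [hT, map_zero, map_zero, mul_zero])
      map_add' := fun a b => hinj (by
        rw [hT, map_add, map_add, mul_add, map_add, hT, hT]) }, fun J c a => hinj ?_,
    fun m a h => ?_⟩
  · change algebraMap R (localRingAt k P) (T J (c ^ p ^ 1 * a)) =
      algebraMap R (localRingAt k P) (c * T J a)
    rw [hT, map_mul _ (_ ^ _), map_mul _ c, hT, pow_one, map_pow, hφ]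
    ring
  · have hu : IsUnit (algebraMap R (localRingAt k P) s ^ p) :=
      (IsLocalization.map_units (localRingAt k P) (⟨s, hs⟩ : P.asIdeal.primeCompl)).pow p
    rw [← Ideal.unit_mul_mem_iff_mem _ hu, hy (algebraMap R (localRingAt k P) a), Finset.mul_sum]
    refine sum_mem fun J _ => ?_
    rw [← mul_assoc, ← mul_pow, ← hT, mul_comm p, pow_mul]
    exact Ideal.mul_mem_right _ _ (Ideal.pow_mem_pow (h J) p)

/-- Composites of e maps from the family are p⁻ᵉ-linear. If all their values at a vanish at P,
undoing the maps one by one multiplies the order of vanishing by p each time. -/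
theorem mem_maximalIdeal_pow_of_traceIdeal_le {P : PrimeSpectrum R}
    (hP : P ∈ Algebra.smoothLocus k R) {e : ℕ} {a : R} (h : traceIdeal p e a ≤ P.asIdeal) :
    algebraMap R (localRingAt k P) a ∈ IsLocalRing.maximalIdeal (localRingAt k P) ^ p ^ e := by
  obtain ⟨ι, T, hT, key⟩ := exists_isInvFrobLinear_family (p := p) hP
  induction e generalizing a with
  | zero =>
    rw [pow_zero, pow_one, algebraMap_mem_maximalIdeal_iff]
    exact h ⟨AddMonoidHom.id R, fun r a => by simp, rfl⟩
  | succ e ih =>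
    rw [pow_succ']
    refine key _ a fun l => ih ?_
    rintro _ ⟨φ, hφ, rfl⟩
    refine h ⟨φ.comp (T l), ?_, rfl⟩
    rw [add_comm]
    exact (hT l).comp hφ

/-- Otherwise c would lie in every power of the maximal ideal, against Krull's intersection theorem.
-/
theorem exists_not_traceIdeal_le {P : PrimeSpectrum R} (hP : P ∈ Algebra.smoothLocus k R) {c : R}
    (hc : c ≠ 0) : ∃ e, ¬ traceIdeal p e c ≤ P.asIdeal := by
  by_contra! h
  have : IsNoetherianRing R := Algebra.FiniteType.isNoetherianRing k R
  have : IsNoetherianRing (localRingAt k P) :=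
    IsLocalization.isNoetherianRing P.asIdeal.primeCompl _ inferInstance
  have hbot := Ideal.iInf_pow_eq_bot_of_isLocalRing _
    (Ideal.IsPrime.ne_top' : IsLocalRing.maximalIdeal (localRingAt k P) ≠ ⊤)
  have hmem : algebraMap R (localRingAt k P) c ∈
      ⨅ i : ℕ, IsLocalRing.maximalIdeal (localRingAt k P) ^ i := by
    refine (Submodule.mem_iInf _).2 fun i => ?_
    exact Ideal.pow_le_pow_right (Nat.lt_pow_self (Fact.out : p.Prime).one_lt).le
      (mem_maximalIdeal_pow_of_traceIdeal_le (p := p) hP (h i))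
  rw [hbot, Ideal.mem_bot] at hmem
  exact hc (IsLocalization.injective (localRingAt k P) P.asIdeal.primeCompl_le_nonZeroDivisors
    (hmem.trans (map_zero _).symm))

/-- If all T l (φ c) vanish at P, then so does φ c. Hence the good points for c form an increasing
family in e, as the compactness argument requires. -/
theorem not_traceIdeal_succ_le {P : PrimeSpectrum R} (hP : P ∈ Algebra.smoothLocus k R) {c : R}
    {e : ℕ} (h : ¬ traceIdeal p e c ≤ P.asIdeal) : ¬ traceIdeal p (e + 1) c ≤ P.asIdeal := by
  obtain ⟨ι, T, hT, key⟩ := exists_isInvFrobLinear_family (p := p) hP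
  contrapose! h
  rintro _ ⟨φ, hφ, rfl⟩
  rw [← algebraMap_mem_maximalIdeal_iff (k := k)]
  have := key 1 (φ c) fun l => by
    rw [pow_one, algebraMap_mem_maximalIdeal_iff]
    exact h ⟨(T l).comp φ, hφ.comp (hT l), rfl⟩
  exact Ideal.pow_le_self (by simpa using (Fact.out : p.Prime).ne_zero) this

variable (k p) in
/-- Smooth points are strongly `F`-regular, uniformly in the point. -/
theorem exists_forall_not_traceIdeal_le {c : R} (hc : c ≠ 0) :
    ∃ e, ∀ P ∈ Algebra.smoothLocus k R, ¬ traceIdeal p e c ≤ P.asIdeal := by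
  have : IsNoetherianRing R := Algebra.FiniteType.isNoetherianRing k R
  have : Algebra.FinitePresentation k R := Algebra.FinitePresentation.of_finiteType.1 inferInstance
  have hmono : Monotone fun e => Algebra.smoothLocus k R ∩
      (PrimeSpectrum.zeroLocus (traceIdeal p e c : Set R))ᶜ :=
    monotone_nat_of_le_succ fun e P ⟨hP, h⟩ => ⟨hP, not_traceIdeal_succ_le hP h⟩
  obtain ⟨e, he⟩ := (TopologicalSpace.NoetherianSpace.isCompact
    (Algebra.smoothLocus k R)).elim_directed_cover _
    (fun e => Algebra.isOpen_smoothLocus.inter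
      (PrimeSpectrum.isClosed_zeroLocus (traceIdeal p e c : Set R)).isOpen_compl)
    (fun P hP => by
      obtain ⟨e, he⟩ := exists_not_traceIdeal_le (p := p) hP hc
      exact Set.mem_iUnion.2 ⟨e, hP, he⟩) hmono.directed_le
  exact ⟨e, fun P hP => (he hP).2⟩

end TestElements

/-! ### Changing the divisor in F-rationality -/

section FRational

variable {R : Type u} [CommRing R] [IsDomain R]

namespace EffCartierDiv

/-- The divisor of a nonzero function. -/
def principal (f : R) (hf : f ≠ 0) : EffCartierDiv R where
  ideal := Ideal.span {f}
  isUnit := by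
    have hf' : algebraMap R (FractionRing R) f ≠ 0 := fun h =>
      hf (IsFractionRing.injective R (FractionRing R) (h.trans (map_zero _).symm))
    rw [FractionalIdeal.coeIdeal_span_singleton]
    refine IsUnit.of_mul_eq_one
      (FractionalIdeal.spanSingleton R⁰ (algebraMap R (FractionRing R) f)⁻¹) ?_
    rw [FractionalIdeal.spanSingleton_mul_spanSingleton, mul_inv_cancel₀ hf',
      FractionalIdeal.spanSingleton_one]

theorem ideal_ne_bot (D : EffCartierDiv R) : D.ideal ≠ ⊥ := by
  intro h
  have := D.isUnit
  rw [h, FractionalIdeal.coeIdeal_bot] at this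
  exact not_isUnit_zero this

theorem exists_mul_eq (D : EffCartierDiv R) {c : R} (hc : c ∈ D.ideal) :
    ∃ μ : D.functions →ₗ[R] R, ∀ x : D.functions,
      algebraMap R (FractionRing R) (μ x) = c • (x : FractionRing R) := by
  have hinj := IsFractionRing.injective R (FractionRing R)
  have h : ∀ x : D.functions, ∃ a : R,
      algebraMap R (FractionRing R) a = c • (x : FractionRing R) := fun x => by
    obtain ⟨a, ha⟩ := x.2 c hc
    exact ⟨a, by rw [← ha, LinearMap.toSpanSingleton_apply, Algebra.algebraMap_eq_smul_one]⟩
  choose μ hμ using h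
  exact ⟨{ toFun := μ
           map_add' := fun x y => hinj (by
             rw [map_add, hμ, hμ, hμ, Submodule.coe_add, smul_add])
           map_smul' := fun a x => hinj (by
             rw [smul_eq_mul, map_mul, hμ, hμ, RingHom.id_apply, Submodule.coe_smul, smul_comm,
               ← Algebra.smul_def]) }, hμ⟩

/-- Multiplication by c maps O_X(D') to R. With 1 = ∑ aₗ bₗ and aₗ = φₗ(c), the map x ↦ ∑ φₗ(c x) bₗ
sends 1 to 1. -/
theorem exists_invFrobLinear_map {p e : ℕ} {D D' : EffCartierDiv R} {c : R} (hc : c ∈ D'.ideal)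
    (h : D.ideal ≤ traceIdeal p e c) : ∃ ψ : D'.functions →+ D.functions,
      (∀ (a : R) (x : D'.functions), ψ (a ^ p ^ e • x) = a • ψ x) ∧
        ψ (D'.inclFunctions 1) = D.inclFunctions 1 := by
  obtain ⟨μ, hμ⟩ := D'.exists_mul_eq hc
  obtain ⟨t, a, b, ha, hb, hab⟩ := D.exists_sum_eq_one
  choose φ hφ hφc using fun l => h (ha l)
  refine ⟨∑ l, ((LinearMap.toSpanSingleton R D.functions ⟨b l, hb l⟩).toAddMonoidHom.comp
    (φ l)).comp μ.toAddMonoidHom, fun a x => ?_, ?_⟩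
  · simp only [AddMonoidHom.finsetSum_apply, Finset.smul_sum]
    refine Finset.sum_congr rfl fun l _ => ?_
    change φ l (μ (a ^ p ^ e • x)) • (⟨b l, hb l⟩ : D.functions) =
      a • (φ l (μ x) • (⟨b l, hb l⟩ : D.functions))
    rw [map_smul, smul_eq_mul, hφ, mul_smul]
  · have h1 : μ (D'.inclFunctions 1) = c := by
      refine IsFractionRing.injective R (FractionRing R) ?_
      rw [hμ, Algebra.algebraMap_eq_smul_one c]
      exact congrArg (c • ·) (map_one (algebraMap R (FractionRing R)))
    refine Subtype.ext ?_
    rw [AddMonoidHom.finsetSum_apply, AddSubmonoidClass.coe_finsetSum]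
    refine Eq.trans (Finset.sum_congr rfl fun l _ => ?_) (hab.trans
      (map_one (algebraMap R (FractionRing R))).symm)
    change φ l (μ (D'.inclFunctions 1)) • b l = _
    rw [h1, hφc]

theorem inclFunctions_eq_smul (D : EffCartierDiv R) (a : R) :
    D.inclFunctions a = a • D.inclFunctions 1 := by
  rw [← map_smul, smul_eq_mul, mul_one]

end EffCartierDiv

/-- If there is a `p⁻ᵉ`-linear map `O_X(D') → O_X(D)` with `1 ↦ 1`, then the injectivity condition in
the definition of `F`-rationality passes from `D` to `D'`. -/
theorem injective_of_invFrobLinear_map {p e n : ℕ} [Fact p.Prime] [CharP R p]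
    {D D' : EffCartierDiv R} (ψ : D'.functions →+ D.functions)
    (hψ : ∀ (a : R) (x : D'.functions), ψ (a ^ p ^ e • x) = a • ψ x)
    (hψ1 : ψ (D'.inclFunctions 1) = D.inclFunctions 1) (I : Ideal R) (j : ℕ)
    (h : Function.Injective ((LocCoh.map I j (FrobPush.map p n D.inclFunctions)).comp
      (LocCoh.map I j (frobMap R p n)))) :
    Function.Injective ((LocCoh.map I j (FrobPush.map p (n + e) D'.inclFunctions)).comp
      (LocCoh.map I j (frobMap R p (n + e)))) := by
  let Ψ : FrobPush R p (n + e) D'.functions →ₗ[R] FrobPush R p n D.functions :=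
    { toFun := ψ
      map_add' := map_add ψ
      map_smul' := fun a x => by
        change ψ (iterateFrobenius R p (n + e) a • (show D'.functions from x)) =
          iterateFrobenius R p n a • ψ x
        rw [iterateFrobenius_def, iterateFrobenius_def, pow_add, pow_mul]
        exact hψ _ _ }
  have hΨ : Ψ ∘ₗ FrobPush.map p (n + e) D'.inclFunctions ∘ₗ frobMap R p (n + e) =
      FrobPush.map p n D.inclFunctions ∘ₗ frobMap R p n := by
    refine LinearMap.ext fun a => ?_
    change ψ (D'.inclFunctions (iterateFrobenius R p (n + e) a)) =
      D.inclFunctions (iterateFrobenius R p n a)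
    rw [EffCartierDiv.inclFunctions_eq_smul, EffCartierDiv.inclFunctions_eq_smul D,
      iterateFrobenius_def, iterateFrobenius_def, pow_add, pow_mul, hψ, hψ1]
  refine Function.Injective.of_comp (f := LocCoh.map I j Ψ) ?_
  convert h using 1
  funext z
  simp only [Function.comp_apply, AddMonoidHom.comp_apply, LocCoh.map_comp_apply]
  exact congrArg (fun f => LocCoh.map I j f z) hΨ

/-- It suffices to test `F`-rationality on the multiples of a divisor containing the singular locus. -/
theorem isFRational_of_containsSing {k : Type v} [Field k] [PerfectField k] [Algebra k R]
    [Algebra.FiniteType k R] {p : ℕ} [Fact p.Prime] [CharP k p] [CharP R p] {d : ℕ}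
    {D : EffCartierDiv R} (hD : D.ContainsSing k)
    (h : ∀ 𝔪 : Ideal R, 𝔪.IsMaximal → ∀ r > 0, ∃ n₀ > 0, ∀ j ≤ d, ∀ n ≥ n₀,
      Function.Injective ((LocCoh.map 𝔪 j (FrobPush.map p n (D.mult r).inclFunctions)).comp
        (LocCoh.map 𝔪 j (frobMap R p n)))) : IsFRational R p d := by
  intro 𝔪 h𝔪 D'
  obtain ⟨c, hc, hc0⟩ := Submodule.exists_mem_ne_zero_of_ne_bot D'.ideal_ne_bot
  obtain ⟨e, he⟩ := exists_forall_not_traceIdeal_le k p hc0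
  obtain ⟨N, hN⟩ := exists_pow_le_of_containsSing hD he
  -- The multiple N + 1 replaces N, because the hypothesis only covers positive multiples.
  obtain ⟨ψ, hψ, hψ1⟩ := EffCartierDiv.exists_invFrobLinear_map (D := D.mult (N + 1)) hc
    ((Ideal.pow_le_pow_right N.le_succ).trans hN)
  obtain ⟨n₀, h0, hn₀⟩ := h 𝔪 h𝔪 (N + 1) N.succ_pos
  refine ⟨n₀ + e, by omega, fun j hj n hn => ?_⟩
  obtain ⟨n, rfl⟩ : ∃ n', n = n' + e := ⟨n - e, by omega⟩
  exact injective_of_invFrobLinear_map ψ hψ hψ1 𝔪 j (hn₀ j hj n (by omega))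

end FRational

/-! ### Comparison of the twisted maps, δ and the Cartier operator -/

section AddMonoidHom

variable {A B C D D' Z : Type*} [AddCommGroup A] [AddCommGroup B] [AddCommGroup C] [AddCommGroup D]
  [AddCommGroup D'] [AddCommGroup Z]

theorem AddMonoidHom.injective_comp_of_comm {g : A →+ B} {t : B →+ C} {δ : B →+ D} {δ' : C →+ D'}
    {τ : D →+ D'} (hτ : Function.Injective τ) (h : ∀ z, δ' (t z) = τ (δ z))
    (hδ : Function.Injective (δ.comp g)) : Function.Injective (t.comp g) := by
  refine (injective_iff_map_eq_zero _).2 fun z hz => (injective_iff_map_eq_zero _).1 hδ z ?_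
  refine (injective_iff_map_eq_zero _).1 hτ _ ?_
  rw [AddMonoidHom.comp_apply, ← h, show t (g z) = 0 from hz, map_zero]

theorem AddMonoidHom.injective_comp_iff_eq_zero {g : A →+ B} {δ : B →+ D} {c : Z →+ A}
    {e : A →+ D} (h : ∀ z, δ (g z) = e z) (h₁ : ∀ w, e (c w) = 0)
    (h₂ : ∀ z, e z = 0 → ∃ w, c w = z) : Function.Injective (δ.comp g) ↔ c = 0 := by
  rw [injective_iff_map_eq_zero]
  constructor
  · exact fun H => AddMonoidHom.ext fun w => H _ ((h _).trans (h₁ w))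
  · intro H z hz
    obtain ⟨w, rfl⟩ := h₂ z ((h z).symm.trans hz)
    rw [H, AddMonoidHom.zero_apply]

theorem AddMonoidHom.eq_zero_of_injective_comp {g : A →+ B} {t : B →+ C} {c : Z →+ A}
    (h : Function.Injective (t.comp g)) (h₀ : ∀ w, t (g (c w)) = 0) : c = 0 :=
  AddMonoidHom.ext fun w => (injective_iff_map_eq_zero _).1 h _ (h₀ w)

end AddMonoidHom

namespace LocCoh

section ConnOfExact

variable {R : Type u} [CommRing R] {I : Ideal R} {j : ℕ} {A B C A' B' C' : Type u}
  [AddCommGroup A] [Module R A] [AddCommGroup B] [Module R B] [AddCommGroup C] [Module R C]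
  [AddCommGroup A'] [Module R A'] [AddCommGroup B'] [Module R B'] [AddCommGroup C'] [Module R C']
  {f : A →ₗ[R] B} {g : B →ₗ[R] C} {f' : A' →ₗ[R] B'} {g' : B' →ₗ[R] C'}

/-- A pair of composable maps with composition zero, as a short complex. -/
abbrev seqOfMaps (f : A →ₗ[R] B) (g : B →ₗ[R] C) (h : Function.Exact f g) :
    ShortComplex (ModuleCat.{u} R) where
  X₁ := ModuleCat.of R A
  X₂ := ModuleCat.of R B
  X₃ := ModuleCat.of R C
  f := ModuleCat.ofHom f
  g := ModuleCat.ofHom g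
  zero := ModuleCat.hom_ext (LinearMap.ext h.apply_apply_eq_zero)

theorem seqOfMaps_shortExact (hf : Function.Injective f) (hg : Function.Surjective g)
    (h : Function.Exact f g) : (seqOfMaps f g h).ShortExact where
  exact := by
    rw [ShortComplex.moduleCat_exact_iff_range_eq_ker]
    exact (LinearMap.exact_iff.1 h).symm
  mono_f := (ModuleCat.mono_iff_injective _).2 hf
  epi_g := (ModuleCat.epi_iff_surjective _).2 hg

variable (I j) in
/-- The connecting map of `0 → A → B → C → 0`. -/
def connOfExact (hf : Function.Injective f) (hg : Function.Surjective g) (h : Function.Exact f g) :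
    LocCoh I j C →+ LocCoh I (j + 1) A :=
  conn (seqOfMaps_shortExact hf hg h) j

theorem δ_eq_connOfExact (D : Submodule R A) : δ I j D =
    connOfExact I j D.subtype_injective D.mkQ_surjective (LinearMap.exact_subtype_mkQ D) := rfl

theorem connOfExact_naturality (hf : Function.Injective f) (hg : Function.Surjective g)
    (h : Function.Exact f g) (hf' : Function.Injective f') (hg' : Function.Surjective g')
    (h' : Function.Exact f' g') {α : A →ₗ[R] A'} {β : B →ₗ[R] B'} {γ : C →ₗ[R] C'}
    (h₁ : ∀ x, f' (α x) = β (f x)) (h₂ : ∀ x, g' (β x) = γ (g x)) (z : LocCoh I j C) :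
    connOfExact I j hf' hg' h' (map I j γ z) = map I (j + 1) α (connOfExact I j hf hg h z) := by
  let φ : seqOfMaps f g h ⟶ seqOfMaps f' g' h' :=
    { τ₁ := ModuleCat.ofHom α
      τ₂ := ModuleCat.ofHom β
      τ₃ := ModuleCat.ofHom γ
      comm₁₂ := ModuleCat.hom_ext (LinearMap.ext h₁)
      comm₂₃ := ModuleCat.hom_ext (LinearMap.ext h₂) }
  unfold connOfExact
  exact conn_naturality (seqOfMaps_shortExact hf hg h) (seqOfMaps_shortExact hf' hg' h') φ z

theorem connOfExact_map (hf : Function.Injective f) (hg : Function.Surjective g)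
    (h : Function.Exact f g) (z : LocCoh I j B) : connOfExact I j hf hg h (map I j g z) = 0 := by
  unfold connOfExact
  exact conn_map (seqOfMaps_shortExact hf hg h) z

theorem exists_map_eq_of_connOfExact (hf : Function.Injective f) (hg : Function.Surjective g)
    (h : Function.Exact f g) (z : LocCoh I j C) (hz : connOfExact I j hf hg h z = 0) :
    ∃ w, map I j g w = z := by
  unfold connOfExact at hz
  exact exists_map_eq (seqOfMaps_shortExact hf hg h) z hz

end ConnOfExact

variable {R : Type u} [CommRing R] {I : Ideal R} {j : ℕ} {M N Q : Type u} [AddCommGroup M]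
  [Module R M] [AddCommGroup N] [Module R N] [AddCommGroup Q] [Module R Q]

/-- As f is injective, B is isomorphic to its image, so by naturality δ followed by an isomorphism
factors through H^j(t). -/
theorem injective_of_injective_δ {B : Submodule R M} {g : Q →ₗ[R] M ⧸ B} {f : M →ₗ[R] N}
    (hf : Function.Injective f) {t : M ⧸ B →ₗ[R] N ⧸ B.map f}
    (ht : ∀ x, t (B.mkQ x) = (B.map f).mkQ (f x))
    (h : Function.Injective ((δ I j B).comp (map I j g))) :
    Function.Injective ((map I j t).comp (map I j g)) := by
  have hτ : Function.Bijective (f.submoduleMap B) :=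
    ⟨fun x y hxy => Subtype.ext (hf (congrArg Subtype.val hxy)), f.submoduleMap_surjective _⟩
  refine AddMonoidHom.injective_comp_of_comm (map_bijective I (j + 1) hτ).1
    (δ := δ I j B) (δ' := δ I j (B.map f)) (fun z => ?_) h
  rw [δ_eq_connOfExact, δ_eq_connOfExact]
  exact connOfExact_naturality B.subtype_injective B.mkQ_surjective (LinearMap.exact_subtype_mkQ B)
    (B.map f).subtype_injective (B.map f).mkQ_surjective (LinearMap.exact_subtype_mkQ (B.map f))
    (β := f) (fun _ => rfl) (fun x => (ht x).symm) z

/-- For submodules `B ≤ Z ≤ M` and a surjective map `c : Z → Q` with kernel `B`, the connecting map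
of `0 → B → Z → Q → 0` factors through the induced map `Q → M / B`. -/
theorem injective_δ_comp_iff {B Z : Submodule R M} (hBZ : B ≤ Z) {c : Z →ₗ[R] Q}
    (hc : Function.Surjective c) (hker : LinearMap.ker c = B.comap Z.subtype) {g : Q →ₗ[R] M ⧸ B}
    (hg : ∀ z : Z, g (c z) = B.mkQ z.1) :
    Function.Injective ((δ I j B).comp (map I j g)) ↔ map I j c = 0 := by
  have hex : Function.Exact (Submodule.inclusion hBZ) c :=
    LinearMap.exact_iff.2 (hker.trans (Submodule.range_inclusion B Z hBZ).symm)
  have hinj := Submodule.inclusion_injective hBZ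
  -- By exactness the kernel of this connecting map is the image of H^j(c).
  refine AddMonoidHom.injective_comp_iff_eq_zero (e := connOfExact I j hinj hc hex) (fun z => ?_)
    (connOfExact_map hinj hc hex) (exists_map_eq_of_connOfExact hinj hc hex)
  rw [δ_eq_connOfExact, connOfExact_naturality hinj hc hex B.subtype_injective
    B.mkQ_surjective (LinearMap.exact_subtype_mkQ B) (α := LinearMap.id)
    (β := Z.subtype) (fun _ => rfl) (fun x => (hg x).symm), map_id_apply]

/-- The injective composite, precomposed with H^j(c), passes through H^j(f) = 0. Here f will be the
inclusion into a twist. -/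
theorem map_eq_zero_of_injective {Z L V W : Type u} [AddCommGroup Z] [Module R Z] [AddCommGroup L]
    [Module R L] [AddCommGroup V] [Module R V] [AddCommGroup W] [Module R W] {c : Z →ₗ[R] Q}
    {g : Q →ₗ[R] L} {t : L →ₗ[R] V} {s : Z →ₗ[R] M} {f : M →ₗ[R] W} {q : W →ₗ[R] V}
    (hf : ∀ z : LocCoh I j M, map I j f z = 0)
    (h : Function.Injective ((map I j t).comp (map I j g)))
    (hcomm : (t ∘ₗ g) ∘ₗ c = (q ∘ₗ f) ∘ₗ s) : map I j c = 0 := by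
  refine AddMonoidHom.eq_zero_of_injective_comp h fun w => ?_
  rw [map_comp_apply, map_comp_apply, hcomm, ← map_comp_apply, ← map_comp_apply, hf, map_zero]

end LocCoh

section Connecting

variable {k : Type v} {R : Type u} [Field k] [CommRing R] [IsDomain R] [Algebra k R] {p : ℕ}
  [Fact p.Prime] [CharP R p]

theorem inclTwist_injective (i : ℕ) (D : EffCartierDiv R) :
    Function.Injective (inclTwist k i D) := fun _ _ h =>
  Subtype.ext (congrArg (fun ω : reflFormsTwist k i D => (ω : DiffForms k (FractionRing R))) h)

theorem injective_natTwist_of_injective_δ {n i : ℕ} {I : Ideal R} {j : ℕ} (D : EffCartierDiv R)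
    (h : Function.Injective ((LocCoh.δ I j (reflBoundaries k R p n i)).comp
        (LocCoh.map I j (invCartier k R p n i)))) :
    Function.Injective ((LocCoh.map I j (natTwist k R p n i D)).comp
        (LocCoh.map I j (invCartier k R p n i))) :=
  LocCoh.injective_of_injective_δ (M := PushForms k R p n i) (N := PushFormsTwist k R p n i D)
    (B := reflBoundaries k R p n i) (g := invCartier k R p n i)
    (f := FrobPush.map p n (inclTwist k i D)) (inclTwist_injective i D)
    (t := natTwist k R p n i D) (fun _ => rfl) h

variable [PerfectField k] [Algebra.FiniteType k R] [CharP k p]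

theorem injective_δ_iff {n i : ℕ} (h : Function.Surjective (cartier k R p n i)) (I : Ideal R)
    (j : ℕ) :
    Function.Injective ((LocCoh.δ I j (reflBoundaries k R p n i)).comp
        (LocCoh.map I j (invCartier k R p n i))) ↔ LocCoh.map I j (cartier k R p n i) = 0 :=
  LocCoh.injective_δ_comp_iff (reflBoundaries_le_reflCycles n i) h (ker_cartier n i)
    (invCartier_cartier h)

theorem map_cartier_eq_zero_of_injective {n i : ℕ} (hC : Function.Surjective (cartier k R p n i))
    {I : Ideal R} {j : ℕ} {D : EffCartierDiv R}
    (hD : ∀ z : LocCoh I j (PushForms k R p n i),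
      LocCoh.map I j (FrobPush.map p n (inclTwist k i D)) z = 0)
    (h : Function.Injective ((LocCoh.map I j (natTwist k R p n i D)).comp
        (LocCoh.map I j (invCartier k R p n i)))) : LocCoh.map I j (cartier k R p n i) = 0 :=
  LocCoh.map_eq_zero_of_injective hD h (c := cartier k R p n i) (s := (reflCycles k R p n i).subtype)
    (q := Submodule.mkQ _)
    (LinearMap.ext fun ω => congrArg (natTwist k R p n i D) (invCartier_cartier hC ω))

end Connecting

end

/-! ### The equivalence -/

theorem isPreFRational_iff {k : Type*} {R : Type*} [Field k] [CommRing R] [IsDomain R]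
    [Algebra k R] (p : ℕ) [Fact p.Prime] [CharP R p] (m d : ℕ) :
    IsPreFRational k R p m d ↔ (∀ i ≤ m, Function.Surjective (cartier k R p 1 i)) ∧
      ∀ 𝔪 : Ideal R, 𝔪.IsMaximal → ∀ D : EffCartierDiv R, ∃ n₀ > 0, ∀ i j n : ℕ,
        i ≤ m → i + j ≤ d → n₀ ≤ n →
        Function.Injective ((LocCoh.map 𝔪 j (natTwist k R p n i D)).comp
          (LocCoh.map 𝔪 j (invCartier k R p n i))) :=
  Iff.rfl

set_option maxHeartbeats 1000000 in
theorem theoremA {k : Type*} {R : Type*} [Field k] [PerfectField k] [CommRing R] [IsDomain R]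
    [Algebra k R] [Algebra.FiniteType k R] [IsIntegrallyClosed R]
    (p : ℕ) [Fact p.Prime] [CharP k p] [CharP R p]
    (d : ℕ) (hd : ringKrullDim R = d) (m : ℕ) (hm : 0 < m)
    (hC : ∀ i ≤ m, Function.Surjective (cartier k R p 1 i)) :
    List.TFAE [
      IsPreFRational k R p m d,
      ∃ D : EffCartierDiv R, D.ContainsSing k ∧
        ∀ 𝔪 : Ideal R, 𝔪.IsMaximal → ∀ r > 0, ∃ n₀ > 0, ∀ i j n : ℕ,
          i ≤ m → i + j ≤ d → n₀ ≤ n →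
          Function.Injective
            ((LocCoh.map 𝔪 j (natTwist k R p n i (D.mult r))).comp
              (LocCoh.map 𝔪 j (invCartier k R p n i))),
      IsFRational R p d ∧
        ∀ 𝔪 : Ideal R, 𝔪.IsMaximal → ∃ n₀ > 0, ∀ i j n : ℕ,
          0 < i → i ≤ m → i + j ≤ d → n₀ ≤ n →
          Function.Injective
            ((LocCoh.δ 𝔪 j (reflBoundaries k R p n i)).comp
              (LocCoh.map 𝔪 j (invCartier k R p n i))),
      IsFRational R p d ∧
        ∀ 𝔪 : Ideal R, 𝔪.IsMaximal → ∃ n₀ > 0, ∀ i j n : ℕ,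
          0 < i → i ≤ m → i + j ≤ d → n₀ ≤ n →
          LocCoh.map 𝔪 j (cartier k R p n i) = 0] := by
  rw [isPreFRational_iff]
  have hCn : ∀ n, ∀ i ≤ m, Function.Surjective (cartier k R p n i) := fun n i hi =>
    cartier_surjective (hC i hi) n
  tfae_have 1 → 2 := by
    rintro ⟨-, h⟩
    -- A principal divisor through Sing(X) suffices, as every D is allowed in the first condition.
    obtain ⟨f, hf, hf'⟩ := exists_ne_zero_forall_mem k R
    refine ⟨EffCartierDiv.principal f hf, fun P hP => ?_,
      fun 𝔪 h𝔪 r _ => h 𝔪 h𝔪 ((EffCartierDiv.principal f hf).mult r)⟩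
    rw [EffCartierDiv.principal, PrimeSpectrum.zeroLocus_span, PrimeSpectrum.mem_zeroLocus,
      Set.singleton_subset_iff]
    by_contra hfP
    exact hP (hf' P hfP)
  tfae_have 2 → 4 := by
    rintro ⟨D, hD, h⟩
    refine ⟨isFRational_of_containsSing hD fun 𝔪 h𝔪 r hr => ?_, fun 𝔪 h𝔪 => ?_⟩
    -- Degree i = 0 is the F-rationality condition for the multiples of D.
    · obtain ⟨n₀, h0, hn₀⟩ := h 𝔪 h𝔪 r hr
      exact ⟨n₀, h0, fun j hj n hn => (injective_degree_zero_iff (hCn n 0 m.zero_le) _ _ _).1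
        (hn₀ 0 j n m.zero_le (by omega) hn)⟩
    · choose N hN using fun i => exists_forall_map_inclTwist_mult_eq_zero (p := p) hd hD 𝔪 i
      -- One multiple r D whose twist annihilates in all degrees i ≤ m at once; adding 1 makes r
      -- positive.
      obtain ⟨r, hr, hNr⟩ : ∃ r > 0, ∀ i ≤ m, N i ≤ r :=
        ⟨(Finset.range (m + 1)).sup N + 1, Nat.succ_pos _, fun i hi => (Finset.le_sup (f := N)
          (Finset.mem_range.2 (Nat.lt_succ_of_le hi))).trans (Nat.le_succ _)⟩
      obtain ⟨n₀, h0, hn₀⟩ := h 𝔪 h𝔪 r hr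
      refine ⟨n₀, h0, fun i j n hi him hij hn => ?_⟩
      -- From i > 0 and i + j ≤ d one gets j < d, the range in which annihilation holds.
      have hz := hN i r (hNr i him) n j (by omega)
      have hinj := hn₀ i j n him hij hn
      exact map_cartier_eq_zero_of_injective (k := k) (R := R) (p := p) (n := n) (i := i) (I := 𝔪)
        (j := j) (D := D.mult r) (hCn n i him) hz hinj
  tfae_have 4 → 3 := by
    rintro ⟨hF, h⟩
    refine ⟨hF, fun 𝔪 h𝔪 => ?_⟩
    obtain ⟨n₀, h0, hn₀⟩ := h 𝔪 h𝔪
    exact ⟨n₀, h0, fun i j n hi him hij hn =>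
      (injective_δ_iff (hCn n i him) 𝔪 j).2 (hn₀ i j n hi him hij hn)⟩
  tfae_have 3 → 1 := by
    rintro ⟨hF, h⟩
    refine ⟨hC, fun 𝔪 h𝔪 D => ?_⟩
    obtain ⟨n₁, h1, hn₁⟩ := hF 𝔪 h𝔪 D
    obtain ⟨n₂, h2, hn₂⟩ := h 𝔪 h𝔪
    refine ⟨max n₁ n₂, lt_max_of_lt_left h1, fun i j n him hij hn => ?_⟩
    -- F-rationality covers i = 0, with a bound depending on D; for i > 0 the bound from δ does not
    -- depend on D.
    rcases Nat.eq_zero_or_pos i with rfl | hi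
    · exact (injective_degree_zero_iff (hCn n 0 him) D 𝔪 j).2
        (hn₁ j (by omega) n ((le_max_left _ _).trans hn))
    · exact injective_natTwist_of_injective_δ D
        (hn₂ i j n hi him hij ((le_max_right _ _).trans hn))
  tfae_finish
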